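/- Let $n\ge 2$, $s\in(0,1)$ and $a=1-2s\in(-1,1)$. Write points of $\mathbb R^{n+1}$ as $(x,y)$ with $x\in\mathbb R^n$, $y\in\mathbb R$, and $|(x,y)|=(|x|^2+y^2)^{1/2}$. Let $$h(x,y)=\frac{\nu_{n+1+a}}{(|x|^2+y^2)^{\frac{n-1+a}{2}}},\qquad \nu_k=\frac{\pi^{k/2}\,\Gamma\!\left(\frac{k-1}{2}\right)}{4}.$$ Let $W^{1,2}(\mathbb R^{n+1}_+,y^a)$ be the closure of $C_c^\infty(\{y\ge 0\})$ in the norm $\big(\int_{y>0}y^a(|u|^2+|\nabla u|^2)\,dx\,dy\big)^{1/2}$. For $A\subset\mathbb R^n$ let $$\mathrm{cap}_s(A)=\inf\Big\{\int_{y>0}y^a|\nabla u|^2\,dx\,dy\;;\;u\in W^{1,2}(\mathbb R^{n+1}_+,y^a),\ u(x,0)\ge 1\ \text{for all }x\in A\Big\},$$ where $u(x,0)$ is the limit as $r\to0$ of the averages of $u$, with respect to $y^a\,dx\,dy$, over the half balls $\{|(\cdot)-(x,0)|<r,\ y>0\}$. A function $\varphi$ is called an $s$-capacitary potential of $A$ if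 it attains this infimum, the minimizer being taken in the closure of the admissible set with respect to convergence of gradients in $L^2(y^a\,dx\,dy)$ and of functions in $L^2(y^a\,dx\,dy)$ on bounded sets. There is a constant $\mu_{n,a}>0$ with $\mathrm{div}(|y|^a\nabla h)=-\mu_{n,a}\,\delta_{0}$ in the sense of distributions on $\mathbb R^{n+1}$, and the following holds. For all $M>0$ and $\delta>0$ there is $R_\delta>0$, depending only on $n$, $a$, $M$, $\delta$, such that the following is true. Let $(\Omega,\mathcal F,P)$ be a probability space and let $S_\varepsilon(k,\omega)\subset\mathbb R^n$ ($\varepsilon>0$, $k\in\mathbb Z^n$, $\omega\in\Omega$) be sets for which there are numbers $\gamma(k,\omega)\in[0,\infty)$, independent of $\varepsilon$, with $$\mathrm{cap}_s(S_\varepsilon(k,\omega))=\varepsilon^n\gamma(k,\omega)\quad\text{for all }\varepsilon>0,\ k\in\mathbb Z^n,\ \omega\in\Omega,$$ and, for almost every $\omega$, $$S_\varepsilon(k,\omega)\subset\{x\in\mathbb R^n:\ |x-\varepsilon k|\le M\varepsilon^{\frac{n}{n-1+a}}\}\quad\text{for all }\varepsilon>0,\ k\in\mathbb Z^n.$$ Then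 for almost every $\omega$, for all $\varepsilon>0$ and $k\in\mathbb Z^n$, every $s$-capacitary potential $\varphi^\varepsilon_k(\cdot,\cdot,\omega)$ of $S_\varepsilon(k,\omega)$ has a representative that is continuous on the set of all $(x,y)$ with $y\ge 0$ and $|(x-\varepsilon k,y)|\ge R_\delta\,\varepsilon^{\frac{n}{n-1+a}}$ and satisfies, at every point $(x,y)$ of that set, $$\Big|\varphi^\varepsilon_k(x,y,\omega)-\varepsilon^n\gamma(k,\omega)\frac{2}{\mu_{n,a}}h(x-\varepsilon k,y)\Big|\le\delta\,\varepsilon^n\gamma(k,\omega)\frac{2}{\mu_{n,a}}h(x-\varepsilon k,y).$$ -/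

import Mathlib

open MeasureTheory Filter Topology Set
open scoped ENNReal NNReal

noncomputable section

namespace FracCap

/-- The space `ℝⁿ⁺¹ = ℝⁿ × ℝ` with points `(x, y)`. As a type, the product carries the sup norm;
all metric notions below go through `euclNorm` and `euclDot` instead. -/
abbrev Pt (n : ℕ) : Type := EuclideanSpace ℝ (Fin n) × ℝ

/-- The Euclidean norm `|(x, y)| = (|x|² + y²)^{1/2}`. -/
def euclNorm {n : ℕ} (z : Pt n) : ℝ := Real.sqrt (‖z.1‖ ^ 2 + z.2 ^ 2)

/-- The Euclidean inner product on `ℝⁿ × ℝ`. -/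
def euclDot {n : ℕ} (z w : Pt n) : ℝ := inner ℝ z.1 w.1 + z.2 * w.2

/-- The Euclidean gradient `∇f = (∇ₓ f, ∂_y f)`. -/
def euclGrad {n : ℕ} (f : Pt n → ℝ) (z : Pt n) : Pt n :=
  (gradient (fun x => f (x, z.2)) z.1, deriv (fun y => f (z.1, y)) z.2)

/-- The open Euclidean ball of radius `r` in `ℝⁿ⁺¹`. -/
def euclBall {n : ℕ} (c : Pt n) (r : ℝ) : Set (Pt n) := {z | euclNorm (z - c) < r}

/-- The measure `y^a dx dy` on the half space `{y > 0}`. -/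
def halfMeasure (n : ℕ) (a : ℝ) : Measure (Pt n) :=
  (volume.restrict {z : Pt n | 0 < z.2}).withDensity (fun z => ENNReal.ofReal (z.2 ^ a))

/-- `C_c^∞(ℝⁿ⁺¹)`; its restrictions to `{y ≥ 0}` are the smooth functions with compact support
in the closed half space (they need not vanish on `{y = 0}`). -/
def IsTest {n : ℕ} (ψ : Pt n → ℝ) : Prop := ContDiff ℝ ((⊤ : ℕ∞) : WithTop ℕ∞) ψ ∧ HasCompactSupport ψ

/-- `u` lies in the weighted Sobolev space `W^{1,2} = W_0^{1,2}` of the closed half space with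
weight `y^a` and has gradient `g`: the pair `(u, g)` is a limit of `(ψ_j, ∇ψ_j)` in
`L²(y^a dx dy)`, with `ψ_j` smooth and compactly supported in the closed half space.
(For `-1 < a < 1` the weight is of Muckenhoupt class `A₂`, and this is the same space as the one
given by weak derivatives.) -/
def IsSobolev {n : ℕ} (a : ℝ) (u : Pt n → ℝ) (g : Pt n → Pt n) : Prop :=
  MemLp u 2 (halfMeasure n a) ∧ MemLp g 2 (halfMeasure n a) ∧
  ∃ ψ : ℕ → Pt n → ℝ, (∀ j, IsTest (ψ j)) ∧
    Tendsto (fun j => eLpNorm (fun z => ψ j z - u z) 2 (halfMeasure n a)) atTop (𝓝 0) ∧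
    Tendsto (fun j => eLpNorm (fun z => euclGrad (ψ j) z - g z) 2 (halfMeasure n a)) atTop (𝓝 0)

/-- The Dirichlet energy `∫_{y > 0} y^a |g|² dx dy` of a function with gradient `g`. -/
def energy {n : ℕ} (a : ℝ) (g : Pt n → Pt n) : ℝ≥0∞ :=
  ∫⁻ z, ENNReal.ofReal (euclNorm (g z) ^ 2) ∂(halfMeasure n a)

/-- `u(x, 0) = t`: the value at the boundary point `(x, 0)` of the precise representative of `u`,
i.e. the limit of the averages of `u` over the half balls centred at `(x, 0)`. -/
def HasTraceValue {n : ℕ} (a : ℝ) (u : Pt n → ℝ) (x : EuclideanSpace ℝ (Fin n)) (t : ℝ) : Prop :=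
  Tendsto (fun r : ℝ => ⨍ z in euclBall ((x, 0) : Pt n) r, u z ∂(halfMeasure n a))
    (𝓝[>] 0) (𝓝 t)

/-- The admissible functions of the capacity problem: `u ∈ W^{1,2}` with `u(x, 0) ≥ 1` for all
`x ∈ A`. -/
def IsAdmissible {n : ℕ} (a : ℝ) (A : Set (EuclideanSpace ℝ (Fin n)))
    (u : Pt n → ℝ) (g : Pt n → Pt n) : Prop :=
  IsSobolev a u g ∧ ∀ x ∈ A, ∃ t : ℝ, 1 ≤ t ∧ HasTraceValue a u x t

/-- The `s`-capacity of `A ⊆ ℝⁿ`, where `s = (1 - a) / 2`. -/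
def sCap {n : ℕ} (a : ℝ) (A : Set (EuclideanSpace ℝ (Fin n))) : ℝ≥0∞ :=
  ⨅ (u : Pt n → ℝ) (g : Pt n → Pt n) (_ : IsAdmissible a A u g), energy a g

/-- `φ` (with gradient `g`) lies in the closure of the admissible functions for the energy norm:
gradients converge in `L²(y^a dx dy)` and functions in `L²(y^a dx dy)` on bounded sets. -/
def IsInEnergyClosure {n : ℕ} (a : ℝ) (A : Set (EuclideanSpace ℝ (Fin n)))
    (φ : Pt n → ℝ) (g : Pt n → Pt n) : Prop :=
  AEStronglyMeasurable φ (halfMeasure n a) ∧ MemLp g 2 (halfMeasure n a) ∧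
  ∃ (u : ℕ → Pt n → ℝ) (v : ℕ → Pt n → Pt n), (∀ j, IsAdmissible a A (u j) (v j)) ∧
    Tendsto (fun j => eLpNorm (fun z => v j z - g z) 2 (halfMeasure n a)) atTop (𝓝 0) ∧
    ∀ r : ℝ, Tendsto (fun j => eLpNorm (fun z => u j z - φ z) 2
      ((halfMeasure n a).restrict (euclBall 0 r))) atTop (𝓝 0)

/-- The `s`-capacitary potential of `A`: the function that attains the infimum of the capacity
problem. The minimiser is sought in the closure of the admissible set for the energy norm, because
it decays like `|(x, y)|^{-(n-1+a)}` and so is not in `L²(y^a dx dy)` when `n + a ≤ 3`. -/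
def IsCapacitaryPotential {n : ℕ} (a : ℝ) (A : Set (EuclideanSpace ℝ (Fin n)))
    (φ : Pt n → ℝ) : Prop :=
  ∃ g : Pt n → Pt n, IsInEnergyClosure a A φ g ∧ energy a g = sCap a A

/-- `ν_k = π^{k/2} Γ((k-1)/2) / 4`. -/
def nuConst (k : ℝ) : ℝ := Real.pi ^ (k / 2) * Real.Gamma ((k - 1) / 2) / 4

/-- `h(x, y) = ν_{n+1+a} / (|x|² + y²)^{(n-1+a)/2}`. -/
def hFun (n : ℕ) (a : ℝ) (z : Pt n) : ℝ :=
  nuConst (n + 1 + a) / (‖z.1‖ ^ 2 + z.2 ^ 2) ^ (((n : ℝ) - 1 + a) / 2)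

/-- `μ` is the constant for which `div(|y|^a ∇h) = -μ δ` in the sense of distributions on
`ℝⁿ⁺¹`, with `δ` the Dirac mass at the origin. -/
def IsFundamentalConst (n : ℕ) (a μ : ℝ) : Prop :=
  ∀ ψ : Pt n → ℝ, IsTest ψ →
    ∫ z : Pt n, |z.2| ^ a * euclDot (euclGrad (hFun n a) z) (euclGrad ψ z) = μ * ψ 0

/-- The lattice point `εk`, `k ∈ ℤⁿ`. -/
def latticePt {n : ℕ} (ε : ℝ) (k : Fin n → ℤ) : EuclideanSpace ℝ (Fin n) :=
  WithLp.toLp 2 (fun i => ε * (k i : ℝ))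

/-- The critical size `a^ε = ε^{n/(n-1+a)} = ε^{n/(n-2s)}`. -/
def critSize (n : ℕ) (a ε : ℝ) : ℝ := ε ^ ((n : ℝ) / ((n : ℝ) - 1 + a))

/-- The points `(x, y)`, `y ≥ 0`, at distance at least `r` from `(c, 0)`. -/
def farRegion {n : ℕ} (c : EuclideanSpace ℝ (Fin n)) (r : ℝ) : Set (Pt n) :=
  {z | 0 ≤ z.2 ∧ r ≤ euclNorm (z - (c, 0))}

end FracCap

end

/-!
Let `φ` be a capacitary potential of a bounded set `A` with gradient `g`, and `β = (n + 1 + a) / 2`.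
By the first variation of the energy, `χ ↦ ∫ y^a ⟨g, ∇χ⟩` is a positive functional of the trace of
`χ` on `{y = 0}`, hence integration against a finite measure `m`, carried by a compact set
containing `A` and of mass `cap_s(A)`.

Test this with the Gaussians `z ↦ exp(-t |z - (x, 0)|²)`. The quantity
`t^β ∫ y^a φ(z) exp(-t |z - (x, 0)|²)` vanishes as `t → 0` and has `t`-derivative
`¼ t^(β-2) ∫ exp(-t |x - x'|²) dm(x')`, so the Gaussian averages of `φ` are determined by `m`.
The potential of `m` with kernel a multiple of `|z|^(-2 (β-1))` has the same averages. Products of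
boundary-centred Gaussians are again such Gaussians up to a factor, and they separate the points of
the closed half space, so Stone–Weierstrass identifies `φ` with that potential. At distances large
compared with the radius of `A` the kernel is nearly constant on the support of `m`, whence
`φ ≈ cap_s(A) · kernel`.

The same computation with a test function in place of `φ`, integrated over `t ∈ (0, ∞)` and
symmetrised by `y ↦ -y`, shows that the kernel is the fundamental solution.
-/

noncomputable section

namespace FracCap

variable {n : ℕ} {a : ℝ}

/-! ### Euclidean geometry of `ℝⁿ × ℝ` -/

/-- The squared Euclidean norm `|x|² + y²`, a smooth function of the point. -/
def normSq (z : Pt n) : ℝ := ‖z.1‖ ^ 2 + z.2 ^ 2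

/-- `euclDot` as a continuous bilinear form. -/
def euclDotL (n : ℕ) : Pt n →L[ℝ] Pt n →L[ℝ] ℝ :=
  (innerSL ℝ).bilinearComp (ContinuousLinearMap.fst ℝ _ ℝ) (ContinuousLinearMap.fst ℝ _ ℝ) +
    (ContinuousLinearMap.mul ℝ ℝ).bilinearComp (ContinuousLinearMap.snd ℝ _ ℝ)
      (ContinuousLinearMap.snd ℝ _ ℝ)

lemma euclDotL_apply (z w : Pt n) : euclDotL n z w = euclDot z w := by
  simp [euclDotL, euclDot]

lemma inner_toLp (z w : Pt n) :
    inner ℝ (WithLp.toLp 2 z : WithLp 2 (Pt n)) (WithLp.toLp 2 w) = euclDot z w := by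
  simp [WithLp.prod_inner_apply, euclDot, mul_comm]

lemma norm_toLp (z : Pt n) : ‖(WithLp.toLp 2 z : WithLp 2 (Pt n))‖ = euclNorm z := by
  simp [WithLp.prod_norm_eq_of_L2, euclNorm]

lemma euclNorm_nonneg (z : Pt n) : 0 ≤ euclNorm z := Real.sqrt_nonneg _

lemma normSq_nonneg (z : Pt n) : 0 ≤ normSq z := by unfold normSq; positivity

lemma euclNorm_sq (z : Pt n) : euclNorm z ^ 2 = normSq z := Real.sq_sqrt (normSq_nonneg z)

lemma euclDot_self (z : Pt n) : euclDot z z = normSq z := by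
  simp [euclDot, normSq, sq]

lemma euclDot_comm (z w : Pt n) : euclDot z w = euclDot w z := by
  simp_rw [← inner_toLp, real_inner_comm]

lemma euclDot_add_left (z z' w : Pt n) : euclDot (z + z') w = euclDot z w + euclDot z' w := by
  simp_rw [← euclDotL_apply, map_add, add_apply]

lemma euclDot_sub_left (z z' w : Pt n) : euclDot (z - z') w = euclDot z w - euclDot z' w := by
  simp_rw [← euclDotL_apply, map_sub, sub_apply]

lemma euclDot_smul_left (c : ℝ) (z w : Pt n) : euclDot (c • z) w = c * euclDot z w := by
  simp_rw [← euclDotL_apply, map_smul, smul_apply, smul_eq_mul]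

lemma euclDot_smul_right (c : ℝ) (z w : Pt n) : euclDot z (c • w) = c * euclDot z w := by
  simp_rw [← euclDotL_apply, map_smul, smul_eq_mul]

lemma normSq_add (z w : Pt n) : normSq (z + w) = normSq z + 2 * euclDot z w + normSq w := by
  simp_rw [← euclNorm_sq, ← norm_toLp, ← inner_toLp, WithLp.toLp_add, norm_add_sq_real]

lemma normSq_smul (c : ℝ) (z : Pt n) : normSq (c • z) = c ^ 2 * normSq z := by
  simp_rw [← euclDot_self, euclDot_smul_left, euclDot_smul_right]; ring

lemma normSq_sub_mk (z : Pt n) (x : EuclideanSpace ℝ (Fin n)) :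
    normSq (z - (x, 0)) = ‖z.1 - x‖ ^ 2 + z.2 ^ 2 := by simp [normSq]

lemma abs_euclDot_le (z w : Pt n) : |euclDot z w| ≤ euclNorm z * euclNorm w := by
  simp_rw [← inner_toLp, ← norm_toLp]
  exact abs_real_inner_le_norm _ _

lemma euclNorm_add_le (z w : Pt n) : euclNorm (z + w) ≤ euclNorm z + euclNorm w := by
  simp_rw [← norm_toLp, WithLp.toLp_add]
  exact norm_add_le _ _

lemma norm_le_euclNorm (z : Pt n) : ‖z‖ ≤ euclNorm z :=
  max_le (Real.le_sqrt_of_sq_le (by nlinarith [sq_nonneg z.2]))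
    (Real.le_sqrt_of_sq_le (by rw [Real.norm_eq_abs, sq_abs]; nlinarith [sq_nonneg ‖z.1‖]))

lemma normSq_le (z : Pt n) : normSq z ≤ 2 * ‖z‖ ^ 2 := by
  have hfst : ‖z.1‖ ^ 2 ≤ ‖z‖ ^ 2 := by gcongr; exact norm_fst_le z
  have hsnd : ‖z.2‖ ^ 2 ≤ ‖z‖ ^ 2 := by gcongr; exact norm_snd_le z
  rw [Real.norm_eq_abs, sq_abs] at hsnd
  unfold normSq
  linarith

lemma euclNorm_le (z : Pt n) : euclNorm z ≤ 2 * ‖z‖ :=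
  Real.sqrt_le_iff.2 ⟨by positivity, by
    nlinarith [normSq_le z, show normSq z = ‖z.1‖ ^ 2 + z.2 ^ 2 from rfl, sq_nonneg ‖z‖]⟩

lemma one_add_normSq_add_le (z w : Pt n) :
    1 + normSq (z + w) ≤ (2 + 2 * normSq w) * (1 + normSq z) := by
  have hadd := normSq_add z w
  have hsub := normSq_add z ((-1 : ℝ) • w)
  rw [euclDot_smul_right, normSq_smul] at hsub
  nlinarith [normSq_nonneg (z + (-1 : ℝ) • w), mul_nonneg (normSq_nonneg z) (normSq_nonneg w)]

@[fun_prop]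
lemma contDiff_normSq {m : WithTop ℕ∞} : ContDiff ℝ m (normSq : Pt n → ℝ) := by
  unfold normSq
  exact (contDiff_fst.norm_sq ℝ).add (contDiff_snd.pow 2)

@[fun_prop]
lemma continuous_normSq : Continuous (normSq : Pt n → ℝ) := by unfold normSq; fun_prop

@[fun_prop]
lemma differentiable_normSq : Differentiable ℝ (normSq : Pt n → ℝ) :=
  (contDiff_normSq (m := 1)).differentiable one_ne_zero

@[fun_prop]
lemma continuous_euclNorm : Continuous (euclNorm : Pt n → ℝ) := by unfold euclNorm; fun_prop

@[fun_prop]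
lemma continuous_euclDot_comp {X : Type*} [TopologicalSpace X] {f g : X → Pt n} (hf : Continuous f)
    (hg : Continuous g) : Continuous fun x => euclDot (f x) (g x) := by
  unfold euclDot; fun_prop

lemma fderiv_normSq (z w : Pt n) : fderiv ℝ normSq z w = 2 * euclDot z w := by
  have hfst : HasFDerivAt (fun z : Pt n => ‖z.1‖ ^ 2) _ z := (hasFDerivAt_fst (𝕜 := ℝ)).norm_sq
  have hsnd : HasFDerivAt (fun z : Pt n => z.2 ^ 2) _ z := (hasFDerivAt_snd (𝕜 := ℝ)).pow 2
  have hadd : HasFDerivAt (normSq : Pt n → ℝ) _ z := hfst.add hsnd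
  rw [hadd.fderiv]
  simp only [euclDot, add_apply, smul_apply, ContinuousLinearMap.comp_apply,
    ContinuousLinearMap.coe_fst', ContinuousLinearMap.coe_snd', innerSL_apply_apply, smul_eq_mul]
  ring

lemma fderiv_normSq_sub (c z w : Pt n) :
    fderiv ℝ (fun z => normSq (z - c)) z w = 2 * euclDot (z - c) w := by
  rw [fderiv_comp_sub, fderiv_normSq]

lemma measurableSet_euclBall (c : Pt n) (r : ℝ) : MeasurableSet (euclBall c r) :=
  measurableSet_lt (by fun_prop) measurable_const

lemma euclBall_subset_ball (c : Pt n) (r : ℝ) : euclBall c r ⊆ Metric.ball c r := fun _ hz =>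
  mem_ball_iff_norm.2 ((norm_le_euclNorm _).trans_lt hz)

lemma iUnion_euclBall_natCast : ⋃ k : ℕ, euclBall (0 : Pt n) k = univ :=
  eq_univ_of_forall fun z => mem_iUnion.2 <|
    (exists_nat_gt (euclNorm z)).imp fun _ hk => by simpa [euclBall] using hk

lemma monotone_euclBall (c : Pt n) : Monotone (euclBall c) := fun _ _ h _ hz => hz.trans_le h

/-! ### Gradients -/

lemma hasFDerivAt_comp_mk_left {f : Pt n → ℝ} {z : Pt n} (hf : DifferentiableAt ℝ f z) :
    HasFDerivAt (fun x => f (x, z.2)) ((fderiv ℝ f z).comp (ContinuousLinearMap.inl ℝ _ ℝ)) z.1 :=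
  HasFDerivAt.comp (g := f) z.1 hf.hasFDerivAt (hasFDerivAt_prodMk_left z.1 z.2)

lemma hasDerivAt_comp_mk_right {f : Pt n → ℝ} {z : Pt n} (hf : DifferentiableAt ℝ f z) :
    HasDerivAt (fun y => f (z.1, y)) (fderiv ℝ f z (0, 1)) z.2 :=
  HasFDerivAt.comp_hasDerivAt (l := f) z.2 hf.hasFDerivAt
    ((hasDerivAt_const z.2 z.1).prodMk (hasDerivAt_id z.2))

/-- The vector representing a linear form on `ℝⁿ × ℝ` with respect to `euclDot`. It makes `euclGrad`
a continuous linear function of `fderiv`. -/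
def rieszVec (n : ℕ) : (Pt n →L[ℝ] ℝ) →L[ℝ] Pt n :=
  LinearMap.toContinuousLinearMap
    { toFun L := ((InnerProductSpace.toDual ℝ _).symm (L.comp (ContinuousLinearMap.inl ℝ _ ℝ)),
        L (0, 1))
      map_add' _ _ := by ext <;> simp
      map_smul' _ _ := by ext <;> simp }

lemma euclDot_rieszVec (L : Pt n →L[ℝ] ℝ) (w : Pt n) : euclDot (rieszVec n L) w = L w := by
  calc euclDot (rieszVec n L) w = L (w.1, 0) + L (0, 1) * w.2 := by simp [rieszVec, euclDot]
    _ = L ((w.1, 0) + w.2 • (0, 1)) := by rw [map_add, map_smul, smul_eq_mul, mul_comm]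
    _ = L w := by simp

lemma euclGrad_eq_rieszVec {f : Pt n → ℝ} {z : Pt n} (hf : DifferentiableAt ℝ f z) :
    euclGrad f z = rieszVec n (fderiv ℝ f z) := by
  rw [euclGrad, gradient, (hasFDerivAt_comp_mk_left hf).fderiv, (hasDerivAt_comp_mk_right hf).deriv]
  rfl

lemma euclDot_euclGrad {f : Pt n → ℝ} {z : Pt n} (hf : DifferentiableAt ℝ f z) (w : Pt n) :
    euclDot (euclGrad f z) w = fderiv ℝ f z w := by
  rw [euclGrad_eq_rieszVec hf, euclDot_rieszVec]

lemma euclGrad_add {f g : Pt n → ℝ} {z : Pt n} (hf : DifferentiableAt ℝ f z)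
    (hg : DifferentiableAt ℝ g z) :
    euclGrad (fun z => f z + g z) z = euclGrad f z + euclGrad g z := by
  rw [euclGrad_eq_rieszVec (hf.fun_add hg), fderiv_fun_add hf hg, map_add, euclGrad_eq_rieszVec hf,
    euclGrad_eq_rieszVec hg]

lemma euclGrad_sub {f g : Pt n → ℝ} {z : Pt n} (hf : DifferentiableAt ℝ f z)
    (hg : DifferentiableAt ℝ g z) :
    euclGrad (fun z => f z - g z) z = euclGrad f z - euclGrad g z := by
  rw [euclGrad_eq_rieszVec (hf.fun_sub hg), fderiv_fun_sub hf hg, map_sub, euclGrad_eq_rieszVec hf,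
    euclGrad_eq_rieszVec hg]

lemma euclGrad_const_mul {f : Pt n → ℝ} {z : Pt n} (hf : DifferentiableAt ℝ f z) (c : ℝ) :
    euclGrad (fun z => c * f z) z = c • euclGrad f z := by
  rw [euclGrad_eq_rieszVec (hf.const_mul c), fderiv_const_mul hf, map_smul, euclGrad_eq_rieszVec hf]

namespace IsTest

variable {ψ χ : Pt n → ℝ}

lemma continuous (h : IsTest ψ) : Continuous ψ := h.1.continuous

lemma differentiableAt (h : IsTest ψ) (z : Pt n) : DifferentiableAt ℝ ψ z :=
  h.1.differentiable (by simp) z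

lemma euclGrad_eq (h : IsTest ψ) : euclGrad ψ = fun z => rieszVec n (fderiv ℝ ψ z) :=
  funext fun z => euclGrad_eq_rieszVec (h.differentiableAt z)

lemma continuous_euclGrad (h : IsTest ψ) : Continuous (euclGrad ψ) := by
  rw [h.euclGrad_eq]
  have := h.1.continuous_fderiv (by simp)
  fun_prop

lemma hasCompactSupport_euclGrad (h : IsTest ψ) : HasCompactSupport (euclGrad ψ) := by
  rw [h.euclGrad_eq]
  exact (h.2.fderiv ℝ).comp_left (map_zero (rieszVec n))

lemma add (h : IsTest ψ) (h' : IsTest χ) : IsTest (fun z => ψ z + χ z) :=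
  ⟨h.1.add h'.1, h.2.add h'.2⟩

lemma mul_left (h : IsTest ψ) (h' : ContDiff ℝ ((⊤ : ℕ∞) : WithTop ℕ∞) χ) :
    IsTest (fun z => χ z * ψ z) :=
  ⟨h'.mul h.1, h.2.mul_left⟩

lemma const_mul (c : ℝ) (h : IsTest ψ) : IsTest (fun z => c * ψ z) := h.mul_left contDiff_const

lemma sub (h : IsTest ψ) (h' : IsTest χ) : IsTest (fun z => ψ z - χ z) := by
  simpa [sub_eq_add_neg] using h.add (h'.const_mul (-1))

lemma exists_lipschitz (h : IsTest ψ) :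
    ∃ L, 0 ≤ L ∧ ∀ z w, |ψ z - ψ w| ≤ L * euclNorm (z - w) := by
  obtain ⟨C, hC⟩ := h.1.lipschitzWith_of_hasCompactSupport h.2 (by simp)
  refine ⟨C, C.2, fun z w => (hC.dist_le_mul z w).trans ?_⟩
  rw [dist_eq_norm]
  gcongr
  exact norm_le_euclNorm _

end IsTest

/-! ### The weighted measure -/

/-- Half of the effective dimension `n + 1 + a` of the weighted half space: the measure
`halfMeasure n a` of a half ball of radius `r` is proportional to `r ^ (2 * halfDim n a)`. -/
def halfDim (n : ℕ) (a : ℝ) : ℝ := ((n : ℝ) + 1 + a) / 2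

/-- The measure `y^a dy` on `(0, ∞)`, the vertical factor of `halfMeasure`. -/
def powMeasure (a : ℝ) : Measure ℝ :=
  (volume.restrict (Ioi 0)).withDensity fun y => ENNReal.ofReal (y ^ a)

instance : SFinite (powMeasure a) := by unfold powMeasure; infer_instance

lemma halfMeasure_eq_prod (n : ℕ) (a : ℝ) :
    halfMeasure n a = (volume : Measure (EuclideanSpace ℝ (Fin n))).prod (powMeasure a) := by
  have hhalf : {z : Pt n | 0 < z.2} = univ ×ˢ Ioi 0 := by ext z; simp
  rw [halfMeasure, powMeasure, prod_withDensity_right (by fun_prop), hhalf, Measure.volume_eq_prod,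
    ← Measure.prod_restrict, Measure.restrict_univ]

lemma integral_powMeasure (a : ℝ) (f : ℝ → ℝ) :
    ∫ y, f y ∂powMeasure a = ∫ y in Ioi 0, y ^ a * f y := by
  rw [powMeasure, integral_withDensity_eq_integral_toReal_smul (by fun_prop) (by simp)]
  refine setIntegral_congr_fun measurableSet_Ioi fun y hy => ?_
  simp [ENNReal.toReal_ofReal (Real.rpow_nonneg (le_of_lt hy) a)]

lemma integrable_powMeasure_iff {f : ℝ → ℝ} :
    Integrable f (powMeasure a) ↔ IntegrableOn (fun y => y ^ a * f y) (Ioi 0) := by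
  rw [powMeasure, integrable_withDensity_iff_integrable_smul' (by fun_prop) (by simp)]
  refine integrableOn_congr_fun (fun y hy => ?_) measurableSet_Ioi
  simp [ENNReal.toReal_ofReal (Real.rpow_nonneg (le_of_lt hy) a)]

lemma measurableSet_upperHalf : MeasurableSet {z : Pt n | 0 < z.2} :=
  measurableSet_lt measurable_const measurable_snd

lemma integral_halfMeasure (f : Pt n → ℝ) :
    ∫ z, f z ∂halfMeasure n a = ∫ z in {z : Pt n | 0 < z.2}, |z.2| ^ a * f z := by
  rw [halfMeasure, integral_withDensity_eq_integral_toReal_smul (by fun_prop) (by simp)]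
  refine setIntegral_congr_fun measurableSet_upperHalf fun z (hz : 0 < z.2) => ?_
  simp [ENNReal.toReal_ofReal (Real.rpow_nonneg hz.le a), abs_of_pos hz]

lemma integrable_halfMeasure_iff {f : Pt n → ℝ} :
    Integrable f (halfMeasure n a) ↔
      IntegrableOn (fun z : Pt n => |z.2| ^ a * f z) {z | 0 < z.2} := by
  rw [halfMeasure, integrable_withDensity_iff_integrable_smul' (by fun_prop) (by simp)]
  refine integrableOn_congr_fun (fun z (hz : 0 < z.2) => ?_) measurableSet_upperHalf
  simp [ENNReal.toReal_ofReal (Real.rpow_nonneg hz.le a), abs_of_pos hz]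

lemma ae_pos_halfMeasure (n : ℕ) (a : ℝ) : ∀ᵐ z ∂halfMeasure n a, 0 < z.2 :=
  (withDensity_absolutelyContinuous _ _).ae_le (ae_restrict_mem measurableSet_upperHalf)

instance : SFinite (halfMeasure n a) := by rw [halfMeasure_eq_prod]; infer_instance

instance [Fact (-1 < a)] : IsLocallyFiniteMeasure (powMeasure a) := by
  refine ⟨fun y => ⟨Iio (y + 1), Iio_mem_nhds (by linarith), ?_⟩⟩
  have hint : IntegrableOn (fun y : ℝ => y ^ a) (Ioo 0 (y + 1)) := by
    rcases le_or_gt (y + 1) 0 with hy | hy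
    · simp [Ioo_eq_empty (not_lt.2 hy)]
    · exact (intervalIntegral.integrableOn_Ioo_rpow_iff hy).2 Fact.out
  rw [powMeasure, withDensity_apply _ measurableSet_Iio,
    Measure.restrict_restrict measurableSet_Iio, Iio_inter_Ioi]
  exact hint.lintegral_lt_top

instance [Fact (-1 < a)] : IsLocallyFiniteMeasure (halfMeasure n a) := by
  rw [halfMeasure_eq_prod]; infer_instance

lemma IsTest.memLp [Fact (-1 < a)] {ψ : Pt n → ℝ} (h : IsTest ψ) : MemLp ψ 2 (halfMeasure n a) :=
  h.continuous.memLp_of_hasCompactSupport h.2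

lemma IsTest.memLp_euclGrad [Fact (-1 < a)] {ψ : Pt n → ℝ} (h : IsTest ψ) :
    MemLp (euclGrad ψ) 2 (halfMeasure n a) :=
  h.continuous_euclGrad.memLp_of_hasCompactSupport h.hasCompactSupport_euclGrad

/-! ### Gaussians -/

/-- The Gaussian `exp(-t |z - (x, 0)|²)` centred at a boundary point. -/
def gauss (t : ℝ) (x : EuclideanSpace ℝ (Fin n)) (z : Pt n) : ℝ :=
  Real.exp (-t * normSq (z - (x, 0)))

lemma gauss_pos (t : ℝ) (x : EuclideanSpace ℝ (Fin n)) (z : Pt n) : 0 < gauss t x z :=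
  Real.exp_pos _

lemma gauss_anti {s t : ℝ} (h : s ≤ t) (x : EuclideanSpace ℝ (Fin n)) (z : Pt n) :
    gauss t x z ≤ gauss s x z :=
  Real.exp_le_exp.2 (mul_le_mul_of_nonneg_right (neg_le_neg h) (normSq_nonneg _))

lemma gauss_zero (x : EuclideanSpace ℝ (Fin n)) (z : Pt n) : gauss 0 x z = 1 := by simp [gauss]

lemma gauss_le_one {t : ℝ} (ht : 0 ≤ t) (x : EuclideanSpace ℝ (Fin n)) (z : Pt n) :
    gauss t x z ≤ 1 :=
  (gauss_anti ht x z).trans_eq (gauss_zero x z)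

lemma gauss_add (s t : ℝ) (x : EuclideanSpace ℝ (Fin n)) (z : Pt n) :
    gauss (s + t) x z = gauss s x z * gauss t x z := by
  rw [gauss, gauss, gauss, ← Real.exp_add]; ring_nf

lemma gauss_sq (t : ℝ) (x : EuclideanSpace ℝ (Fin n)) (z : Pt n) :
    gauss t x z ^ 2 = gauss (2 * t) x z := by
  rw [two_mul, gauss_add, sq]

lemma gauss_eq_mul (t : ℝ) (x : EuclideanSpace ℝ (Fin n)) (z : Pt n) :
    gauss t x z = Real.exp (-t * ‖z.1 - x‖ ^ 2) * Real.exp (-t * z.2 ^ 2) := by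
  rw [gauss, normSq_sub_mk, ← Real.exp_add]; ring_nf

lemma gauss_mk_zero (t : ℝ) (x x' : EuclideanSpace ℝ (Fin n)) :
    gauss t x (x', 0) = Real.exp (-t * ‖x' - x‖ ^ 2) := by
  simp [gauss_eq_mul]

@[fun_prop]
lemma contDiff_gauss {m : WithTop ℕ∞} (t : ℝ) (x : EuclideanSpace ℝ (Fin n)) :
    ContDiff ℝ m (gauss t x) :=
  Real.contDiff_exp.comp (contDiff_const.mul (contDiff_normSq.comp (by fun_prop)))

@[fun_prop]
lemma continuous_gauss (t : ℝ) (x : EuclideanSpace ℝ (Fin n)) : Continuous (gauss t x) :=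
  (contDiff_gauss (m := 0) t x).continuous

@[fun_prop]
lemma differentiable_gauss (t : ℝ) (x : EuclideanSpace ℝ (Fin n)) : Differentiable ℝ (gauss t x) :=
  (contDiff_gauss (m := 1) t x).differentiable one_ne_zero

lemma fderiv_gauss (t : ℝ) (x : EuclideanSpace ℝ (Fin n)) (z w : Pt n) :
    fderiv ℝ (gauss t x) z w = -(2 * t) * gauss t x z * euclDot (z - (x, 0)) w := by
  have hd : DifferentiableAt ℝ (fun z : Pt n => normSq (z - (x, 0))) z := by fun_prop
  have hexp : HasFDerivAt (gauss t x) _ z := (hd.hasFDerivAt.const_mul (-t)).exp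
  rw [hexp.fderiv]
  simp only [smul_apply, fderiv_normSq_sub, smul_eq_mul, gauss]
  ring

/-- `∫_{y > 0} y^a exp(-|z|²) dz`. -/
def gaussMass (n : ℕ) (a : ℝ) : ℝ := Real.pi ^ ((n : ℝ) / 2) * (Real.Gamma ((a + 1) / 2) / 2)

lemma gaussMass_pos [h : Fact (-1 < a)] : 0 < gaussMass n a := by
  have := Real.Gamma_pos_of_pos (s := (a + 1) / 2) (by linarith [h.out])
  unfold gaussMass
  positivity

lemma integrable_powMeasure_exp_neg_mul_sq [h : Fact (-1 < a)] {t : ℝ} (ht : 0 < t) :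
    Integrable (fun y => Real.exp (-t * y ^ 2)) (powMeasure a) :=
  integrable_powMeasure_iff.2 (integrableOn_rpow_mul_exp_neg_mul_sq ht h.out)

lemma integral_powMeasure_exp_neg_mul_sq [h : Fact (-1 < a)] {t : ℝ} (ht : 0 < t) :
    ∫ y, Real.exp (-t * y ^ 2) ∂powMeasure a =
      t ^ (-((a + 1) / 2)) * (Real.Gamma ((a + 1) / 2) / 2) := by
  have hrpow := integral_rpow_mul_exp_neg_mul_rpow (p := 2) (by norm_num) h.out ht
  simp only [Real.rpow_ofNat] at hrpow
  rw [integral_powMeasure, hrpow, neg_div]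
  ring

lemma integrable_exp_neg_mul_sq_norm {V : Type*} [NormedAddCommGroup V] [InnerProductSpace ℝ V]
    [FiniteDimensional ℝ V] [MeasurableSpace V] [BorelSpace V] {t : ℝ} (ht : 0 < t) :
    Integrable fun x : V => Real.exp (-t * ‖x‖ ^ 2) := by
  refine Integrable.of_integral_ne_zero ?_
  rw [GaussianFourier.integral_rexp_neg_mul_sq_norm ht]
  positivity

lemma integrable_gauss [Fact (-1 < a)] {t : ℝ} (ht : 0 < t) (x : EuclideanSpace ℝ (Fin n)) :
    Integrable (gauss t x) (halfMeasure n a) := by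
  rw [halfMeasure_eq_prod, funext (gauss_eq_mul t x)]
  exact ((integrable_exp_neg_mul_sq_norm ht).comp_sub_right x).mul_prod
    (integrable_powMeasure_exp_neg_mul_sq ht)

lemma integral_gauss [Fact (-1 < a)] {t : ℝ} (ht : 0 < t) (x : EuclideanSpace ℝ (Fin n)) :
    ∫ z, gauss t x z ∂halfMeasure n a = gaussMass n a * t ^ (-halfDim n a) := by
  have hdim : -halfDim n a = -((n : ℝ) / 2) + -((a + 1) / 2) := by unfold halfDim; ring
  simp_rw [halfMeasure_eq_prod, gauss_eq_mul]
  rw [integral_prod_mul (fun x' => Real.exp (-t * ‖x' - x‖ ^ 2)) (fun y => Real.exp (-t * y ^ 2)),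
    integral_sub_right_eq_self (fun x' => Real.exp (-t * ‖x'‖ ^ 2)),
    GaussianFourier.integral_rexp_neg_mul_sq_norm ht, integral_powMeasure_exp_neg_mul_sq ht,
    Real.div_rpow Real.pi_pos.le ht.le, finrank_euclideanSpace, Fintype.card_fin, hdim,
    Real.rpow_add ht, Real.rpow_neg ht.le ((n : ℝ) / 2), gaussMass]
  ring

/-! ### The dilation identity and Hardy's inequality -/

lemma integral_coord_sub_mul_fderiv {E : Type*} [NormedAddCommGroup E] [NormedSpace ℝ E]
    [FiniteDimensional ℝ E] [MeasurableSpace E] [BorelSpace E] {μ : Measure E}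
    [μ.IsAddHaarMeasure] {f : E → ℝ} (hf : ContDiff ℝ 1 f) (hc : HasCompactSupport f)
    (L : E →L[ℝ] ℝ) (x₀ v : E) :
    ∫ x, L (x - x₀) * fderiv ℝ f x v ∂μ = -(L v * ∫ x, f x ∂μ) := by
  have := hf.continuous_fderiv one_ne_zero
  have hL (x : E) : fderiv ℝ (fun x => L (x - x₀)) x = L := by
    rw [fderiv_comp_sub (f := L) x₀, L.fderiv]
  rw [integral_mul_fderiv_eq_neg_fderiv_mul_of_integrable (f := fun x => L (x - x₀)) (g := f)
    _ _ _ (fun _ _ => by fun_prop) (fun x _ => hf.differentiable one_ne_zero x)]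
  · simp_rw [hL, integral_const_mul]
  · simp_rw [hL]
    exact (hf.continuous.integrable_of_hasCompactSupport hc).const_mul _
  · exact Continuous.integrable_of_hasCompactSupport (by fun_prop)
      ((hc.fderiv ℝ).mono fun x hx h0 => hx (by simp [h0]))
  · exact Continuous.integrable_of_hasCompactSupport (by fun_prop) hc.mul_left

lemma integral_fderiv_sub {E : Type*} [NormedAddCommGroup E] [NormedSpace ℝ E]
    [FiniteDimensional ℝ E] [MeasurableSpace E] [BorelSpace E] {μ : Measure E}
    [μ.IsAddHaarMeasure] {f : E → ℝ} (hf : ContDiff ℝ 1 f) (hc : HasCompactSupport f) (x₀ : E) :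
    ∫ x, fderiv ℝ f x (x - x₀) ∂μ = -(Module.finrank ℝ E * ∫ x, f x ∂μ) := by
  have := hf.continuous_fderiv one_ne_zero
  let b := Module.finBasis ℝ E
  let L i : E →L[ℝ] ℝ := (b.coord i).toContinuousLinearMap
  have hexpand (x : E) : fderiv ℝ f x (x - x₀) = ∑ i, L i (x - x₀) * fderiv ℝ f x (b i) := by
    conv_lhs => rw [← b.sum_repr (x - x₀), map_sum]
    simp [L]
  have hint i : Integrable (fun x => L i (x - x₀) * fderiv ℝ f x (b i)) μ :=
    Continuous.integrable_of_hasCompactSupport (by fun_prop)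
      ((hc.fderiv ℝ).mono fun x hx h0 => hx (by simp [h0]))
  have hL i : L i (b i) = 1 := by simp [L]
  simp_rw [hexpand]
  rw [integral_finsetSum _ fun i _ => hint i]
  simp only [integral_coord_sub_mul_fderiv hf hc, hL, one_mul, Finset.sum_neg_distrib,
    Finset.sum_const, Finset.card_univ, Fintype.card_fin, nsmul_eq_mul]

lemma integral_mul_deriv_powMeasure [h : Fact (-1 < a)] {g : ℝ → ℝ} (hg : ContDiff ℝ 1 g)
    (hc : HasCompactSupport g) :
    ∫ y, y * deriv g y ∂powMeasure a = -((a + 1) * ∫ y, g y ∂powMeasure a) := by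
  have ha : 0 < a + 1 := by linarith [h.out]
  have := hg.continuous_deriv le_rfl
  have hig : Integrable g (powMeasure a) := hg.continuous.integrable_of_hasCompactSupport hc
  have hig' : Integrable (fun y => y * deriv g y) (powMeasure a) :=
    Continuous.integrable_of_hasCompactSupport (by fun_prop) hc.deriv.mul_left
  have hderiv (y : ℝ) (hy : y ∈ Ioi 0) : HasDerivAt (fun y => y ^ (a + 1) * g y)
      (y ^ a * (y * deriv g y) + (a + 1) * (y ^ a * g y)) y := by
    have hy : 0 < y := hy
    convert! (Real.hasDerivAt_rpow_const (p := a + 1) (Or.inl hy.ne')).mul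
      (hg.differentiable one_ne_zero y).hasDerivAt using 1
    rw [add_sub_cancel_right, Real.rpow_add hy, Real.rpow_one]
    ring
  have hcontPrim : Continuous fun y : ℝ => y ^ (a + 1) * g y :=
    (Real.continuous_rpow_const ha.le).mul hg.continuous
  have hlim : Tendsto (fun y => y ^ (a + 1) * g y) atTop (𝓝 0) := by
    refine tendsto_const_nhds.congr' ?_
    filter_upwards [atTop_le_cocompact hc.compl_mem_cocompact] with y hy
    rw [image_eq_zero_of_notMem_tsupport hy, mul_zero]
  rw [integrable_powMeasure_iff] at hig hig'
  have hftc := integral_Ioi_of_hasDerivAt_of_tendsto hcontPrim.continuousWithinAt hderiv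
    (hig'.add (hig.const_mul _)) hlim
  rw [integral_add hig' (hig.const_mul _), integral_const_mul, Real.zero_rpow ha.ne'] at hftc
  rw [integral_powMeasure, integral_powMeasure]
  linarith

section Dilation

variable [Fact (-1 < a)] {F : Pt n → ℝ}

lemma integral_fderiv_horizontal (hF : ContDiff ℝ 1 F) (hc : HasCompactSupport F)
    (x₀ : EuclideanSpace ℝ (Fin n)) :
    ∫ z, fderiv ℝ F z (z.1 - x₀, 0) ∂halfMeasure n a = -(n * ∫ z, F z ∂halfMeasure n a) := by
  have := hF.continuous_fderiv one_ne_zero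
  have hi : Integrable F (halfMeasure n a) := hF.continuous.integrable_of_hasCompactSupport hc
  have hi' : Integrable (fun z => fderiv ℝ F z (z.1 - x₀, 0)) (halfMeasure n a) :=
    Continuous.integrable_of_hasCompactSupport (by fun_prop)
      ((hc.fderiv ℝ).mono fun x hx h0 => hx (by simp [h0]))
  rw [halfMeasure_eq_prod] at hi hi' ⊢
  rw [integral_prod_symm _ hi', integral_prod_symm _ hi, ← integral_const_mul, ← integral_neg]
  congr 1 with y
  have hslice : HasCompactSupport fun x => F (x, y) := hc.comp_isClosedEmbedding
    (Isometry.of_dist_eq fun _ _ => by simp [Prod.dist_eq]).isClosedEmbedding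
  have hsmooth : ContDiff ℝ 1 fun x => F (x, y) := hF.comp (by fun_prop)
  have hparts := integral_fderiv_sub (μ := volume) hsmooth hslice x₀
  rw [finrank_euclideanSpace, Fintype.card_fin] at hparts
  rw [← hparts]
  congr 1 with x
  rw [(hasFDerivAt_comp_mk_left (hF.differentiable one_ne_zero (x, y))).fderiv]
  simp

lemma integral_fderiv_vertical (hF : ContDiff ℝ 1 F) (hc : HasCompactSupport F) :
    ∫ z, z.2 * fderiv ℝ F z (0, 1) ∂halfMeasure n a =
      -((a + 1) * ∫ z, F z ∂halfMeasure n a) := by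
  have := hF.continuous_fderiv one_ne_zero
  have hi : Integrable F (halfMeasure n a) := hF.continuous.integrable_of_hasCompactSupport hc
  have hi' : Integrable (fun z => z.2 * fderiv ℝ F z (0, 1)) (halfMeasure n a) :=
    Continuous.integrable_of_hasCompactSupport (by fun_prop)
      ((hc.fderiv ℝ).mono fun x hx h0 => hx (by simp [h0]))
  rw [halfMeasure_eq_prod] at hi hi' ⊢
  rw [integral_prod _ hi', integral_prod _ hi, ← integral_const_mul, ← integral_neg]
  congr 1 with x
  have hslice : HasCompactSupport fun y => F (x, y) := hc.comp_isClosedEmbedding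
    (Isometry.of_dist_eq fun _ _ => by simp [Prod.dist_eq]).isClosedEmbedding
  have hsmooth : ContDiff ℝ 1 fun y => F (x, y) := hF.comp (by fun_prop)
  rw [← integral_mul_deriv_powMeasure hsmooth hslice]
  congr 1 with y
  rw [(hasDerivAt_comp_mk_right (hF.differentiable one_ne_zero (x, y))).deriv]

lemma integral_fderiv_sub_halfMeasure (hF : ContDiff ℝ 1 F) (hc : HasCompactSupport F)
    (x₀ : EuclideanSpace ℝ (Fin n)) :
    ∫ z, fderiv ℝ F z (z - (x₀, 0)) ∂halfMeasure n a =
      -(2 * halfDim n a * ∫ z, F z ∂halfMeasure n a) := by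
  have := hF.continuous_fderiv one_ne_zero
  have hsplit (z : Pt n) : fderiv ℝ F z (z - (x₀, 0)) =
      fderiv ℝ F z (z.1 - x₀, 0) + z.2 * fderiv ℝ F z (0, 1) := by
    rw [← smul_eq_mul, ← map_smul, ← map_add]
    congr 1
    ext <;> simp
  simp_rw [hsplit]
  rw [integral_add, integral_fderiv_horizontal hF hc, integral_fderiv_vertical hF hc, halfDim]
  · ring
  all_goals
    exact Continuous.integrable_of_hasCompactSupport (by fun_prop)
      ((hc.fderiv ℝ).mono fun x hx h0 => hx (by simp [h0]))

end Dilation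

/-- The weak form of the equation `div(y^a ∇G) = y^a (4 t² |z - (x, 0)|² - 2 t (n + 1 + a)) G` for
the Gaussian `G = gauss t x`. -/
lemma IsTest.integral_gauss_mul_euclDot [Fact (-1 < a)] {ψ : Pt n → ℝ} (hψ : IsTest ψ) (t : ℝ)
    (x : EuclideanSpace ℝ (Fin n)) :
    ∫ z, gauss t x z * euclDot (euclGrad ψ z) (z - (x, 0)) ∂halfMeasure n a =
      ∫ z, ψ z * (gauss t x z * (2 * t * normSq (z - (x, 0)) - 2 * halfDim n a))
        ∂halfMeasure n a := by
  have hF : IsTest (fun z => gauss t x z * ψ z) := hψ.mul_left (contDiff_gauss t x)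
  have hdil := integral_fderiv_sub_halfMeasure (a := a) (hF.1.of_le (by exact_mod_cast le_top))
    hF.2 x
  have hfderiv (z : Pt n) : fderiv ℝ (fun z => gauss t x z * ψ z) z (z - (x, 0)) =
      gauss t x z * euclDot (euclGrad ψ z) (z - (x, 0)) -
        ψ z * (gauss t x z * (2 * t * normSq (z - (x, 0)))) := by
    rw [fderiv_fun_mul (differentiable_gauss t x z) (hψ.differentiableAt z)]
    simp only [add_apply, smul_apply, fderiv_gauss, smul_eq_mul, euclDot_self,
      euclDot_euclGrad (hψ.differentiableAt z)]
    ring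
  have hcont := hψ.continuous
  have hcont' := hψ.continuous_euclGrad
  have hi : Integrable (fun z => gauss t x z * ψ z) (halfMeasure n a) :=
    hF.continuous.integrable_of_hasCompactSupport hF.2
  have hi' : Integrable (fun z => ψ z * (gauss t x z * (2 * t * normSq (z - (x, 0)))))
      (halfMeasure n a) :=
    Continuous.integrable_of_hasCompactSupport (by fun_prop) hψ.2.mul_right
  simp_rw [hfderiv] at hdil
  rw [integral_sub _ hi'] at hdil
  · rw [sub_eq_iff_eq_add.1 hdil, ← neg_mul, ← integral_const_mul,
      ← integral_add (hi.const_mul _) hi']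
    congr 1 with z
    ring
  · exact Continuous.integrable_of_hasCompactSupport (by fun_prop)
      (hψ.hasCompactSupport_euclGrad.mono fun z hz h0 => hz (by simp [h0, euclDot]))

lemma one_add_normSq_pos (z : Pt n) : 0 < 1 + normSq z := by linarith [normSq_nonneg z]

lemma fderiv_sq_div_one_add_normSq {f : Pt n → ℝ} {z : Pt n} (hf : DifferentiableAt ℝ f z) :
    fderiv ℝ (fun z => f z ^ 2 / (1 + normSq z)) z z =
      2 * f z * fderiv ℝ f z z / (1 + normSq z) -
        2 * f z ^ 2 * normSq z / (1 + normSq z) ^ 2 := by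
  have hne := (one_add_normSq_pos z).ne'
  have hd : DifferentiableAt ℝ (fun z : Pt n => 1 + normSq z) z := by fun_prop
  simp_rw [div_eq_mul_inv]
  have hinv : HasFDerivAt (fun z : Pt n => (1 + normSq z)⁻¹) _ z :=
    (hasDerivAt_inv hne).comp_hasFDerivAt z hd.hasFDerivAt
  have hmul : HasFDerivAt (fun z => f z ^ 2 * (1 + normSq z)⁻¹) _ z :=
    (hf.hasFDerivAt.pow 2).mul hinv
  rw [hmul.fderiv]
  simp [fderiv_normSq, euclDot_self]
  field_simp
  ring

lemma IsTest.sq_div_one_add_normSq {ψ : Pt n → ℝ} (h : IsTest ψ) :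
    IsTest fun z => ψ z ^ 2 / (1 + normSq z) :=
  ⟨(h.1.pow 2).div (by fun_prop) fun z => (one_add_normSq_pos z).ne',
    h.2.mono fun z hz h0 => hz (by simp [h0])⟩

lemma hardy_pointwise {b : ℝ} (hb : 0 < b) (s : ℝ) (v z : Pt n) :
    b * (s ^ 2 / (1 + normSq z)) - b⁻¹ * normSq v ≤
      2 * s * euclDot v z / (1 + normSq z) - 2 * s ^ 2 * normSq z / (1 + normSq z) ^ 2 +
        2 * (b + 1) * (s ^ 2 / (1 + normSq z)) := by
  have hpos := one_add_normSq_pos z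
  have hsq := normSq_nonneg (v + (b * s / (1 + normSq z)) • z)
  rw [normSq_add, euclDot_smul_right, normSq_smul] at hsq
  have hle : 0 ≤ b * s ^ 2 / (1 + normSq z) ^ 2 + 2 * s ^ 2 / (1 + normSq z) ^ 2 := by positivity
  have hdecomp : 2 * s * euclDot v z / (1 + normSq z) -
        2 * s ^ 2 * normSq z / (1 + normSq z) ^ 2 + 2 * (b + 1) * (s ^ 2 / (1 + normSq z)) -
        (b * (s ^ 2 / (1 + normSq z)) - b⁻¹ * normSq v) =
      b⁻¹ * (normSq v + 2 * (b * s / (1 + normSq z) * euclDot v z) +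
        (b * s / (1 + normSq z)) ^ 2 * normSq z) +
        (b * s ^ 2 / (1 + normSq z) ^ 2 + 2 * s ^ 2 / (1 + normSq z) ^ 2) := by
    field_simp
    ring
  have := mul_nonneg (inv_nonneg.2 hb.le) hsq
  linarith

lemma IsTest.integrable_normSq_euclGrad [Fact (-1 < a)] {ψ : Pt n → ℝ} (h : IsTest ψ) :
    Integrable (fun z => normSq (euclGrad ψ z)) (halfMeasure n a) :=
  (continuous_normSq.comp h.continuous_euclGrad).integrable_of_hasCompactSupport
    (h.hasCompactSupport_euclGrad.comp_left (by simp [normSq]))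

lemma IsTest.integrable_fderiv_self [Fact (-1 < a)] {ψ : Pt n → ℝ} (h : IsTest ψ) :
    Integrable (fun z => fderiv ℝ ψ z z) (halfMeasure n a) :=
  ((h.1.continuous_fderiv (by simp)).clm_apply continuous_id).integrable_of_hasCompactSupport
    ((h.2.fderiv ℝ).mono fun z hz h0 => hz (by simp [h0]))

lemma IsTest.hardy [Fact (-1 < a)] (hb : 1 < halfDim n a) {ψ : Pt n → ℝ} (hψ : IsTest ψ) :
    ∫ z, ψ z ^ 2 / (1 + normSq z) ∂halfMeasure n a ≤
      (1 / (halfDim n a - 1)) ^ 2 * ∫ z, normSq (euclGrad ψ z) ∂halfMeasure n a := by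
  obtain ⟨b, hb0, hN⟩ : ∃ b, 0 < b ∧ halfDim n a = b + 1 := ⟨halfDim n a - 1, by linarith, by ring⟩
  have hF := hψ.sq_div_one_add_normSq
  have hi := hF.continuous.integrable_of_hasCompactSupport hF.2 (μ := halfMeasure n a)
  have higrad := hψ.integrable_normSq_euclGrad (a := a)
  have hdil := integral_fderiv_sub_halfMeasure (a := a) (hF.1.of_le (by exact_mod_cast le_top))
    hF.2 0
  simp only [Prod.mk_zero_zero, sub_zero] at hdil
  have hmono : ∫ z, (b * (ψ z ^ 2 / (1 + normSq z)) - b⁻¹ * normSq (euclGrad ψ z))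
        ∂halfMeasure n a ≤
      ∫ z, (fderiv ℝ (fun z => ψ z ^ 2 / (1 + normSq z)) z z +
        2 * (b + 1) * (ψ z ^ 2 / (1 + normSq z))) ∂halfMeasure n a := by
    refine integral_mono ((hi.const_mul b).sub (higrad.const_mul b⁻¹))
      (hF.integrable_fderiv_self.add (hi.const_mul _)) fun z => ?_
    simp_rw [fderiv_sq_div_one_add_normSq (hψ.differentiableAt z),
      ← euclDot_euclGrad (hψ.differentiableAt z)]
    exact hardy_pointwise hb0 (ψ z) (euclGrad ψ z) z
  rw [integral_sub (hi.const_mul b) (higrad.const_mul b⁻¹),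
    integral_add hF.integrable_fderiv_self (hi.const_mul _), hdil, hN] at hmono
  simp_rw [integral_const_mul] at hmono
  rw [neg_add_cancel, sub_nonpos, ← le_inv_mul_iff₀ hb0] at hmono
  rw [hN, add_sub_cancel_right]
  exact hmono.trans_eq (by ring)

/-- The square root of the weight in Hardy's inequality. -/
def hardyWeight (z : Pt n) : ℝ := (Real.sqrt (1 + normSq z))⁻¹

lemma hardyWeight_pos (z : Pt n) : 0 < hardyWeight z :=
  inv_pos.2 (Real.sqrt_pos.2 (one_add_normSq_pos z))

lemma hardyWeight_le_one (z : Pt n) : hardyWeight z ≤ 1 :=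
  inv_le_one_of_one_le₀ (Real.one_le_sqrt.2 (by linarith [normSq_nonneg z]))

lemma hardyWeight_sq (z : Pt n) : hardyWeight z ^ 2 = (1 + normSq z)⁻¹ := by
  rw [hardyWeight, inv_pow, Real.sq_sqrt (one_add_normSq_pos z).le]

lemma inv_hardyWeight_le (z : Pt n) : (hardyWeight z)⁻¹ ≤ 1 + normSq z := by
  rw [hardyWeight, inv_inv]
  exact Real.sqrt_le_self_iff.2 (Or.inr (by linarith [normSq_nonneg z]))

@[fun_prop]
lemma continuous_hardyWeight : Continuous (hardyWeight : Pt n → ℝ) :=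
  Continuous.inv₀ (by fun_prop) fun z => (Real.sqrt_pos.2 (one_add_normSq_pos z)).ne'

@[fun_prop]
lemma continuous_inv_hardyWeight : Continuous fun z : Pt n => (hardyWeight z)⁻¹ :=
  continuous_hardyWeight.inv₀ fun z => (hardyWeight_pos z).ne'

lemma eLpNorm_two_eq_sqrt {X F : Type*} [MeasurableSpace X] [NormedAddCommGroup F] {μ : Measure X}
    {f : X → F} (hf : MemLp f 2 μ) :
    eLpNorm f 2 μ = ENNReal.ofReal (Real.sqrt (∫ x, ‖f x‖ ^ 2 ∂μ)) := by
  rw [hf.eLpNorm_eq_integral_rpow_norm (by simp) (by simp), Real.sqrt_eq_rpow]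
  simp

lemma IsTest.memLp_hardyWeight_mul [Fact (-1 < a)] {ψ : Pt n → ℝ} (h : IsTest ψ) :
    MemLp (fun z => hardyWeight z * ψ z) 2 (halfMeasure n a) :=
  (continuous_hardyWeight.mul h.continuous).memLp_of_hasCompactSupport h.2.mul_left

lemma IsTest.eLpNorm_hardy [Fact (-1 < a)] (hb : 1 < halfDim n a) {ψ : Pt n → ℝ} (hψ : IsTest ψ) :
    eLpNorm (fun z => hardyWeight z * ψ z) 2 (halfMeasure n a) ≤
      ENNReal.ofReal (2 / (halfDim n a - 1)) * eLpNorm (euclGrad ψ) 2 (halfMeasure n a) := by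
  have : 0 < halfDim n a - 1 := by linarith
  have hgrad := hψ.memLp_euclGrad (a := a)
  rw [eLpNorm_two_eq_sqrt hψ.memLp_hardyWeight_mul, eLpNorm_two_eq_sqrt hgrad,
    ← ENNReal.ofReal_mul (by positivity)]
  refine ENNReal.ofReal_le_ofReal (Real.sqrt_le_iff.2 ⟨by positivity, ?_⟩)
  rw [mul_pow, Real.sq_sqrt (integral_nonneg fun z => by positivity)]
  calc ∫ z, ‖hardyWeight z * ψ z‖ ^ 2 ∂halfMeasure n a
      = ∫ z, ψ z ^ 2 / (1 + normSq z) ∂halfMeasure n a := by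
        congr 1 with z
        rw [Real.norm_eq_abs, sq_abs, mul_pow, hardyWeight_sq, inv_mul_eq_div]
    _ ≤ (1 / (halfDim n a - 1)) ^ 2 * ∫ z, normSq (euclGrad ψ z) ∂halfMeasure n a := hψ.hardy hb
    _ ≤ (1 / (halfDim n a - 1)) ^ 2 * ∫ z, 2 ^ 2 * ‖euclGrad ψ z‖ ^ 2 ∂halfMeasure n a := by
        gcongr
        · exact hψ.integrable_normSq_euclGrad
        · exact (hgrad.integrable_norm_pow (by simp)).const_mul _
        · intro z
          simp only [← euclNorm_sq, ← mul_pow]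
          exact pow_le_pow_left₀ (euclNorm_nonneg _) (euclNorm_le _) 2
    _ = (2 / (halfDim n a - 1)) ^ 2 * ∫ z, ‖euclGrad ψ z‖ ^ 2 ∂halfMeasure n a := by
        rw [integral_const_mul]; ring

/-! ### Functions dominated by Gaussians -/

/-- `f` decays at least as fast as a Gaussian. -/
def IsGaussDominated {F : Type*} [Norm F] (f : Pt n → F) : Prop :=
  ∃ t > 0, ∃ C, ∀ z, ‖f z‖ ≤ C * gauss t 0 z

lemma one_add_pow_le_mul_exp {s r : ℝ} (hs : 0 < s) (hr : 0 ≤ r) (m : ℕ) :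
    (1 + r) ^ m ≤ m.factorial * Real.exp s / s ^ m * Real.exp (s * r) := by
  have hexp := Real.pow_div_factorial_le_exp (s * (1 + r)) (by positivity) m
  rw [div_le_iff₀ (by positivity), mul_pow, mul_add, mul_one, Real.exp_add] at hexp
  rw [div_mul_eq_mul_div, le_div_iff₀ (by positivity)]
  linarith

lemma gauss_le_exp_mul_gauss_half {t : ℝ} (ht : 0 ≤ t) (x : EuclideanSpace ℝ (Fin n)) (z : Pt n) :
    gauss t x z ≤ Real.exp (t * ‖x‖ ^ 2) * gauss (t / 2) 0 z := by
  have htri : ‖z.1‖ ^ 2 ≤ 2 * ‖z.1 - x‖ ^ 2 + 2 * ‖x‖ ^ 2 := by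
    have := norm_le_norm_sub_add z.1 x
    nlinarith [sq_nonneg (‖z.1 - x‖ - ‖x‖), norm_nonneg z.1]
  rw [gauss, gauss, ← Real.exp_add, normSq_sub_mk, normSq_sub_mk, sub_zero]
  refine Real.exp_le_exp.2 ?_
  nlinarith [mul_le_mul_of_nonneg_left htri ht, mul_nonneg ht (sq_nonneg z.2)]

lemma isGaussDominated_gauss {t : ℝ} (ht : 0 < t) (x : EuclideanSpace ℝ (Fin n)) :
    IsGaussDominated (gauss t x) :=
  ⟨t / 2, by positivity, _, fun z => by
    rw [Real.norm_of_nonneg (gauss_pos t x z).le]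
    exact gauss_le_exp_mul_gauss_half ht.le x z⟩

section GaussDominated

variable {F G : Type*} [NormedAddCommGroup F] [NormedAddCommGroup G] {f : Pt n → F} {g : Pt n → G}

lemma IsGaussDominated.of_norm_le (hf : IsGaussDominated f) {C : ℝ} (m : ℕ)
    (h : ∀ z, ‖g z‖ ≤ C * (1 + normSq z) ^ m * ‖f z‖) : IsGaussDominated g := by
  obtain ⟨t, ht, D, hD⟩ := hf
  have : 0 ≤ D :=
    nonneg_of_mul_nonneg_left ((norm_nonneg _).trans (hD 0)) (gauss_pos t 0 (0 : Pt n))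
  refine ⟨t / 2, by positivity, |C| * (m.factorial * Real.exp (t / 2) / (t / 2) ^ m) * D,
    fun z => ?_⟩
  have hz := normSq_nonneg z
  have hgauss : Real.exp (t / 2 * normSq z) * gauss t 0 z = gauss (t / 2) 0 z := by
    rw [gauss, gauss, ← Real.exp_add, Prod.mk_zero_zero, sub_zero]; ring_nf
  calc ‖g z‖ ≤ C * (1 + normSq z) ^ m * ‖f z‖ := h z
    _ ≤ |C| * (m.factorial * Real.exp (t / 2) / (t / 2) ^ m * Real.exp (t / 2 * normSq z)) *
          (D * gauss t 0 z) := by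
        gcongr
        · exact le_abs_self C
        · exact one_add_pow_le_mul_exp (half_pos ht) hz m
        · exact hD z
    _ = _ := by rw [← hgauss]; ring

lemma IsGaussDominated.memLp_two [Fact (-1 < a)] (h : IsGaussDominated f)
    (hf : AEStronglyMeasurable f (halfMeasure n a)) : MemLp f 2 (halfMeasure n a) := by
  obtain ⟨t, ht, C, hC⟩ := h
  rw [memLp_two_iff_integrable_sq_norm hf]
  refine ((integrable_gauss (t := 2 * t) (by positivity) 0).const_mul (C ^ 2)).mono' (hf.norm.pow 2)
    (ae_of_all _ fun z => ?_)
  rw [Real.norm_of_nonneg (by positivity), ← gauss_sq, ← mul_pow]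
  exact pow_le_pow_left₀ (norm_nonneg _) (hC z) 2

lemma IsGaussDominated.memLp_inv_hardyWeight_mul [Fact (-1 < a)] {f : Pt n → ℝ}
    (h : IsGaussDominated f) (hf : AEStronglyMeasurable f (halfMeasure n a)) :
    MemLp (fun z => (hardyWeight z)⁻¹ * f z) 2 (halfMeasure n a) := by
  refine (h.of_norm_le (C := 1) 1 fun z => ?_).memLp_two
    (continuous_inv_hardyWeight.aestronglyMeasurable.mul hf)
  rw [norm_mul, norm_inv, Real.norm_of_nonneg (hardyWeight_pos z).le, one_mul, pow_one]
  exact mul_le_mul_of_nonneg_right (inv_hardyWeight_le z) (norm_nonneg _)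

lemma hardyWeight_mul_mul_inv_mul (z : Pt n) (r s : ℝ) :
    hardyWeight z * r * ((hardyWeight z)⁻¹ * s) = r * s := by
  have := (hardyWeight_pos z).ne'
  field_simp

lemma IsGaussDominated.integrable_mul [Fact (-1 < a)] {φ f : Pt n → ℝ} (h : IsGaussDominated f)
    (hf : AEStronglyMeasurable f (halfMeasure n a))
    (hφ : MemLp (fun z => hardyWeight z * φ z) 2 (halfMeasure n a)) :
    Integrable (fun z => φ z * f z) (halfMeasure n a) :=
  (hφ.integrable_mul (h.memLp_inv_hardyWeight_mul hf)).congr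
    (ae_of_all _ fun _ => hardyWeight_mul_mul_inv_mul _ _ _)

end GaussDominated

lemma one_add_normSq_sub_mk_le (x : EuclideanSpace ℝ (Fin n)) (z : Pt n) :
    1 + normSq (z - (x, 0)) ≤ (2 + 2 * ‖x‖ ^ 2) * (1 + normSq z) := by
  simpa [sub_eq_add_neg, normSq] using one_add_normSq_add_le z (-(x, 0))

lemma one_add_normSq_le (x : EuclideanSpace ℝ (Fin n)) (z : Pt n) :
    1 + normSq z ≤ (2 + 2 * ‖x‖ ^ 2) * (1 + normSq (z - (x, 0))) := by
  have h := one_add_normSq_sub_mk_le (-x) (z - (x, 0))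
  have hz : z - (x, 0) - (-x, 0) = z := by ext <;> simp
  rwa [hz, norm_neg] at h

lemma isGaussDominated_gauss_smul_sub {t : ℝ} (ht : 0 < t) (x : EuclideanSpace ℝ (Fin n)) :
    IsGaussDominated fun z => gauss t x z • (z - (x, 0)) := by
  refine (isGaussDominated_gauss ht x).of_norm_le (C := 2 + 2 * ‖x‖ ^ 2) 1 fun z => ?_
  rw [norm_smul, mul_comm, pow_one]
  refine mul_le_mul_of_nonneg_right (le_trans ?_ (one_add_normSq_sub_mk_le x z)) (norm_nonneg _)
  have := norm_le_euclNorm (z - (x, 0))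
  nlinarith [euclNorm_sq (z - (x, 0)), sq_nonneg (euclNorm (z - (x, 0)) - 1)]

lemma isGaussDominated_gauss_mul_normSq {t : ℝ} (ht : 0 < t) (x : EuclideanSpace ℝ (Fin n))
    (c d : ℝ) : IsGaussDominated fun z => gauss t x z * (c * normSq (z - (x, 0)) - d) := by
  refine (isGaussDominated_gauss ht x).of_norm_le (C := (|c| + |d|) * (2 + 2 * ‖x‖ ^ 2)) 1
    fun z => ?_
  rw [norm_mul, mul_comm, pow_one]
  refine mul_le_mul_of_nonneg_right ?_ (norm_nonneg _)
  have hN := normSq_nonneg (z - (x, 0))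
  calc ‖c * normSq (z - (x, 0)) - d‖ ≤ |c| * normSq (z - (x, 0)) + |d| := by
        rw [← abs_of_nonneg hN, ← abs_mul, abs_of_nonneg hN]
        exact abs_sub _ _
    _ ≤ (|c| + |d|) * (1 + normSq (z - (x, 0))) := by
        nlinarith [mul_nonneg (abs_nonneg d) hN, abs_nonneg c]
    _ ≤ _ := by
        rw [mul_assoc]
        exact mul_le_mul_of_nonneg_left (one_add_normSq_sub_mk_le x z) (by positivity)

lemma memLp_gauss_smul_sub [Fact (-1 < a)] {t : ℝ} (ht : 0 < t) (x : EuclideanSpace ℝ (Fin n)) :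
    MemLp (fun z => gauss t x z • (z - (x, 0))) 2 (halfMeasure n a) :=
  (isGaussDominated_gauss_smul_sub ht x).memLp_two (Continuous.aestronglyMeasurable (by fun_prop))

/-! ### Limits of test functions in the energy norm -/

/-- `(φ, g)` is a limit of pairs `(ψ_j, ∇ψ_j)` with test functions `ψ_j`, where gradients converge
in `L²(y^a dx dy)` and functions in `L²(y^a dx dy)` on bounded sets. -/
def IsTestLimit (a : ℝ) (φ : Pt n → ℝ) (g : Pt n → Pt n) : Prop :=
  AEStronglyMeasurable φ (halfMeasure n a) ∧ MemLp g 2 (halfMeasure n a) ∧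
  ∃ ψ : ℕ → Pt n → ℝ, (∀ j, IsTest (ψ j)) ∧
    Tendsto (fun j => eLpNorm (fun z => euclGrad (ψ j) z - g z) 2 (halfMeasure n a)) atTop (𝓝 0) ∧
    ∀ r : ℝ, Tendsto (fun j => eLpNorm (fun z => ψ j z - φ z) 2
      ((halfMeasure n a).restrict (euclBall 0 r))) atTop (𝓝 0)

lemma tendsto_zero_of_le_add {u v w : ℕ → ℝ≥0∞} (hv : Tendsto v atTop (𝓝 0))
    (hw : Tendsto w atTop (𝓝 0)) (h : ∀ j, u j ≤ v j + w j) : Tendsto u atTop (𝓝 0) :=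
  tendsto_of_tendsto_of_tendsto_of_le_of_le tendsto_const_nhds (by simpa using hv.add hw)
    (fun _ => zero_le) h

lemma eLpNorm_sub_le_add {X F : Type*} [MeasurableSpace X] [NormedAddCommGroup F] {μ : Measure X}
    {f g h : X → F} {p : ℝ≥0∞} (hp : 1 ≤ p) (hf : AEStronglyMeasurable f μ)
    (hg : AEStronglyMeasurable g μ) (hh : AEStronglyMeasurable h μ) :
    eLpNorm (fun x => f x - h x) p μ ≤
      eLpNorm (fun x => f x - g x) p μ + eLpNorm (fun x => g x - h x) p μ := by
  have h_add := eLpNorm_add_le (hf.sub hg) (hg.sub hh) hp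
  rwa [sub_add_sub_cancel] at h_add

lemma IsSobolev.exists_isTest_eLpNorm_sub_lt {u : Pt n → ℝ} {v : Pt n → Pt n}
    (h : IsSobolev a u v) {ε : ℝ≥0∞} (hε : 0 < ε) :
    ∃ ψ : Pt n → ℝ, IsTest ψ ∧ eLpNorm (fun z => ψ z - u z) 2 (halfMeasure n a) < ε ∧
      eLpNorm (fun z => euclGrad ψ z - v z) 2 (halfMeasure n a) < ε := by
  obtain ⟨_, _, ψ, hψ, hfun, hgrad⟩ := h
  obtain ⟨i, hi⟩ := ((hfun.eventually_lt_const hε).and (hgrad.eventually_lt_const hε)).exists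
  exact ⟨ψ i, hψ i, hi⟩

lemma IsInEnergyClosure.isTestLimit {A : Set (EuclideanSpace ℝ (Fin n))} {φ : Pt n → ℝ}
    {g : Pt n → Pt n} [Fact (-1 < a)] (h : IsInEnergyClosure a A φ g) : IsTestLimit a φ g := by
  obtain ⟨hφ, hg, u, v, hadm, hv, hu⟩ := h
  have hsmall : Tendsto (fun j : ℕ => ((j + 1 : ℕ) : ℝ≥0∞)⁻¹) atTop (𝓝 0) :=
    ENNReal.tendsto_inv_nat_nhds_zero.comp (tendsto_add_atTop_nat 1)
  have hsob j : IsSobolev a (u j) (v j) := (hadm j).1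
  choose ψ hψ hfun hgrad using fun j =>
    (hsob j).exists_isTest_eLpNorm_sub_lt (ENNReal.inv_pos.2 (ENNReal.natCast_ne_top (j + 1)))
  refine ⟨hφ, hg, ψ, hψ, tendsto_zero_of_le_add hsmall hv fun j => ?_,
    fun r => tendsto_zero_of_le_add hsmall (hu r) fun j => ?_⟩
  · exact (eLpNorm_sub_le_add one_le_two (hψ j).memLp_euclGrad.1 (hsob j).2.1.1 hg.1).trans
      (add_le_add_left (hgrad j).le _)
  · refine (eLpNorm_sub_le_add one_le_two (hψ j).memLp.1.restrict (hsob j).1.1.restrict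
      hφ.restrict).trans (add_le_add_left ?_ _)
    exact (eLpNorm_mono_measure _ Measure.restrict_le_self).trans (hfun j).le

lemma eLpNorm_le_of_forall_euclBall {μ : Measure (Pt n)} {f : Pt n → ℝ} {c : ℝ≥0∞}
    (h : ∀ r : ℝ, eLpNorm f 2 (μ.restrict (euclBall 0 r)) ≤ c) : eLpNorm f 2 μ ≤ c := by
  have hiff (μ' : Measure (Pt n)) :
      eLpNorm f 2 μ' ≤ c ↔ ∫⁻ z, ‖f z‖ₑ ^ (2 : ℝ) ∂μ' ≤ c ^ (2 : ℝ) := by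
    rw [eLpNorm_eq_lintegral_rpow_enorm_toReal (by simp) (by simp), one_div,
      ENNReal.rpow_inv_le_iff (by simp), ENNReal.toReal_ofNat]
  simp_rw [hiff] at h ⊢
  have hdir : Monotone fun k : ℕ => euclBall (0 : Pt n) k :=
    (monotone_euclBall 0).comp Nat.mono_cast
  rw [← setLIntegral_univ, ← iUnion_euclBall_natCast,
    setLIntegral_iUnion_of_directed _ hdir.directed_le]
  exact iSup_le fun k => h k

lemma IsTestLimit.eLpNorm_hardy [Fact (-1 < a)] (hb : 1 < halfDim n a) {φ : Pt n → ℝ}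
    {g : Pt n → Pt n} (h : IsTestLimit a φ g) :
    eLpNorm (fun z => hardyWeight z * φ z) 2 (halfMeasure n a) ≤
      ENNReal.ofReal (2 / (halfDim n a - 1)) * eLpNorm g 2 (halfMeasure n a) := by
  obtain ⟨hφ, hg, ψ, hψ, hgrad, hloc⟩ := h
  refine eLpNorm_le_of_forall_euclBall fun r => ?_
  have hlim := (hloc r).add (ENNReal.Tendsto.const_mul (hgrad.add_const
    (eLpNorm g 2 (halfMeasure n a))) (Or.inr (ENNReal.ofReal_ne_top (r := 2 / (halfDim n a - 1)))))
  rw [zero_add, zero_add] at hlim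
  refine ge_of_tendsto' hlim fun k => ?_
  have hsplit : (fun z => hardyWeight z * φ z) =
      (fun z => hardyWeight z * ψ k z) - fun z => hardyWeight z * (ψ k z - φ z) := by
    ext z; simp only [Pi.sub_apply]; ring
  have hnear : eLpNorm (fun z => hardyWeight z * (ψ k z - φ z)) 2
      ((halfMeasure n a).restrict (euclBall 0 r)) ≤
      eLpNorm (fun z => ψ k z - φ z) 2 ((halfMeasure n a).restrict (euclBall 0 r)) :=
    eLpNorm_mono fun z => by
      rw [norm_mul, Real.norm_of_nonneg (hardyWeight_pos z).le]
      exact mul_le_of_le_one_left (norm_nonneg _) (hardyWeight_le_one z)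
  have htest : eLpNorm (fun z => hardyWeight z * ψ k z) 2
      ((halfMeasure n a).restrict (euclBall 0 r)) ≤ ENNReal.ofReal (2 / (halfDim n a - 1)) *
        (eLpNorm (fun z => euclGrad (ψ k) z - g z) 2 (halfMeasure n a) +
          eLpNorm g 2 (halfMeasure n a)) := by
    refine ((eLpNorm_mono_measure _ Measure.restrict_le_self).trans
      ((hψ k).eLpNorm_hardy hb)).trans (mul_le_mul_right ?_ _)
    simpa using eLpNorm_sub_le_add one_le_two (hψ k).memLp_euclGrad.1 hg.1
      (aestronglyMeasurable_zero (β := Pt n))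
  rw [hsplit]
  refine (eLpNorm_sub_le (hψ k).memLp_hardyWeight_mul.1.restrict
    (continuous_hardyWeight.aestronglyMeasurable.mul
      ((hψ k).memLp.1.sub hφ).restrict) one_le_two).trans ?_
  rw [add_comm]
  exact add_le_add hnear htest

lemma IsTestLimit.memLp_hardyWeight_mul [Fact (-1 < a)] (hb : 1 < halfDim n a) {φ : Pt n → ℝ}
    {g : Pt n → Pt n} (h : IsTestLimit a φ g) :
    MemLp (fun z => hardyWeight z * φ z) 2 (halfMeasure n a) :=
  ⟨continuous_hardyWeight.aestronglyMeasurable.mul h.1, (h.eLpNorm_hardy hb).trans_lt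
    (ENNReal.mul_lt_top ENNReal.ofReal_lt_top h.2.1.2)⟩

lemma IsTest.sub_isTestLimit [Fact (-1 < a)] {φ χ : Pt n → ℝ} {g : Pt n → Pt n} (hχ : IsTest χ)
    (h : IsTestLimit a φ g) : IsTestLimit a (fun z => χ z - φ z) (fun z => euclGrad χ z - g z) := by
  obtain ⟨hφ, hg, ψ, hψ, hgrad, hloc⟩ := h
  refine ⟨hχ.memLp.1.sub hφ, hχ.memLp_euclGrad.sub hg, fun j z => χ z - ψ j z,
    fun j => hχ.sub (hψ j), hgrad.congr fun j => ?_, fun r => (hloc r).congr fun j => ?_⟩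
  · simp_rw [euclGrad_sub (hχ.differentiableAt _) ((hψ j).differentiableAt _),
      sub_sub_sub_cancel_left]
    exact eLpNorm_sub_comm _ _ _ _
  · simp_rw [sub_sub_sub_cancel_left]
    exact eLpNorm_sub_comm _ _ _ _

/-! ### Pairings in `L²` -/

section Bilinear

variable {X E F : Type*} [MeasurableSpace X] {μ : Measure X}
  [NormedAddCommGroup E] [NormedSpace ℝ E] [NormedAddCommGroup F] [NormedSpace ℝ F]

lemma integrable_bilin_of_memLp_two (B : E →L[ℝ] F →L[ℝ] ℝ) {f : X → E} {g : X → F}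
    (hf : MemLp f 2 μ) (hg : MemLp g 2 μ) : Integrable (fun x => B (f x) (g x)) μ := by
  rw [← memLp_one_iff_integrable]
  exact MemLp.of_bilin (p := 2) (q := 2) (fun x y => B x y) ‖B‖₊ hf hg
    (B.aestronglyMeasurable_comp₂ hf.1 hg.1) (ae_of_all _ fun x => B.le_opNorm₂ _ _)

lemma tendsto_integral_bilin_of_eLpNorm_two (B : E →L[ℝ] F →L[ℝ] ℝ) {f : ℕ → X → E} {f₀ : X → E}
    {g : X → F} (hf : ∀ j, MemLp (f j) 2 μ) (hf₀ : MemLp f₀ 2 μ) (hg : MemLp g 2 μ)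
    (h : Tendsto (fun j => eLpNorm (fun x => f j x - f₀ x) 2 μ) atTop (𝓝 0)) :
    Tendsto (fun j => ∫ x, B (f j x) (g x) ∂μ) atTop (𝓝 (∫ x, B (f₀ x) (g x) ∂μ)) := by
  refine tendsto_integral_of_L1' _ (integrable_bilin_of_memLp_two B hf₀ hg).1
    (Eventually.of_forall fun j => integrable_bilin_of_memLp_two B (hf j) hg) ?_
  have hlim : Tendsto (fun j => (‖B‖₊ : ℝ≥0∞) * eLpNorm (fun x => f j x - f₀ x) 2 μ *
      eLpNorm g 2 μ) atTop (𝓝 (‖B‖₊ * 0 * eLpNorm g 2 μ)) :=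
    ENNReal.Tendsto.mul_const (ENNReal.Tendsto.const_mul h (Or.inr ENNReal.coe_ne_top))
      (Or.inr hg.2.ne)
  rw [mul_zero, zero_mul] at hlim
  refine tendsto_of_tendsto_of_tendsto_of_le_of_le tendsto_const_nhds hlim (fun j => zero_le)
    fun j => ?_
  calc eLpNorm ((fun x => B (f j x) (g x)) - fun x => B (f₀ x) (g x)) 1 μ
      = eLpNorm (fun x => B (f j x - f₀ x) (g x)) 1 μ := by congr 1; ext1 x; simp
    _ ≤ _ := eLpNorm_le_eLpNorm_mul_eLpNorm_of_nnnorm (p := 2) (q := 2) ((hf j).sub hf₀).1 hg.1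
        (fun x y => B x y) ‖B‖₊ (ae_of_all _ fun x => B.le_opNorm₂ _ _)

lemma tendsto_eLpNorm_linComb {f f' : ℕ → X → F} {p : ℝ≥0∞} (hp : 1 ≤ p) (c d : ℝ)
    (hf : ∀ j, AEStronglyMeasurable (f j) μ) (hf' : ∀ j, AEStronglyMeasurable (f' j) μ)
    (h : Tendsto (fun j => eLpNorm (f j) p μ) atTop (𝓝 0))
    (h' : Tendsto (fun j => eLpNorm (f' j) p μ) atTop (𝓝 0)) :
    Tendsto (fun j => eLpNorm (fun x => c • f j x + d • f' j x) p μ) atTop (𝓝 0) := by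
  have hc := ENNReal.Tendsto.const_mul h (a := ‖c‖ₑ) (Or.inr enorm_ne_top)
  have hd := ENNReal.Tendsto.const_mul h' (a := ‖d‖ₑ) (Or.inr enorm_ne_top)
  rw [mul_zero] at hc hd
  refine tendsto_zero_of_le_add hc hd fun j => ?_
  rw [← eLpNorm_const_smul, ← eLpNorm_const_smul]
  exact eLpNorm_add_le ((hf j).const_smul c) ((hf' j).const_smul d) hp

end Bilinear

lemma integrable_euclDot {g w : Pt n → Pt n} (hg : MemLp g 2 (halfMeasure n a))
    (hw : MemLp w 2 (halfMeasure n a)) :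
    Integrable (fun z => euclDot (g z) (w z)) (halfMeasure n a) := by
  simpa only [euclDotL_apply] using integrable_bilin_of_memLp_two (euclDotL n) hg hw

lemma tendsto_integral_euclDot {g : ℕ → Pt n → Pt n} {g₀ w : Pt n → Pt n}
    (hg : ∀ j, MemLp (g j) 2 (halfMeasure n a)) (hg₀ : MemLp g₀ 2 (halfMeasure n a))
    (hw : MemLp w 2 (halfMeasure n a))
    (h : Tendsto (fun j => eLpNorm (fun z => g j z - g₀ z) 2 (halfMeasure n a)) atTop (𝓝 0)) :
    Tendsto (fun j => ∫ z, euclDot (g j z) (w z) ∂halfMeasure n a) atTop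
      (𝓝 (∫ z, euclDot (g₀ z) (w z) ∂halfMeasure n a)) := by
  simpa only [euclDotL_apply] using tendsto_integral_bilin_of_eLpNorm_two (euclDotL n) hg hg₀ hw h

lemma IsTestLimit.tendsto_integral_mul [Fact (-1 < a)] (hb : 1 < halfDim n a) {φ f : Pt n → ℝ}
    {g : Pt n → Pt n} {ψ : ℕ → Pt n → ℝ} (h : IsTestLimit a φ g) (hψ : ∀ j, IsTest (ψ j))
    (hgrad : Tendsto (fun j => eLpNorm (fun z => euclGrad (ψ j) z - g z) 2 (halfMeasure n a))
      atTop (𝓝 0))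
    (hf : IsGaussDominated f) (hfm : AEStronglyMeasurable f (halfMeasure n a)) :
    Tendsto (fun j => ∫ z, ψ j z * f z ∂halfMeasure n a) atTop
      (𝓝 (∫ z, φ z * f z ∂halfMeasure n a)) := by
  have hlim : Tendsto (fun j => eLpNorm (fun z => hardyWeight z * ψ j z - hardyWeight z * φ z) 2
      (halfMeasure n a)) atTop (𝓝 0) := by
    have hzero := ENNReal.Tendsto.const_mul hgrad
      (Or.inr (ENNReal.ofReal_ne_top (r := 2 / (halfDim n a - 1))))
    rw [mul_zero] at hzero
    refine tendsto_of_tendsto_of_tendsto_of_le_of_le tendsto_const_nhds hzero (fun _ => zero_le)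
      fun j => ?_
    simpa only [mul_sub] using ((hψ j).sub_isTestLimit h).eLpNorm_hardy hb
  simpa only [ContinuousLinearMap.mul_apply', hardyWeight_mul_mul_inv_mul] using
    tendsto_integral_bilin_of_eLpNorm_two (ContinuousLinearMap.mul ℝ ℝ)
      (fun j => (hψ j).memLp_hardyWeight_mul) (h.memLp_hardyWeight_mul hb)
      (hf.memLp_inv_hardyWeight_mul hfm) hlim

lemma IsTestLimit.integral_gauss_mul_euclDot [Fact (-1 < a)] (hb : 1 < halfDim n a)
    {φ : Pt n → ℝ} {g : Pt n → Pt n} (h : IsTestLimit a φ g) {t : ℝ} (ht : 0 < t)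
    (x : EuclideanSpace ℝ (Fin n)) :
    ∫ z, gauss t x z * euclDot (g z) (z - (x, 0)) ∂halfMeasure n a =
      ∫ z, φ z * (gauss t x z * (2 * t * normSq (z - (x, 0)) - 2 * halfDim n a))
        ∂halfMeasure n a := by
  obtain ⟨_, hg, ψ, hψ, hgrad, _⟩ := id h
  have hleft := tendsto_integral_euclDot (fun j => (hψ j).memLp_euclGrad) hg
    (memLp_gauss_smul_sub ht x) hgrad
  have hright := h.tendsto_integral_mul hb hψ hgrad (isGaussDominated_gauss_mul_normSq ht x
    (2 * t) (2 * halfDim n a)) (Continuous.aestronglyMeasurable (by fun_prop))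
  simp only [euclDot_smul_right] at hleft
  exact tendsto_nhds_unique hleft
    (hright.congr fun j => ((hψ j).integral_gauss_mul_euclDot t x).symm)

/-! ### Boundary traces and linear combinations of admissible functions -/

lemma IsTest.isSobolev [Fact (-1 < a)] {ψ : Pt n → ℝ} (h : IsTest ψ) :
    IsSobolev a ψ (euclGrad ψ) :=
  ⟨h.memLp, h.memLp_euclGrad, fun _ => ψ, fun _ => h, by simp, by simp⟩

lemma IsSobolev.linComb [Fact (-1 < a)] {u u' : Pt n → ℝ} {g g' : Pt n → Pt n}
    (h : IsSobolev a u g) (h' : IsSobolev a u' g') (c d : ℝ) :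
    IsSobolev a (fun z => c * u z + d * u' z) (fun z => c • g z + d • g' z) := by
  obtain ⟨hu, hg, ψ, hψ, hfun, hgrad⟩ := h
  obtain ⟨hu', hg', ψ', hψ', hfun', hgrad'⟩ := h'
  refine ⟨(hu.const_mul c).add (hu'.const_mul d), (hg.const_smul c).add (hg'.const_smul d),
    fun j z => c * ψ j z + d * ψ' j z, fun j => ((hψ j).const_mul c).add ((hψ' j).const_mul d),
    (tendsto_eLpNorm_linComb one_le_two c d (fun j => ((hψ j).memLp.sub hu).1)
      (fun j => ((hψ' j).memLp.sub hu').1) hfun hfun').congr fun j => ?_,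
    (tendsto_eLpNorm_linComb one_le_two c d (fun j => ((hψ j).memLp_euclGrad.sub hg).1)
      (fun j => ((hψ' j).memLp_euclGrad.sub hg').1) hgrad hgrad').congr fun j => ?_⟩
  · congr 1 with z
    simp only [Pi.sub_apply, smul_eq_mul]
    ring
  · congr 1
    ext1 z
    rw [euclGrad_add (((hψ j).const_mul c).differentiableAt z)
      (((hψ' j).const_mul d).differentiableAt z), euclGrad_const_mul ((hψ j).differentiableAt z),
      euclGrad_const_mul ((hψ' j).differentiableAt z)]
    simp only [Pi.sub_apply, smul_sub]
    abel

lemma halfMeasure_euclBall_lt_top [Fact (-1 < a)] (c : Pt n) (r : ℝ) :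
    halfMeasure n a (euclBall c r) < ∞ :=
  (measure_mono (euclBall_subset_ball c r)).trans_lt measure_ball_lt_top

lemma isOpen_euclBall (c : Pt n) (r : ℝ) : IsOpen (euclBall c r) :=
  isOpen_lt (by fun_prop) continuous_const

lemma volume_restrict_absolutelyContinuous_halfMeasure (n : ℕ) (a : ℝ) :
    volume.restrict {z : Pt n | 0 < z.2} ≪ halfMeasure n a :=
  withDensity_absolutelyContinuous' (by fun_prop) <|
    (ae_restrict_mem measurableSet_upperHalf).mono fun z (hz : 0 < z.2) => by
      simpa using Real.rpow_pos_of_pos hz a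

lemma halfMeasure_euclBall_ne_zero (x : EuclideanSpace ℝ (Fin n)) {r : ℝ} (hr : 0 < r) :
    halfMeasure n a (euclBall (x, 0) r) ≠ 0 := by
  refine fun hzero => ?_
  have hnull := volume_restrict_absolutelyContinuous_halfMeasure n a hzero
  rw [Measure.restrict_apply (measurableSet_euclBall _ _)] at hnull
  refine ((isOpen_euclBall _ _).inter (isOpen_lt continuous_const continuous_snd)).measure_ne_zero
    volume ⟨(x, r / 2), ?_, half_pos hr⟩ hnull
  refine (Real.sqrt_lt' hr).2 ?_
  simp only [Prod.mk_sub_mk, sub_self, sub_zero, norm_zero]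
  nlinarith

lemma integrableOn_euclBall_of_memLp_two [Fact (-1 < a)] {f : Pt n → ℝ}
    (hf : MemLp f 2 (halfMeasure n a)) (c : Pt n) (r : ℝ) :
    IntegrableOn f (euclBall c r) (halfMeasure n a) :=
  have : IsFiniteMeasure ((halfMeasure n a).restrict (euclBall c r)) :=
    isFiniteMeasure_restrict.2 (halfMeasure_euclBall_lt_top c r).ne
  (hf.restrict _).integrable one_le_two

lemma HasTraceValue.linComb [Fact (-1 < a)] {u u' : Pt n → ℝ} {x : EuclideanSpace ℝ (Fin n)}
    {τ τ' : ℝ} (h : HasTraceValue a u x τ) (h' : HasTraceValue a u' x τ')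
    (hu : MemLp u 2 (halfMeasure n a)) (hu' : MemLp u' 2 (halfMeasure n a)) (c d : ℝ) :
    HasTraceValue a (fun z => c * u z + d * u' z) x (c * τ + d * τ') := by
  refine ((h.const_mul c).add (h'.const_mul d)).congr fun r => ?_
  simp only [setAverage_eq, smul_eq_mul]
  rw [integral_add ((integrableOn_euclBall_of_memLp_two hu _ r).const_mul c)
    ((integrableOn_euclBall_of_memLp_two hu' _ r).const_mul d), integral_const_mul,
    integral_const_mul]
  ring

lemma IsTest.hasTraceValue [Fact (-1 < a)] {ψ : Pt n → ℝ} (h : IsTest ψ)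
    (x : EuclideanSpace ℝ (Fin n)) : HasTraceValue a ψ x (ψ (x, 0)) := by
  rw [HasTraceValue, Metric.tendsto_nhds]
  intro ε hε
  obtain ⟨δ, hδ, hclose⟩ := Metric.continuousAt_iff.1
    (h.continuous.continuousAt (x := ((x, 0) : Pt n))) (ε / 2) (half_pos hε)
  filter_upwards [Ioo_mem_nhdsGT hδ] with r hr
  have hmem : ⨍ z in euclBall (x, 0) r, ψ z ∂halfMeasure n a ∈
      Metric.closedBall (ψ (x, 0)) (ε / 2) := by
    refine (convex_closedBall _ _).set_average_mem Metric.isClosed_closedBall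
      (halfMeasure_euclBall_ne_zero x hr.1) (halfMeasure_euclBall_lt_top _ r).ne ?_
      (integrableOn_euclBall_of_memLp_two h.memLp _ r)
    refine (ae_restrict_iff' (measurableSet_euclBall _ _)).2 (ae_of_all _ fun z hz => ?_)
    exact (hclose ((euclBall_subset_ball _ _ hz).trans hr.2)).le
  exact lt_of_le_of_lt hmem (by linarith)

/-! ### The Dirichlet energy -/

lemma energy_eq_eLpNorm_sq (g : Pt n → Pt n) :
    energy a g = eLpNorm (fun z => euclNorm (g z)) 2 (halfMeasure n a) ^ 2 := by
  rw [← ENNReal.rpow_natCast, Nat.cast_ofNat, eLpNorm_eq_lintegral_rpow_enorm_toReal (by simp)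
    (by simp), ← ENNReal.rpow_mul, ENNReal.toReal_ofNat, one_div,
    inv_mul_cancel₀ (by simp), ENNReal.rpow_one, energy]
  congr 1 with z
  rw [Real.enorm_of_nonneg (euclNorm_nonneg _), ENNReal.rpow_ofNat,
    ENNReal.ofReal_pow (euclNorm_nonneg _)]

lemma energy_eq_ofReal {g : Pt n → Pt n} (hg : MemLp g 2 (halfMeasure n a)) :
    energy a g = ENNReal.ofReal (∫ z, normSq (g z) ∂halfMeasure n a) := by
  have hint := integrable_euclDot hg hg
  simp_rw [euclDot_self] at hint
  rw [ofReal_integral_eq_lintegral_ofReal hint (ae_of_all _ fun z => normSq_nonneg _), energy]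
  simp_rw [euclNorm_sq]

lemma eLpNorm_euclNorm_le {v g : Pt n → Pt n} (hv : AEStronglyMeasurable v (halfMeasure n a))
    (hg : AEStronglyMeasurable g (halfMeasure n a)) :
    eLpNorm (fun z => euclNorm (v z)) 2 (halfMeasure n a) ≤
      ENNReal.ofReal 2 * eLpNorm (fun z => v z - g z) 2 (halfMeasure n a) +
        eLpNorm (fun z => euclNorm (g z)) 2 (halfMeasure n a) := by
  have hdiff : eLpNorm (fun z => euclNorm (v z - g z)) 2 (halfMeasure n a) ≤
      ENNReal.ofReal 2 * eLpNorm (fun z => v z - g z) 2 (halfMeasure n a) :=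
    eLpNorm_le_mul_eLpNorm_of_ae_le_mul (ae_of_all _ fun z => by
      rw [Real.norm_of_nonneg (euclNorm_nonneg _)]
      exact euclNorm_le _) 2
  refine (eLpNorm_mono_real fun z => ?_).trans ((eLpNorm_add_le
    (continuous_euclNorm.comp_aestronglyMeasurable (hv.sub hg))
    (continuous_euclNorm.comp_aestronglyMeasurable hg) one_le_two).trans (add_le_add_left hdiff _))
  rw [Real.norm_of_nonneg (euclNorm_nonneg _)]
  simpa using euclNorm_add_le (v z - g z) (g z)

lemma sCap_le_energy_of_tendsto {A : Set (EuclideanSpace ℝ (Fin n))} {u : ℕ → Pt n → ℝ}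
    {v : ℕ → Pt n → Pt n} {g : Pt n → Pt n} (hadm : ∀ j, IsAdmissible a A (u j) (v j))
    (hg : MemLp g 2 (halfMeasure n a))
    (h : Tendsto (fun j => eLpNorm (fun z => v j z - g z) 2 (halfMeasure n a)) atTop (𝓝 0)) :
    sCap a A ≤ energy a g := by
  have hlim := ENNReal.Tendsto.pow (n := 2)
    ((ENNReal.Tendsto.const_mul h (Or.inr (ENNReal.ofReal_ne_top (r := 2)))).add_const
      (eLpNorm (fun z => euclNorm (g z)) 2 (halfMeasure n a)))
  rw [mul_zero, zero_add, ← energy_eq_eLpNorm_sq] at hlim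
  refine ge_of_tendsto' hlim fun j => ?_
  calc sCap a A ≤ energy a (v j) := iInf₂_le_of_le (u j) (v j) (iInf_le _ (hadm j))
    _ ≤ _ := by
      rw [energy_eq_eLpNorm_sq]
      gcongr
      exact eLpNorm_euclNorm_le (hadm j).1.2.1.1 hg.1

lemma integral_normSq_add_smul {g w : Pt n → Pt n} (hg : MemLp g 2 (halfMeasure n a))
    (hw : MemLp w 2 (halfMeasure n a)) (t : ℝ) :
    ∫ z, normSq (g z + t • w z) ∂halfMeasure n a = ∫ z, normSq (g z) ∂halfMeasure n a +
      t * (2 * ∫ z, euclDot (g z) (w z) ∂halfMeasure n a +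
        t * ∫ z, normSq (w z) ∂halfMeasure n a) := by
  have hgg := integrable_euclDot hg hg
  have hgw := integrable_euclDot hg hw
  have hww := integrable_euclDot hw hw
  simp_rw [euclDot_self] at hgg hww
  simp_rw [normSq_add, normSq_smul, euclDot_smul_right]
  have hcross := (hgw.const_mul t).const_mul 2
  rw [integral_add (hgg.fun_add hcross) (hww.const_mul _), integral_add hgg hcross,
    integral_const_mul, integral_const_mul, integral_const_mul]
  ring

lemma integral_euclDot_nonneg_of_forall_energy_le {g w : Pt n → Pt n}
    (hg : MemLp g 2 (halfMeasure n a)) (hw : MemLp w 2 (halfMeasure n a))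
    (h : ∀ t : ℝ, 0 < t → t ≤ 1 → energy a g ≤ energy a (fun z => g z + t • w z)) :
    0 ≤ ∫ z, euclDot (g z) (w z) ∂halfMeasure n a := by
  have hquot (t : ℝ) (ht : 0 < t) (ht1 : t ≤ 1) :
      0 ≤ 2 * ∫ z, euclDot (g z) (w z) ∂halfMeasure n a +
        t * ∫ z, normSq (w z) ∂halfMeasure n a := by
    have hle : energy a g ≤ energy a (g + t • w) := h t ht ht1
    rw [energy_eq_ofReal hg, energy_eq_ofReal (hg.add (hw.const_smul t)),
      ENNReal.ofReal_le_ofReal_iff (integral_nonneg fun z => normSq_nonneg _)] at hle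
    simp only [Pi.add_apply, Pi.smul_apply, integral_normSq_add_smul hg hw] at hle
    exact nonneg_of_mul_nonneg_right (by linarith) ht
  have hlim : Tendsto (fun t : ℝ => 2 * ∫ z, euclDot (g z) (w z) ∂halfMeasure n a +
      t * ∫ z, normSq (w z) ∂halfMeasure n a) (𝓝[>] 0)
      (𝓝 (2 * ∫ z, euclDot (g z) (w z) ∂halfMeasure n a +
        0 * ∫ z, normSq (w z) ∂halfMeasure n a)) :=
    (Continuous.tendsto (by fun_prop) 0).mono_left nhdsWithin_le_nhds
  have := ge_of_tendsto hlim (by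
    filter_upwards [Ioo_mem_nhdsGT zero_lt_one] with t ht using hquot t ht.1 ht.2.le)
  linarith

/-! ### First variation of the energy and the capacitary measure -/

section Variation

variable [Fact (-1 < a)] {A : Set (EuclideanSpace ℝ (Fin n))} {φ : Pt n → ℝ} {g : Pt n → Pt n}

lemma IsAdmissible.linComb {u : Pt n → ℝ} {v : Pt n → Pt n} (h : IsAdmissible a A u v)
    {ψ : Pt n → ℝ} (hψ : IsTest ψ) {c d : ℝ}
    (hcd : ∀ x ∈ A, ∀ τ : ℝ, 1 ≤ τ → 1 ≤ c * τ + d * ψ (x, 0)) :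
    IsAdmissible a A (fun z => c * u z + d * ψ z) (fun z => c • v z + d • euclGrad ψ z) := by
  refine ⟨h.1.linComb hψ.isSobolev c d, fun x hx => ?_⟩
  obtain ⟨τ, hτ, htrace⟩ := h.2 x hx
  exact ⟨_, hcd x hx τ hτ, htrace.linComb (hψ.hasTraceValue x) h.1.1 hψ.memLp c d⟩

lemma IsInEnergyClosure.sCap_le_energy_linComb (h : IsInEnergyClosure a A φ g)
    {ψ : Pt n → ℝ} (hψ : IsTest ψ) {c d : ℝ}
    (hcd : ∀ x ∈ A, ∀ τ : ℝ, 1 ≤ τ → 1 ≤ c * τ + d * ψ (x, 0)) :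
    sCap a A ≤ energy a (fun z => c • g z + d • euclGrad ψ z) := by
  obtain ⟨_, hg, u, v, hadm, hv, _⟩ := h
  refine sCap_le_energy_of_tendsto (fun j => (hadm j).linComb hψ hcd)
    ((hg.const_smul c).add (hψ.memLp_euclGrad.const_smul d)) ?_
  have hlim := ENNReal.Tendsto.const_mul hv (a := ‖c‖ₑ) (Or.inr enorm_ne_top)
  rw [mul_zero] at hlim
  refine hlim.congr fun j => ?_
  rw [← eLpNorm_const_smul]
  congr 1
  ext1 z
  simp only [Pi.smul_apply, smul_sub, add_sub_add_right_eq_sub]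

lemma IsInEnergyClosure.integral_euclDot_nonneg (h : IsInEnergyClosure a A φ g)
    (hE : energy a g = sCap a A) {ψ : Pt n → ℝ} (hψ : IsTest ψ) (hpos : ∀ x ∈ A, 0 ≤ ψ (x, 0)) :
    0 ≤ ∫ z, euclDot (g z) (euclGrad ψ z) ∂halfMeasure n a := by
  refine integral_euclDot_nonneg_of_forall_energy_le h.2.1 hψ.memLp_euclGrad fun t ht _ => ?_
  rw [hE]
  simpa only [one_smul] using h.sCap_le_energy_linComb hψ (c := 1) (d := t) fun x hx τ hτ => by
    linarith [mul_nonneg ht.le (hpos x hx)]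

lemma IsInEnergyClosure.integral_euclDot_eq (h : IsInEnergyClosure a A φ g)
    (hE : energy a g = sCap a A) {η : Pt n → ℝ} (hη : IsTest η) (hone : ∀ x ∈ A, η (x, 0) = 1) :
    ∫ z, euclDot (g z) (euclGrad η z) ∂halfMeasure n a = ∫ z, normSq (g z) ∂halfMeasure n a := by
  have hg := h.2.1
  have hη' := hη.memLp_euclGrad (a := a)
  -- As `η = 1` on `A`, the perturbation `φ + t (η - φ)` is admissible for `t` of either sign.
  have hvar (σ : ℝ) (hσ : |σ| = 1) :
      0 ≤ ∫ z, euclDot (g z) ((σ • (euclGrad η - g)) z) ∂halfMeasure n a := by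
    refine integral_euclDot_nonneg_of_forall_energy_le hg ((hη'.sub hg).const_smul σ)
      fun t ht ht1 => ?_
    have hσt : t * σ ≤ 1 := (mul_le_of_le_one_right ht.le ((le_abs_self σ).trans_eq hσ)).trans ht1
    rw [hE]
    convert h.sCap_le_energy_linComb hη (c := 1 - t * σ) (d := t * σ) fun x hx τ hτ => by
      rw [hone x hx]; nlinarith [mul_nonneg (sub_nonneg.2 hσt) (sub_nonneg.2 hτ)] using 2
    ext1 z
    simp only [Pi.smul_apply, Pi.sub_apply, smul_sub, sub_smul, one_smul, mul_smul]
    abel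
  have hexpand (σ : ℝ) : ∫ z, euclDot (g z) ((σ • (euclGrad η - g)) z) ∂halfMeasure n a =
      σ * (∫ z, euclDot (g z) (euclGrad η z) ∂halfMeasure n a -
        ∫ z, normSq (g z) ∂halfMeasure n a) := by
    simp_rw [← euclDot_self]
    rw [← integral_sub (integrable_euclDot hg hη') (integrable_euclDot hg hg),
      ← integral_const_mul]
    congr 1 with z
    rw [Pi.smul_apply, Pi.sub_apply, euclDot_smul_right, euclDot_comm, euclDot_sub_left,
      euclDot_comm]
  linarith [hexpand 1 ▸ hvar 1 abs_one, hexpand (-1) ▸ hvar (-1) (by simp)]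

end Variation

section Riesz

open scoped CompactlySupported

variable {X : Type*} [TopologicalSpace X] [CompactSpace X]

/-- The cone of nonnegative functions in `C(X, ℝ)`, in the form required by M. Riesz' extension
theorem. -/
def nonnegCone (X : Type*) [TopologicalSpace X] : PointedCone ℝ C(X, ℝ) where
  carrier := {f | ∀ x, 0 ≤ f x}
  zero_mem' _ := le_rfl
  add_mem' h h' x := add_nonneg (h x) (h' x)
  smul_mem' c _ h x := mul_nonneg c.2 (h x)

lemma exists_nonneg_extension {E : Submodule ℝ C(X, ℝ)} (hone : 1 ∈ E) (L : E →ₗ[ℝ] ℝ)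
    (hL : ∀ f : E, (∀ x, 0 ≤ f.1 x) → 0 ≤ L f) :
    ∃ Λ : C(X, ℝ) →ₗ[ℝ] ℝ, (∀ f : E, Λ f = L f) ∧ ∀ f, (∀ x, 0 ≤ f x) → 0 ≤ Λ f := by
  refine riesz_extension (nonnegCone X) ⟨E, L⟩ hL fun f => ?_
  obtain ⟨C, hC⟩ := (isCompact_range f.continuous).isBounded.exists_norm_le
  refine ⟨⟨C • 1, E.smul_mem C hone⟩, fun x => ?_⟩
  have hCx : -C ≤ f x := (abs_le.1 (hC _ (mem_range_self x))).1
  simpa using neg_le_iff_add_nonneg'.1 hCx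

variable [T2Space X] [MeasurableSpace X] [BorelSpace X]

lemma exists_isFiniteMeasure_integral_eq_of_nonneg (Λ : C(X, ℝ) →ₗ[ℝ] ℝ)
    (hΛ : ∀ f, (∀ x, 0 ≤ f x) → 0 ≤ Λ f) :
    ∃ m : Measure X, IsFiniteMeasure m ∧ ∀ f : C(X, ℝ), ∫ x, f x ∂m = Λ f := by
  let Λc : C_c(X, ℝ) →ₚ[ℝ] ℝ := PositiveLinearMap.mk₀
    { toFun := fun f => Λ f.toContinuousMap
      map_add' := fun f f' => Λ.map_add f.toContinuousMap f'.toContinuousMap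
      map_smul' := fun c f => Λ.map_smul c f.toContinuousMap } fun f hf => hΛ _ hf
  exact ⟨RealRMK.rieszMeasure Λc, inferInstance, fun f =>
    RealRMK.integral_rieszMeasure Λc ⟨f, HasCompactSupport.of_compactSpace _⟩⟩

lemma exists_isFiniteMeasure_integral_comp_eq {V : Type*} [AddCommGroup V] [Module ℝ V]
    (T : V →ₗ[ℝ] C(X, ℝ)) (hone : 1 ∈ LinearMap.range T) (L : V →ₗ[ℝ] ℝ)
    (hL : ∀ v, (∀ x, 0 ≤ T v x) → 0 ≤ L v) :
    ∃ m : Measure X, IsFiniteMeasure m ∧ ∀ v, ∫ x, T v x ∂m = L v := by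
  have hker : LinearMap.ker T ≤ LinearMap.ker L := fun v hv => by
    rw [LinearMap.mem_ker] at hv ⊢
    refine le_antisymm ?_ (hL v fun x => by simp [hv])
    simpa using hL (-v) fun x => by simp [hv]
  let Lrange : LinearMap.range T →ₗ[ℝ] ℝ :=
    (LinearMap.ker T).liftQ L hker ∘ₗ T.quotKerEquivRange.symm.toLinearMap
  have hLrange (v : V) : Lrange ⟨T v, LinearMap.mem_range_self T v⟩ = L v := by
    simp only [Lrange, LinearMap.comp_apply, LinearEquiv.coe_coe,
      T.quotKerEquivRange_symm_apply_image v, Submodule.mkQ_apply, Submodule.liftQ_apply]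
  obtain ⟨Λ, hext, hpos⟩ := exists_nonneg_extension hone Lrange (by
    rintro ⟨_, v, rfl⟩ hv
    exact (hL v hv).trans_eq (hLrange v).symm)
  obtain ⟨m, hm, hint⟩ := exists_isFiniteMeasure_integral_eq_of_nonneg Λ hpos
  exact ⟨m, hm, fun v => ((hint (T v)).trans (hext ⟨T v, _⟩)).trans (hLrange v)⟩

end Riesz

lemma exists_isTest_eq_one (r : ℝ) : ∃ η : Pt n → ℝ, IsTest η ∧ ∀ z, ‖z‖ ≤ r → η z = 1 := by
  let η : ContDiffBump (0 : Pt n) := ⟨max r 1, max r 1 + 1, by positivity, by linarith⟩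
  refine ⟨η, ⟨η.contDiff, η.hasCompactSupport⟩, fun z hz => η.one_of_mem_closedBall ?_⟩
  simpa [η] using Or.inl hz

/-- The space of test functions. -/
def testSubmodule (n : ℕ) : Submodule ℝ (Pt n → ℝ) where
  carrier := {ψ | IsTest ψ}
  zero_mem' := ⟨contDiff_const, HasCompactSupport.zero⟩
  add_mem' h h' := h.add h'
  smul_mem' c _ h := h.const_mul c

/-- Restriction of test functions to a set `K` in the boundary `{y = 0}`. -/
def testRestrict (K : Set (EuclideanSpace ℝ (Fin n))) : testSubmodule n →ₗ[ℝ] C(K, ℝ) where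
  toFun ψ := ⟨fun x => ψ.1 (x, 0), ψ.2.continuous.comp (by fun_prop)⟩
  map_add' _ _ := rfl
  map_smul' _ _ := rfl

lemma exists_isTest_eq_one_on {K : Set (EuclideanSpace ℝ (Fin n))}
    (hK : IsCompact K) : ∃ η : Pt n → ℝ, IsTest η ∧ ∀ x ∈ K, η (x, 0) = 1 := by
  obtain ⟨r, hr⟩ := hK.isBounded.exists_norm_le
  obtain ⟨η, hη, hone⟩ := exists_isTest_eq_one (n := n) r
  exact ⟨η, hη, fun x hx => hone _ (by simpa using hr x hx)⟩

/-- The first variation of the energy at a function with gradient `g` (up to a factor `2`), as a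
functional on test functions. -/
def firstVariation [Fact (-1 < a)] {g : Pt n → Pt n} (hg : MemLp g 2 (halfMeasure n a)) :
    testSubmodule n →ₗ[ℝ] ℝ where
  toFun ψ := ∫ z, euclDot (g z) (euclGrad ψ.1 z) ∂halfMeasure n a
  map_add' ψ χ := by
    rw [← integral_add (integrable_euclDot hg ψ.2.memLp_euclGrad)
      (integrable_euclDot hg χ.2.memLp_euclGrad)]
    congr 1 with z
    have hadd : euclGrad (ψ + χ).1 z = _ :=
      euclGrad_add (ψ.2.differentiableAt z) (χ.2.differentiableAt z)
    rw [hadd, euclDot_comm, euclDot_add_left, euclDot_comm, euclDot_comm (euclGrad χ.1 z)]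
  map_smul' c ψ := by
    rw [RingHom.id_apply, smul_eq_mul, ← integral_const_mul]
    congr 1 with z
    have hsmul : euclGrad (c • ψ).1 z = _ := euclGrad_const_mul (ψ.2.differentiableAt z) c
    rw [hsmul, euclDot_smul_right]

/-- The field `g` has `-div(y^a g) = 0` in `{y > 0}` and boundary flux `m` through `{y = 0}`, in the
weak sense. For the gradient of a capacitary potential, `m` is the capacitary measure. -/
def IsBoundaryFlux (a : ℝ) (g : Pt n → Pt n) (m : Measure (EuclideanSpace ℝ (Fin n))) : Prop :=
  ∀ ψ, IsTest ψ → ∫ x, ψ (x, 0) ∂m = ∫ z, euclDot (g z) (euclGrad ψ z) ∂halfMeasure n a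

lemma IsInEnergyClosure.exists_isBoundaryFlux [Fact (-1 < a)]
    {A K : Set (EuclideanSpace ℝ (Fin n))} {φ : Pt n → ℝ} {g : Pt n → Pt n}
    (h : IsInEnergyClosure a A φ g) (hE : energy a g = sCap a A) (hK : IsCompact K)
    (hAK : A ⊆ K) : ∃ m : Measure (EuclideanSpace ℝ (Fin n)), IsFiniteMeasure m ∧
      IsBoundaryFlux a g m ∧ m univ = sCap a A ∧ ∀ᵐ x ∂m, x ∈ K := by
  have : CompactSpace K := isCompact_iff_compactSpace.1 hK
  obtain ⟨η, hη, hone⟩ := exists_isTest_eq_one_on hK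
  obtain ⟨m, hm, hrep⟩ := exists_isFiniteMeasure_integral_comp_eq (testRestrict K)
    ⟨⟨η, hη⟩, ContinuousMap.ext fun x => hone x x.2⟩ (firstVariation h.2.1) fun ψ hψ =>
      h.integral_euclDot_nonneg hE ψ.2 fun x hx => hψ ⟨x, hAK hx⟩
  have hK' : MeasurableEmbedding ((↑) : K → EuclideanSpace ℝ (Fin n)) :=
    .subtype_coe hK.measurableSet
  refine ⟨m.map (↑), inferInstance, fun ψ hψ => (hK'.integral_map _).trans (hrep ⟨ψ, hψ⟩), ?_,
    (hK'.ae_map_iff).2 (ae_of_all _ fun x => x.2)⟩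
  have hmass : ∫ x : K, η (x, 0) ∂m = ∫ z, normSq (g z) ∂halfMeasure n a :=
    (hrep ⟨η, hη⟩).trans (h.integral_euclDot_eq hE hη fun x hx => hone x (hAK hx))
  rw [← hE, energy_eq_ofReal h.2.1, ← hmass, hK'.map_apply]
  simp [fun x : K => hone x x.2, Measure.real]

/-! ### Gaussian averages of a potential -/

/-- A sequence of smooth cutoff functions: uniformly bounded by `1`, eventually equal to `1` at
every point, and with gradients tending to zero uniformly. -/
structure IsCutoffSeq (χ : ℕ → Pt n → ℝ) : Prop where
  isTest : ∀ k, IsTest (χ k)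
  norm_le_one : ∀ k z, ‖χ k z‖ ≤ 1
  eventually_eq_one : ∀ z, ∀ᶠ k in atTop, χ k z = 1
  exists_norm_fderiv_le : ∃ C : ℕ → ℝ, Tendsto C atTop (𝓝 0) ∧ ∀ k z, ‖fderiv ℝ (χ k) z‖ ≤ C k

lemma exists_isCutoffSeq (n : ℕ) : ∃ χ : ℕ → Pt n → ℝ, IsCutoffSeq χ := by
  let η : ContDiffBump (0 : Pt n) := ⟨1, 2, one_pos, one_lt_two⟩
  have hη : IsTest η := ⟨η.contDiff, η.hasCompactSupport⟩
  obtain ⟨C, hC⟩ := (hη.1.continuous_fderiv (by simp)).bounded_above_of_compact_support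
    (hη.2.fderiv (𝕜 := ℝ))
  let c (k : ℕ) : ℝ := 1 / ((k : ℝ) + 1)
  have hc (k : ℕ) : 0 < c k := by positivity
  have hlim : Tendsto c atTop (𝓝 0) := tendsto_one_div_add_atTop_nhds_zero_nat
  refine ⟨fun k z => η (c k • z), fun k => ⟨hη.1.comp (contDiff_const_smul _),
    hη.2.comp_smul (hc k).ne'⟩, fun k z => ?_, fun z => ?_, fun k => c k * C, ?_, fun k z => ?_⟩
  · rw [Real.norm_of_nonneg η.nonneg]
    exact η.le_one
  · have hz : Tendsto (fun k => ‖c k • z‖) atTop (𝓝 0) := by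
      simpa using (hlim.smul_const z).norm
    filter_upwards [hz.eventually_le_const zero_lt_one] with k hk
    exact η.one_of_mem_closedBall (mem_closedBall_zero_iff.2 hk)
  · simpa using hlim.mul_const C
  · rw [fderiv_comp_smul, norm_smul, Real.norm_of_nonneg (hc k).le]
    exact mul_le_mul_of_nonneg_left (hC _) (hc k).le

lemma IsCutoffSeq.tendsto_integral_mul {X : Type*} [MeasurableSpace X] {μ : Measure X}
    {χ : ℕ → Pt n → ℝ} (hχ : IsCutoffSeq χ) {p : X → Pt n} (hp : AEMeasurable p μ) {f : X → ℝ}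
    (hf : Integrable f μ) :
    Tendsto (fun k => ∫ x, χ k (p x) * f x ∂μ) atTop (𝓝 (∫ x, f x ∂μ)) := by
  refine tendsto_integral_of_dominated_convergence (fun x => ‖f x‖) (fun k => ?_) hf.norm
    (fun k => ae_of_all _ fun x => ?_) (ae_of_all _ fun x => ?_)
  · exact ((hχ.isTest k).continuous.measurable.comp_aemeasurable hp).aestronglyMeasurable.mul hf.1
  · rw [norm_mul]
    exact mul_le_of_le_one_left (norm_nonneg _) (hχ.norm_le_one k _)
  · refine tendsto_const_nhds.congr' ?_
    filter_upwards [hχ.eventually_eq_one (p x)] with k hk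
    rw [hk, one_mul]

lemma IsCutoffSeq.tendsto_integral_mul_fderiv {μ : Measure (Pt n)} {χ : ℕ → Pt n → ℝ}
    (hχ : IsCutoffSeq χ) {f : Pt n → ℝ} {g : Pt n → Pt n}
    (hfg : Integrable (fun z => ‖f z‖ * ‖g z‖) μ) :
    Tendsto (fun k => ∫ z, f z * fderiv ℝ (χ k) z (g z) ∂μ) atTop (𝓝 0) := by
  obtain ⟨C, hlim, hC⟩ := hχ.exists_norm_fderiv_le
  refine squeeze_zero_norm (fun k => ?_)
    (by simpa using hlim.mul_const (∫ z, ‖f z‖ * ‖g z‖ ∂μ))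
  rw [← integral_const_mul]
  refine norm_integral_le_of_norm_le (hfg.const_mul _) (ae_of_all _ fun z => ?_)
  rw [norm_mul, mul_left_comm]
  exact mul_le_mul_of_nonneg_left (ContinuousLinearMap.le_of_opNorm_le _ (hC k z) _)
    (norm_nonneg _)

lemma IsBoundaryFlux.integral_eq {g : Pt n → Pt n} {m : Measure (EuclideanSpace ℝ (Fin n))}
    (hm : IsBoundaryFlux a g m) {f : Pt n → ℝ} (hf : ContDiff ℝ ((⊤ : ℕ∞) : WithTop ℕ∞) f)
    (hfm : Integrable (fun x => f (x, 0)) m)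
    (hfg : Integrable (fun z => ‖f z‖ * ‖g z‖) (halfMeasure n a))
    (hfg' : Integrable (fun z => fderiv ℝ f z (g z)) (halfMeasure n a))
    (hg : AEStronglyMeasurable g (halfMeasure n a)) :
    ∫ x, f (x, 0) ∂m = ∫ z, fderiv ℝ f z (g z) ∂halfMeasure n a := by
  obtain ⟨χ, hχ⟩ := exists_isCutoffSeq n
  have htest (k : ℕ) : IsTest fun z => f z * χ k z := (hχ.isTest k).mul_left hf
  have hint₁ (k : ℕ) : Integrable (fun z => χ k z * fderiv ℝ f z (g z)) (halfMeasure n a) :=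
    hfg'.bdd_mul (hχ.isTest k).continuous.aestronglyMeasurable
      (ae_of_all _ fun z => hχ.norm_le_one k z)
  have hint₂ (k : ℕ) : Integrable (fun z => f z * fderiv ℝ (χ k) z (g z)) (halfMeasure n a) := by
    obtain ⟨C, -, hC⟩ := hχ.exists_norm_fderiv_le
    refine (hfg.const_mul (C k)).mono' (hf.continuous.aestronglyMeasurable.mul ?_)
      (ae_of_all _ fun z => ?_)
    · exact isBoundedBilinearMap_apply.continuous.comp_aestronglyMeasurable₂
        ((hχ.isTest k).1.continuous_fderiv (by simp)).aestronglyMeasurable hg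
    · rw [norm_mul, mul_left_comm]
      exact mul_le_mul_of_nonneg_left (ContinuousLinearMap.le_of_opNorm_le _ (hC k z) _)
        (norm_nonneg _)
  have hprod (k : ℕ) : ∫ z, χ k z * fderiv ℝ f z (g z) ∂halfMeasure n a +
      ∫ z, f z * fderiv ℝ (χ k) z (g z) ∂halfMeasure n a = ∫ x, χ k (x, 0) * f (x, 0) ∂m := by
    rw [← integral_add (hint₁ k) (hint₂ k)]
    simp_rw [mul_comm (χ k (_, 0))]
    refine (integral_congr_ae (ae_of_all _ fun z => ?_)).trans (hm _ (htest k)).symm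
    rw [euclDot_comm, euclDot_euclGrad ((htest k).differentiableAt z),
      fderiv_fun_mul (hf.contDiffAt.differentiableAt (by simp)) ((hχ.isTest k).differentiableAt z)]
    simp [add_comm]
  have hlim := (hχ.tendsto_integral_mul aemeasurable_id hfg').add
    (hχ.tendsto_integral_mul_fderiv hfg)
  rw [add_zero] at hlim
  exact tendsto_nhds_unique
    (hχ.tendsto_integral_mul (p := fun x => (x, 0)) (by fun_prop) hfm) (hlim.congr hprod)

lemma integrable_gauss_mk_zero (m : Measure (EuclideanSpace ℝ (Fin n))) [IsFiniteMeasure m] {t : ℝ}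
    (ht : 0 ≤ t) (x : EuclideanSpace ℝ (Fin n)) : Integrable (fun x' => gauss t x (x', 0)) m :=
  .of_bound (Continuous.aestronglyMeasurable (by fun_prop)) 1 <| ae_of_all _ fun x' => by
    rw [Real.norm_of_nonneg (gauss_pos _ _ _).le]
    exact gauss_le_one ht _ _

lemma IsBoundaryFlux.integral_gauss [Fact (-1 < a)] {g : Pt n → Pt n}
    {m : Measure (EuclideanSpace ℝ (Fin n))} [IsFiniteMeasure m] (hm : IsBoundaryFlux a g m)
    (hg : MemLp g 2 (halfMeasure n a)) {t : ℝ} (ht : 0 < t) (x : EuclideanSpace ℝ (Fin n)) :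
    ∫ x', gauss t x (x', 0) ∂m =
      -(2 * t) * ∫ z, gauss t x z * euclDot (g z) (z - (x, 0)) ∂halfMeasure n a := by
  have hfderiv (z : Pt n) : fderiv ℝ (gauss t x) z (g z) =
      -(2 * t) * (gauss t x z * euclDot (g z) (z - (x, 0))) := by
    rw [fderiv_gauss, euclDot_comm, mul_assoc]
  have hgauss : MemLp (gauss t x) 2 (halfMeasure n a) :=
    (isGaussDominated_gauss ht x).memLp_two (Continuous.aestronglyMeasurable (by fun_prop))
  have hint : Integrable (fun z => gauss t x z * euclDot (g z) (z - (x, 0))) (halfMeasure n a) := by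
    simpa only [euclDot_smul_right] using integrable_euclDot hg (memLp_gauss_smul_sub ht x)
  rw [hm.integral_eq (contDiff_gauss t x) (integrable_gauss_mk_zero m ht.le x)
    (hgauss.norm.integrable_mul hg.norm) (by simpa only [hfderiv] using hint.const_mul _) hg.1]
  simp_rw [hfderiv, integral_const_mul]

lemma aestronglyMeasurable_of_hardyWeight_mul {φ : Pt n → ℝ}
    (hφ : MemLp (fun z => hardyWeight z * φ z) 2 (halfMeasure n a)) :
    AEStronglyMeasurable φ (halfMeasure n a) := by
  refine (continuous_inv_hardyWeight.aestronglyMeasurable.mul hφ.1).congr (ae_of_all _ fun z => ?_)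
  exact inv_mul_cancel_left₀ (hardyWeight_pos z).ne' _

section GaussianAverages

variable [Fact (-1 < a)] {φ : Pt n → ℝ}

lemma integrable_mul_gauss (hφ : MemLp (fun z => hardyWeight z * φ z) 2 (halfMeasure n a)) {t : ℝ}
    (ht : 0 < t) (x : EuclideanSpace ℝ (Fin n)) :
    Integrable (fun z => φ z * gauss t x z) (halfMeasure n a) :=
  (isGaussDominated_gauss ht x).integrable_mul (by fun_prop) hφ

lemma integrable_mul_gauss_mul_normSq
    (hφ : MemLp (fun z => hardyWeight z * φ z) 2 (halfMeasure n a)) {t : ℝ} (ht : 0 < t)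
    (x : EuclideanSpace ℝ (Fin n)) :
    Integrable (fun z => φ z * (gauss t x z * normSq (z - (x, 0)))) (halfMeasure n a) := by
  simpa only [one_mul, sub_zero] using (isGaussDominated_gauss_mul_normSq ht x 1 0).integrable_mul
    (Continuous.aestronglyMeasurable (by fun_prop)) hφ

lemma hasDerivAt_integral_mul_gauss
    (hφ : MemLp (fun z => hardyWeight z * φ z) 2 (halfMeasure n a)) {t : ℝ} (ht : 0 < t)
    (x : EuclideanSpace ℝ (Fin n)) :
    HasDerivAt (fun t => ∫ z, φ z * gauss t x z ∂halfMeasure n a)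
      (-∫ z, φ z * (gauss t x z * normSq (z - (x, 0))) ∂halfMeasure n a) t := by
  have hφm := aestronglyMeasurable_of_hardyWeight_mul hφ
  rw [← integral_neg]
  refine (hasDerivAt_integral_of_dominated_loc_of_deriv_le (s := Ioi (t / 2))
    (F := fun t z => φ z * gauss t x z)
    (F' := fun t z => -(φ z * (gauss t x z * normSq (z - (x, 0)))))
    (bound := fun z => ‖φ z * (gauss (t / 2) x z * normSq (z - (x, 0)))‖)
    (Ioi_mem_nhds (half_lt_self ht))
    (Eventually.of_forall fun s => hφm.mul (continuous_gauss s x).aestronglyMeasurable)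
    (integrable_mul_gauss hφ ht x) (integrable_mul_gauss_mul_normSq hφ ht x).1.neg
    (ae_of_all _ fun z s hs => ?_) (integrable_mul_gauss_mul_normSq hφ (half_pos ht) x).norm
    (ae_of_all _ fun z s _ => ?_)).2
  · rw [norm_neg, norm_mul, norm_mul, norm_mul, norm_mul, Real.norm_of_nonneg (gauss_pos _ _ _).le,
      Real.norm_of_nonneg (gauss_pos _ _ _).le]
    gcongr
    exact gauss_anti (le_of_lt hs) x z
  · have hexp := (((hasDerivAt_neg s).mul_const (normSq (z - (x, 0)))).exp).const_mul (φ z)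
    exact hexp.congr_deriv (by rw [gauss]; ring)

lemma hasDerivAt_rpow_mul_integral_gauss
    (hφ : MemLp (fun z => hardyWeight z * φ z) 2 (halfMeasure n a)) {t : ℝ} (ht : 0 < t)
    (x : EuclideanSpace ℝ (Fin n)) :
    HasDerivAt (fun t => t ^ halfDim n a * ∫ z, φ z * gauss t x z ∂halfMeasure n a)
      (-(1 / 2) * t ^ (halfDim n a - 1) * ∫ z, φ z * (gauss t x z *
        (2 * t * normSq (z - (x, 0)) - 2 * halfDim n a)) ∂halfMeasure n a) t := by
  refine ((Real.hasDerivAt_rpow_const (p := halfDim n a) (Or.inl ht.ne')).mul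
    (hasDerivAt_integral_mul_gauss hφ ht x)).congr_deriv ?_
  have hsplit (z : Pt n) :
      φ z * (gauss t x z * (2 * t * normSq (z - (x, 0)) - 2 * halfDim n a)) =
        2 * t * (φ z * (gauss t x z * normSq (z - (x, 0)))) -
          2 * halfDim n a * (φ z * gauss t x z) := by ring
  have hpow : t ^ halfDim n a = t ^ (halfDim n a - 1) * t := by
    rw [Real.rpow_sub_one ht.ne', div_mul_cancel₀ _ ht.ne']
  simp_rw [hsplit]
  rw [integral_sub ((integrable_mul_gauss_mul_normSq hφ ht x).const_mul _)
    ((integrable_mul_gauss hφ ht x).const_mul _), integral_const_mul, integral_const_mul, hpow]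
  ring

end GaussianAverages

lemma inv_hardyWeight_mul_gauss_sq_le {t : ℝ} (ht : 0 < t) (ht1 : t ≤ 1)
    (x : EuclideanSpace ℝ (Fin n)) (z : Pt n) :
    ((hardyWeight z)⁻¹ * gauss t x z) ^ 2 ≤ (2 + 2 * ‖x‖ ^ 2) * (2 / t) * gauss t x z := by
  have htri := one_add_normSq_le x z
  have hg := gauss_pos t x z
  have hexp : t * normSq (z - (x, 0)) * gauss t x z ≤ 1 := by
    rw [gauss, neg_mul, Real.exp_neg, mul_inv_le_iff₀ (Real.exp_pos _), one_mul]
    linarith [Real.add_one_le_exp (t * normSq (z - (x, 0)))]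
  have hmoment : (1 + normSq (z - (x, 0))) * gauss t x z ≤ 2 / t := by
    rw [le_div_iff₀ ht]
    nlinarith [gauss_le_one ht.le x z]
  calc ((hardyWeight z)⁻¹ * gauss t x z) ^ 2
      = (1 + normSq z) * gauss t x z ^ 2 := by rw [mul_pow, inv_pow, hardyWeight_sq, inv_inv]
    _ ≤ ((2 + 2 * ‖x‖ ^ 2) * (1 + normSq (z - (x, 0)))) * gauss t x z ^ 2 := by gcongr
    _ = (2 + 2 * ‖x‖ ^ 2) * ((1 + normSq (z - (x, 0))) * gauss t x z) * gauss t x z := by ring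
    _ ≤ _ := by gcongr

lemma integral_inv_hardyWeight_mul_gauss_sq_le [Fact (-1 < a)] {t : ℝ} (ht : 0 < t) (ht1 : t ≤ 1)
    (x : EuclideanSpace ℝ (Fin n)) :
    ∫ z, ((hardyWeight z)⁻¹ * gauss t x z) ^ 2 ∂halfMeasure n a ≤
      (2 + 2 * ‖x‖ ^ 2) * (2 / t) * (gaussMass n a * t ^ (-halfDim n a)) := by
  rw [← integral_gauss ht x, ← integral_const_mul]
  exact integral_mono_of_nonneg (ae_of_all _ fun z => sq_nonneg _)
    ((integrable_gauss ht x).const_mul _)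
    (ae_of_all _ fun z => inv_hardyWeight_mul_gauss_sq_le ht ht1 x z)

lemma sq_integral_mul_le {X : Type*} [MeasurableSpace X] {μ : Measure X} {f g : X → ℝ}
    (hf : MemLp f 2 μ) (hg : MemLp g 2 μ) :
    (∫ x, f x * g x ∂μ) ^ 2 ≤ (∫ x, f x ^ 2 ∂μ) * ∫ x, g x ^ 2 ∂μ := by
  have hholder := integral_mul_norm_le_Lp_mul_Lq Real.HolderConjugate.two_two
    (f := f) (g := g) (by simpa using hf) (by simpa using hg)
  simp only [Real.rpow_two, ← Real.sqrt_eq_rpow, Real.norm_eq_abs, sq_abs] at hholder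
  rw [← Real.sqrt_mul (integral_nonneg fun _ => sq_nonneg _)] at hholder
  calc (∫ x, f x * g x ∂μ) ^ 2 = |∫ x, f x * g x ∂μ| ^ 2 := (sq_abs _).symm
    _ ≤ √((∫ x, f x ^ 2 ∂μ) * ∫ x, g x ^ 2 ∂μ) ^ 2 := by
        gcongr
        refine (abs_integral_le_integral_abs).trans ?_
        simpa only [abs_mul] using hholder
    _ = _ := Real.sq_sqrt (mul_nonneg (integral_nonneg fun _ => sq_nonneg _)
        (integral_nonneg fun _ => sq_nonneg _))

lemma tendsto_rpow_mul_integral_gauss_zero [Fact (-1 < a)] (hb : 1 < halfDim n a) {φ : Pt n → ℝ}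
    (hφ : MemLp (fun z => hardyWeight z * φ z) 2 (halfMeasure n a))
    (x : EuclideanSpace ℝ (Fin n)) :
    Tendsto (fun t : ℝ => t ^ halfDim n a * ∫ z, φ z * gauss t x z ∂halfMeasure n a)
      (𝓝[>] 0) (𝓝 0) := by
  set β := halfDim n a
  set B := (∫ z, (hardyWeight z * φ z) ^ 2 ∂halfMeasure n a) *
    ((2 + 2 * ‖x‖ ^ 2) * 2 * gaussMass n a)
  have hlim : Tendsto (fun t : ℝ => √(B * t ^ (β - 1))) (𝓝[>] 0) (𝓝 0) := by
    have hcont : Continuous fun t : ℝ => √(B * t ^ (β - 1)) :=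
      Real.continuous_sqrt.comp ((Real.continuous_rpow_const (by linarith)).const_mul B)
    simpa [Real.zero_rpow (by linarith : β - 1 ≠ 0)] using
      (hcont.tendsto 0).mono_left nhdsWithin_le_nhds
  refine squeeze_zero_norm' ?_ hlim
  filter_upwards [Ioo_mem_nhdsGT zero_lt_one] with t ⟨ht, ht1⟩
  refine Real.abs_le_sqrt ?_
  have hcs := sq_integral_mul_le hφ ((isGaussDominated_gauss ht x).memLp_inv_hardyWeight_mul
    (Continuous.aestronglyMeasurable (by fun_prop)))
  simp only [hardyWeight_mul_mul_inv_mul] at hcs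
  have hpow : (t ^ β) ^ 2 * (t⁻¹ * t ^ (-β)) = t ^ (β - 1) := by
    rw [← Real.rpow_mul_natCast ht.le, ← Real.rpow_neg_one, ← Real.rpow_add ht, ← Real.rpow_add ht]
    push_cast
    ring_nf
  calc (t ^ β * ∫ z, φ z * gauss t x z ∂halfMeasure n a) ^ 2
      = (t ^ β) ^ 2 * (∫ z, φ z * gauss t x z ∂halfMeasure n a) ^ 2 := mul_pow _ _ _
    _ ≤ (t ^ β) ^ 2 * ((∫ z, (hardyWeight z * φ z) ^ 2 ∂halfMeasure n a) *
          ((2 + 2 * ‖x‖ ^ 2) * (2 / t) * (gaussMass n a * t ^ (-β)))) := by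
        gcongr
        refine hcs.trans (mul_le_mul_of_nonneg_left
          (integral_inv_hardyWeight_mul_gauss_sq_le ht ht1.le x) ?_)
        exact integral_nonneg fun _ => sq_nonneg _
    _ = B * ((t ^ β) ^ 2 * (t⁻¹ * t ^ (-β))) := by ring
    _ = B * t ^ (β - 1) := by rw [hpow]

lemma intervalIntegrable_rpow_mul_integral_gauss (hb : 1 < halfDim n a)
    (m : Measure (EuclideanSpace ℝ (Fin n))) [IsFiniteMeasure m] {t : ℝ} (ht : 0 < t)
    (x : EuclideanSpace ℝ (Fin n)) :
    IntervalIntegrable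
      (fun s : ℝ => 1 / 4 * s ^ (halfDim n a - 2) * ∫ x', gauss s x (x', 0) ∂m) volume 0 t := by
  have hpow : IntervalIntegrable (fun s : ℝ => 1 / 4 * s ^ (halfDim n a - 2)) volume 0 t :=
    (intervalIntegral.intervalIntegrable_rpow' (by linarith)).const_mul _
  have hmeas : StronglyMeasurable fun s : ℝ => ∫ x', gauss s x (x', 0) ∂m := by
    refine StronglyMeasurable.integral_prod_right
      (f := fun (s : ℝ) (x' : EuclideanSpace ℝ (Fin n)) => gauss s x (x', 0))
      (Continuous.stronglyMeasurable ?_)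
    unfold gauss Function.uncurry
    fun_prop
  rw [intervalIntegrable_iff_integrableOn_Ioc_of_le ht.le] at hpow ⊢
  refine hpow.mul_bdd (c := m.real univ) hmeas.aestronglyMeasurable
    ((ae_restrict_iff' measurableSet_Ioc).2 (ae_of_all _ fun s hs => ?_))
  refine (norm_integral_le_of_norm_le_const (C := 1) (ae_of_all _ fun x' => ?_)).trans (by simp)
  rw [Real.norm_of_nonneg (gauss_pos _ _ _).le]
  exact gauss_le_one hs.1.le _ _

/-- With `β = halfDim n a`, the quantity `t^β ∫ φ(z) exp(-t |z - (x, 0)|²) y^a dz` for the potential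
`φ` of the measure `m`, as an integral over `m`. -/
def gaussProfile (a : ℝ) (m : Measure (EuclideanSpace ℝ (Fin n))) (t : ℝ)
    (x : EuclideanSpace ℝ (Fin n)) : ℝ :=
  ∫ s in 0..t, 1 / 4 * s ^ (halfDim n a - 2) * ∫ x', gauss s x (x', 0) ∂m

lemma IsTestLimit.rpow_mul_integral_gauss [Fact (-1 < a)] (hb : 1 < halfDim n a)
    {m : Measure (EuclideanSpace ℝ (Fin n))} [IsFiniteMeasure m] {φ : Pt n → ℝ} {g : Pt n → Pt n}
    (h : IsTestLimit a φ g) (hm : IsBoundaryFlux a g m) {t : ℝ} (ht : 0 < t)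
    (x : EuclideanSpace ℝ (Fin n)) :
    t ^ halfDim n a * ∫ z, φ z * gauss t x z ∂halfMeasure n a = gaussProfile a m t x := by
  have hφ := h.memLp_hardyWeight_mul hb
  have hderiv (s : ℝ) (hs : 0 < s) : HasDerivAt
      (fun t => t ^ halfDim n a * ∫ z, φ z * gauss t x z ∂halfMeasure n a)
      (1 / 4 * s ^ (halfDim n a - 2) * ∫ x', gauss s x (x', 0) ∂m) s := by
    refine (hasDerivAt_rpow_mul_integral_gauss hφ hs x).congr_deriv ?_
    have hpow : s ^ (halfDim n a - 1) = s ^ (halfDim n a - 2) * s := by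
      rw [← Real.rpow_add_one hs.ne']
      ring_nf
    rw [hm.integral_gauss h.2.1 hs x, h.integral_gauss_mul_euclDot hb hs x, hpow]
    ring
  rw [gaussProfile, intervalIntegral.integral_eq_sub_of_hasDerivAt_of_tendsto ht
    (fun s hs => hderiv s hs.1) (intervalIntegrable_rpow_mul_integral_gauss hb m ht x)
    (tendsto_rpow_mul_integral_gauss_zero hb hφ x)
    ((hderiv t ht).continuousAt.tendsto.mono_left nhdsWithin_le_nhds), sub_zero]

/-! ### Potentials of boundary measures -/

/-- The solution of `-div(y^a ∇u) = 0` in `{y > 0}` with unit flux through the origin. Its constant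
is the one coming out of its representation as a superposition of Gaussians. -/
def fundKernel (n : ℕ) (a : ℝ) (z : Pt n) : ℝ :=
  Real.Gamma (halfDim n a - 1) / (4 * gaussMass n a) * normSq z ^ (-(halfDim n a - 1))

lemma gamma_div_gaussMass_pos [Fact (-1 < a)] (hb : 1 < halfDim n a) :
    0 < Real.Gamma (halfDim n a - 1) / (4 * gaussMass n a) := by
  have := gaussMass_pos (n := n) (a := a)
  have := Real.Gamma_pos_of_pos (s := halfDim n a - 1) (by linarith)
  positivity

lemma fundKernel_nonneg [Fact (-1 < a)] (hb : 1 < halfDim n a) (z : Pt n) :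
    0 ≤ fundKernel n a z :=
  mul_nonneg (gamma_div_gaussMass_pos hb).le (Real.rpow_nonneg (normSq_nonneg z) _)

lemma measurable_fundKernel (n : ℕ) (a : ℝ) : Measurable (fundKernel n a) := by
  unfold fundKernel
  fun_prop

lemma measurable_fundKernel_sub (n : ℕ) (a : ℝ) :
    Measurable fun p : Pt n × EuclideanSpace ℝ (Fin n) => fundKernel n a (p.1 - (p.2, 0)) :=
  (measurable_fundKernel n a).comp (by fun_prop)

@[fun_prop]
lemma measurable_gauss_comp {X : Type*} [MeasurableSpace X] {f : X → ℝ} {g : X → Pt n}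
    (hf : Measurable f) (hg : Measurable g) (x : EuclideanSpace ℝ (Fin n)) :
    Measurable fun p => gauss (f p) x (g p) := by
  unfold gauss
  exact (hf.neg.mul (continuous_normSq.measurable.comp (hg.sub_const _))).exp

lemma lintegral_rpow_mul_exp {b r : ℝ} (hb : 0 < b) (hr : 0 < r) :
    ∫⁻ s in Ioi (0 : ℝ), ENNReal.ofReal (s ^ (b - 1) * Real.exp (-s * r)) =
      ENNReal.ofReal (Real.Gamma b * r ^ (-b)) := by
  have hint : IntegrableOn (fun s : ℝ => s ^ (b - 1) * Real.exp (-s * r)) (Ioi 0) := by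
    simpa only [Real.rpow_one, neg_mul, mul_comm r] using
      integrableOn_rpow_mul_exp_neg_mul_rpow (p := 1) (s := b - 1) (by linarith) one_pos hr
  have hgamma := Real.integral_rpow_mul_exp_neg_mul_Ioi hb hr
  rw [one_div, Real.inv_rpow hr.le, ← Real.rpow_neg hr.le, mul_comm] at hgamma
  rw [← ofReal_integral_eq_lintegral_ofReal hint, ← hgamma]
  · simp only [neg_mul, mul_comm r]
  · exact (ae_restrict_mem measurableSet_Ioi).mono fun s hs =>
      mul_nonneg (Real.rpow_nonneg (le_of_lt hs) _) (Real.exp_pos _).le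

lemma ofReal_fundKernel_sub [Fact (-1 < a)] (hb : 1 < halfDim n a) {z : Pt n} (hz : 0 < z.2)
    (x : EuclideanSpace ℝ (Fin n)) :
    ENNReal.ofReal (fundKernel n a (z - (x, 0))) =
      ∫⁻ s in Ioi (0 : ℝ), ENNReal.ofReal ((4 * gaussMass n a)⁻¹ * s ^ (halfDim n a - 2)) *
        ENNReal.ofReal (gauss s x z) := by
  have hr : 0 < normSq (z - (x, 0)) := by rw [normSq_sub_mk]; positivity
  have hmass := gaussMass_pos (n := n) (a := a)
  have hsplit (s : ℝ) (hs : s ∈ Ioi (0 : ℝ)) :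
      ENNReal.ofReal ((4 * gaussMass n a)⁻¹ * s ^ (halfDim n a - 2)) *
          ENNReal.ofReal (gauss s x z) =
        ENNReal.ofReal (4 * gaussMass n a)⁻¹ *
          ENNReal.ofReal (s ^ (halfDim n a - 1 - 1) * Real.exp (-s * normSq (z - (x, 0)))) := by
    have hpow : 0 ≤ s ^ (halfDim n a - 2) := Real.rpow_nonneg (le_of_lt hs) _
    rw [← ENNReal.ofReal_mul (by positivity), ← ENNReal.ofReal_mul (by positivity), gauss,
      mul_assoc, sub_sub, one_add_one_eq_two]
  rw [setLIntegral_congr_fun measurableSet_Ioi hsplit, lintegral_const_mul _ (by fun_prop),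
    lintegral_rpow_mul_exp (by linarith) hr, ← ENNReal.ofReal_mul (by positivity), fundKernel,
    ← mul_assoc, inv_mul_eq_div]

lemma add_mul_norm_sq_sub {E : Type*} [NormedAddCommGroup E] [InnerProductSpace ℝ E] {s t : ℝ}
    (hst : s + t ≠ 0) (v x x₀ : E) :
    s * ‖v - x‖ ^ 2 + t * ‖v - x₀‖ ^ 2 = (s + t) * ‖v - (s + t)⁻¹ • (s • x + t • x₀)‖ ^ 2 +
      s * t / (s + t) * ‖x - x₀‖ ^ 2 := by
  have hv : v - (s + t)⁻¹ • (s • x + t • x₀) = (s + t)⁻¹ • (s • (v - x) + t • (v - x₀)) := by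
    rw [eq_inv_smul_iff₀ hst, smul_sub, smul_inv_smul₀ hst]
    module
  rw [hv, ← sub_sub_sub_cancel_left x₀ x v, norm_smul, mul_pow, Real.norm_eq_abs, sq_abs,
    norm_add_sq_real, norm_sub_sq_real (v - x₀) (v - x), norm_smul, norm_smul,
    real_inner_smul_left, real_inner_smul_right, real_inner_comm (v - x) (v - x₀), mul_pow,
    mul_pow, Real.norm_eq_abs, Real.norm_eq_abs, sq_abs, sq_abs]
  field_simp
  ring

lemma gauss_mul_gauss {s t : ℝ} (hst : s + t ≠ 0) (x x₀ : EuclideanSpace ℝ (Fin n)) (z : Pt n) :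
    gauss s x z * gauss t x₀ z = gauss (s * t / (s + t)) x₀ (x, 0) *
      gauss (s + t) ((s + t)⁻¹ • (s • x + t • x₀)) z := by
  rw [gauss_mk_zero, gauss, gauss, gauss, ← Real.exp_add, ← Real.exp_add, normSq_sub_mk,
    normSq_sub_mk, normSq_sub_mk]
  congr 1
  linarith [add_mul_norm_sq_sub hst z.1 x x₀]

lemma lintegral_gauss_mul_gauss [Fact (-1 < a)] {s t : ℝ} (hst : 0 < s + t)
    (x x₀ : EuclideanSpace ℝ (Fin n)) :
    ∫⁻ z, ENNReal.ofReal (gauss s x z) * ENNReal.ofReal (gauss t x₀ z) ∂halfMeasure n a =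
      ENNReal.ofReal (gaussMass n a * (s + t) ^ (-halfDim n a) *
        gauss (s * t / (s + t)) x₀ (x, 0)) := by
  simp_rw [← ENNReal.ofReal_mul (gauss_pos _ _ _).le, gauss_mul_gauss hst.ne']
  rw [← ofReal_integral_eq_lintegral_ofReal ((integrable_gauss hst _).const_mul _)
    (ae_of_all _ fun z => mul_nonneg (gauss_pos _ _ _).le (gauss_pos _ _ _).le),
    integral_const_mul, integral_gauss hst, mul_comm]

lemma image_mul_div_add_Ioi {t : ℝ} (ht : 0 < t) :
    (fun s : ℝ => s * t / (s + t)) '' Ioi 0 = Ioo 0 t := by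
  ext σ
  constructor
  · rintro ⟨s, hs, rfl⟩
    rw [mem_Ioi] at hs
    refine ⟨by positivity, ?_⟩
    rw [div_lt_iff₀ (by positivity)]
    nlinarith
  · rintro ⟨hσ, hσt⟩
    have hsub : 0 < t - σ := sub_pos.2 hσt
    refine ⟨σ * t / (t - σ), div_pos (mul_pos hσ ht) hsub, ?_⟩
    field_simp
    ring_nf

lemma lintegral_comp_mul_div_add {t : ℝ} (ht : 0 < t) (f : ℝ → ℝ≥0∞) :
    ∫⁻ σ in Ioo 0 t, f σ =
      ∫⁻ s in Ioi (0 : ℝ), ENNReal.ofReal (t ^ 2 / (s + t) ^ 2) * f (s * t / (s + t)) := by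
  rw [← image_mul_div_add_Ioi ht, lintegral_image_eq_lintegral_abs_deriv_mul measurableSet_Ioi
    (f' := fun s => t ^ 2 / (s + t) ^ 2)]
  · simp_rw [abs_of_nonneg (div_nonneg (sq_nonneg t) (sq_nonneg _))]
  · intro s hs
    have hst : s + t ≠ 0 := (add_pos hs ht).ne'
    refine (((hasDerivAt_id s).mul_const t).div ((hasDerivAt_id s).add_const t)
      hst).hasDerivWithinAt.congr_deriv ?_
    simp only [id]
    ring
  · intro s hs s' hs' heq
    rw [mem_Ioi] at hs hs'
    rw [div_eq_div_iff (by positivity) (by positivity)] at heq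
    exact mul_left_cancel₀ (pow_pos ht 2).ne' (by linarith)

lemma rpow_sub_two_mul_add_rpow_neg {s t : ℝ} (hs : 0 < s) (ht : 0 < t) (b : ℝ) :
    s ^ (b - 2) * (s + t) ^ (-b) =
      t ^ (-b) * (t ^ 2 / (s + t) ^ 2 * (s * t / (s + t)) ^ (b - 2)) := by
  have hst : 0 < s + t := add_pos hs ht
  have : 0 < t ^ b := Real.rpow_pos_of_pos ht _
  have : 0 < (s + t) ^ b := Real.rpow_pos_of_pos hst _
  rw [Real.div_rpow (by positivity) hst.le, Real.mul_rpow hs.le ht.le, Real.rpow_sub ht,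
    Real.rpow_sub hst, Real.rpow_ofNat, Real.rpow_ofNat, Real.rpow_neg ht.le, Real.rpow_neg hst.le]
  field_simp

lemma lintegral_fundKernel_mul_gauss [Fact (-1 < a)] (hb : 1 < halfDim n a) {t : ℝ} (ht : 0 < t)
    (x x₀ : EuclideanSpace ℝ (Fin n)) :
    ∫⁻ z, ENNReal.ofReal (fundKernel n a (z - (x, 0))) * ENNReal.ofReal (gauss t x₀ z)
        ∂halfMeasure n a =
      ENNReal.ofReal (t ^ (-halfDim n a)) * ∫⁻ s in Ioo 0 t,
        ENNReal.ofReal (1 / 4 * s ^ (halfDim n a - 2) * gauss s x₀ (x, 0)) := by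
  have hmass := gaussMass_pos (n := n) (a := a)
  calc _ = ∫⁻ z : Pt n, (∫⁻ s in Ioi (0 : ℝ),
        ENNReal.ofReal ((4 * gaussMass n a)⁻¹ * s ^ (halfDim n a - 2)) *
          (ENNReal.ofReal (gauss s x z) * ENNReal.ofReal (gauss t x₀ z))) ∂halfMeasure n a := by
        refine lintegral_congr_ae ?_
        filter_upwards [ae_pos_halfMeasure n a] with z hz
        simp_rw [ofReal_fundKernel_sub hb hz x, ← mul_assoc]
        rw [lintegral_mul_const _ (by fun_prop)]
    _ = ∫⁻ s in Ioi (0 : ℝ), ∫⁻ z,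
        ENNReal.ofReal ((4 * gaussMass n a)⁻¹ * s ^ (halfDim n a - 2)) *
          (ENNReal.ofReal (gauss s x z) * ENNReal.ofReal (gauss t x₀ z)) ∂halfMeasure n a := by
        refine lintegral_lintegral_swap (Measurable.aemeasurable ?_)
        unfold Function.uncurry
        fun_prop
    _ = ∫⁻ s in Ioi (0 : ℝ), ENNReal.ofReal (t ^ (-halfDim n a)) *
        (ENNReal.ofReal (t ^ 2 / (s + t) ^ 2) * ENNReal.ofReal (1 / 4 *
          (s * t / (s + t)) ^ (halfDim n a - 2) * gauss (s * t / (s + t)) x₀ (x, 0))) := by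
        refine setLIntegral_congr_fun measurableSet_Ioi fun s hs => ?_
        rw [mem_Ioi] at hs
        have hst : 0 < s + t := by positivity
        rw [lintegral_const_mul _ (by fun_prop), lintegral_gauss_mul_gauss hst,
          ← ENNReal.ofReal_mul (by positivity), ← ENNReal.ofReal_mul (by positivity),
          ← ENNReal.ofReal_mul (by positivity)]
        congr 1
        have hpow := rpow_sub_two_mul_add_rpow_neg hs ht (halfDim n a)
        field_simp at hpow ⊢
        linear_combination gauss (s * t / (s + t)) x₀ (x, 0) * hpow
    _ = _ := by
        rw [lintegral_const_mul _ (by fun_prop), lintegral_comp_mul_div_add ht]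

lemma measurable_lintegral_rpow_mul_gauss (a t : ℝ) (x : EuclideanSpace ℝ (Fin n)) :
    Measurable fun x' : EuclideanSpace ℝ (Fin n) => ∫⁻ s in Ioo 0 t,
      ENNReal.ofReal (1 / 4 * s ^ (halfDim n a - 2) * gauss s x (x', 0)) :=
  Measurable.lintegral_prod_right' (f := fun p : EuclideanSpace ℝ (Fin n) × ℝ =>
    ENNReal.ofReal (1 / 4 * p.2 ^ (halfDim n a - 2) * gauss p.2 x (p.1, 0))) (by fun_prop)

/-- The potential of a measure on `{y = 0}`. -/
def potential (a : ℝ) (m : Measure (EuclideanSpace ℝ (Fin n))) (z : Pt n) : ℝ :=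
  ∫ x, fundKernel n a (z - (x, 0)) ∂m

section Potential

variable (m : Measure (EuclideanSpace ℝ (Fin n)))

lemma potential_nonneg [Fact (-1 < a)] (hb : 1 < halfDim n a) (z : Pt n) : 0 ≤ potential a m z :=
  integral_nonneg fun _ => fundKernel_nonneg hb _

lemma potential_mul_gauss_nonneg [Fact (-1 < a)] (hb : 1 < halfDim n a)
    (t : ℝ) (x : EuclideanSpace ℝ (Fin n)) :
    0 ≤ᵐ[halfMeasure n a] fun z => potential a m z * gauss t x z :=
  ae_of_all _ fun z => mul_nonneg (potential_nonneg m hb z) (gauss_pos t x z).le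

lemma gaussProfile_nonneg {t : ℝ} (ht : 0 ≤ t) (x : EuclideanSpace ℝ (Fin n)) :
    0 ≤ gaussProfile a m t x :=
  intervalIntegral.integral_nonneg ht fun _ hs => mul_nonneg
    (mul_nonneg (by norm_num) (Real.rpow_nonneg hs.1 _))
    (integral_nonneg fun _ => (gauss_pos _ _ _).le)

variable [IsFiniteMeasure m]

lemma integrable_fundKernel_sub [Fact (-1 < a)] (hb : 1 < halfDim n a) {z : Pt n} {r : ℝ}
    (hr : 0 < r) (hz : ∀ᵐ x ∂m, r ≤ normSq (z - (x, 0))) :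
    Integrable (fun x => fundKernel n a (z - (x, 0))) m := by
  refine .of_bound
    ((measurable_fundKernel_sub n a).comp measurable_prodMk_left).aestronglyMeasurable
    (Real.Gamma (halfDim n a - 1) / (4 * gaussMass n a) * r ^ (-(halfDim n a - 1))) ?_
  filter_upwards [hz] with x hx
  rw [Real.norm_of_nonneg (fundKernel_nonneg hb _)]
  exact mul_le_mul_of_nonneg_left (Real.rpow_le_rpow_of_nonpos hr hx (by linarith))
    (gamma_div_gaussMass_pos hb).le

lemma measurable_potential : Measurable (potential a m) :=
  ((measurable_fundKernel_sub n a).stronglyMeasurable.integral_prod_right').measurable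

lemma ofReal_potential [Fact (-1 < a)] (hb : 1 < halfDim n a) {z : Pt n} (hz : 0 < z.2) :
    ENNReal.ofReal (potential a m z) = ∫⁻ x, ENNReal.ofReal (fundKernel n a (z - (x, 0))) ∂m := by
  refine ofReal_integral_eq_lintegral_ofReal (integrable_fundKernel_sub m hb (pow_pos hz 2) ?_)
    (ae_of_all _ fun _ => fundKernel_nonneg hb _)
  refine ae_of_all _ fun x => ?_
  rw [normSq_sub_mk]
  exact le_add_of_nonneg_left (sq_nonneg _)

lemma ofReal_gaussProfile (hb : 1 < halfDim n a) {t : ℝ} (ht : 0 < t)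
    (x : EuclideanSpace ℝ (Fin n)) :
    ENNReal.ofReal (gaussProfile a m t x) = ∫⁻ x', (∫⁻ s in Ioo 0 t,
      ENNReal.ofReal (1 / 4 * s ^ (halfDim n a - 2) * gauss s x (x', 0))) ∂m := by
  have hint := intervalIntegrable_rpow_mul_integral_gauss hb m ht x
  rw [intervalIntegrable_iff_integrableOn_Ioo_of_le ht.le] at hint
  have hpow (s : ℝ) (hs : s ∈ Ioo 0 t) : 0 ≤ 1 / 4 * s ^ (halfDim n a - 2) :=
    mul_nonneg (by norm_num) (Real.rpow_nonneg hs.1.le _)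
  rw [gaussProfile, intervalIntegral.integral_of_le ht.le, integral_Ioc_eq_integral_Ioo,
    ofReal_integral_eq_lintegral_ofReal hint ((ae_restrict_mem measurableSet_Ioo).mono fun s hs =>
      mul_nonneg (hpow s hs) (integral_nonneg fun _ => (gauss_pos _ _ _).le))]
  rw [lintegral_lintegral_swap (Measurable.aemeasurable (by unfold Function.uncurry; fun_prop))]
  refine setLIntegral_congr_fun measurableSet_Ioo fun s hs => ?_
  rw [← integral_const_mul, ofReal_integral_eq_lintegral_ofReal
    ((integrable_gauss_mk_zero m hs.1.le x).const_mul _)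
    (ae_of_all _ fun x' => mul_nonneg (hpow s hs) (gauss_pos _ _ _).le)]

lemma lintegral_potential_mul_gauss [Fact (-1 < a)] (hb : 1 < halfDim n a) {t : ℝ} (ht : 0 < t)
    (x : EuclideanSpace ℝ (Fin n)) :
    ∫⁻ z, ENNReal.ofReal (potential a m z * gauss t x z) ∂halfMeasure n a =
      ENNReal.ofReal (t ^ (-halfDim n a) * gaussProfile a m t x) := by
  have hker := measurable_fundKernel_sub n a
  have hgauss : Measurable fun p : Pt n × EuclideanSpace ℝ (Fin n) => gauss t x p.1 := by fun_prop
  have hker' (z : Pt n) : Measurable fun x' => fundKernel n a (z - (x', 0)) :=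
    (measurable_fundKernel n a).comp (by fun_prop)
  calc ∫⁻ z, ENNReal.ofReal (potential a m z * gauss t x z) ∂halfMeasure n a
      = ∫⁻ z, (∫⁻ x', ENNReal.ofReal (fundKernel n a (z - (x', 0))) *
          ENNReal.ofReal (gauss t x z) ∂m) ∂halfMeasure n a := by
        refine lintegral_congr_ae ?_
        filter_upwards [ae_pos_halfMeasure n a] with z hz
        rw [ENNReal.ofReal_mul (potential_nonneg m hb z), ofReal_potential m hb hz,
          lintegral_mul_const _ (hker' z).ennreal_ofReal]
    _ = ∫⁻ x', (∫⁻ z, ENNReal.ofReal (fundKernel n a (z - (x', 0))) *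
          ENNReal.ofReal (gauss t x z) ∂halfMeasure n a) ∂m :=
        lintegral_lintegral_swap (hker.ennreal_ofReal.mul hgauss.ennreal_ofReal).aemeasurable
    _ = ENNReal.ofReal (t ^ (-halfDim n a) * gaussProfile a m t x) := by
        simp_rw [lintegral_fundKernel_mul_gauss hb ht]
        rw [lintegral_const_mul _ (measurable_lintegral_rpow_mul_gauss a t x),
          ← ofReal_gaussProfile m hb ht x, ENNReal.ofReal_mul (by positivity)]

lemma aestronglyMeasurable_potential_mul_gauss (t : ℝ) (x : EuclideanSpace ℝ (Fin n)) :
    AEStronglyMeasurable (fun z => potential a m z * gauss t x z) (halfMeasure n a) :=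
  ((measurable_potential m).mul (continuous_gauss t x).measurable).aestronglyMeasurable

lemma integrable_potential_mul_gauss [Fact (-1 < a)] (hb : 1 < halfDim n a) {t : ℝ} (ht : 0 < t)
    (x : EuclideanSpace ℝ (Fin n)) :
    Integrable (fun z => potential a m z * gauss t x z) (halfMeasure n a) := by
  refine (lintegral_ofReal_ne_top_iff_integrable (aestronglyMeasurable_potential_mul_gauss m t x)
    (potential_mul_gauss_nonneg m hb t x)).1 ?_
  rw [lintegral_potential_mul_gauss m hb ht x]
  exact ENNReal.ofReal_ne_top

lemma integral_potential_mul_gauss [Fact (-1 < a)] (hb : 1 < halfDim n a) {t : ℝ} (ht : 0 < t)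
    (x : EuclideanSpace ℝ (Fin n)) :
    ∫ z, potential a m z * gauss t x z ∂halfMeasure n a =
      t ^ (-halfDim n a) * gaussProfile a m t x := by
  rw [integral_eq_lintegral_of_nonneg_ae (potential_mul_gauss_nonneg m hb t x)
    (aestronglyMeasurable_potential_mul_gauss m t x), lintegral_potential_mul_gauss m hb ht x,
    ENNReal.toReal_ofReal]
  exact mul_nonneg (Real.rpow_nonneg ht.le _) (gaussProfile_nonneg m ht.le x)

end Potential

/-! ### Injectivity of the Gaussian transform -/

section Injectivity

open scoped BoundedContinuousFunction

lemma ae_eq_zero_of_forall_mem_subalgebra {X : Type*} [TopologicalSpace X] [PolishSpace X]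
    [MeasurableSpace X] [BorelSpace X] {ν : Measure X} {u : X → ℝ} (hu : Integrable u ν)
    {S : StarSubalgebra ℝ (X →ᵇ ℝ)}
    (hS : (S.map (BoundedContinuousFunction.toContinuousMapStarₐ ℝ)).SeparatesPoints)
    (h : ∀ f ∈ S, ∫ x, u x * f x ∂ν = 0) : u =ᵐ[ν] 0 := by
  let ρ (v : X → ℝ) : Measure X := ν.withDensity fun x => ENNReal.ofReal (v x)
  have : IsFiniteMeasure (ρ u) := isFiniteMeasure_withDensity_ofReal hu.2
  have : IsFiniteMeasure (ρ (-u)) := isFiniteMeasure_withDensity_ofReal hu.neg.2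
  have hint (v : X → ℝ) (hv : Integrable v ν) (f : X →ᵇ ℝ) :
      ∫ x, f x ∂ρ v = ∫ x, max (v x) 0 * f x ∂ν := by
    rw [integral_withDensity_eq_integral_toReal_smul₀ hv.1.aemeasurable.ennreal_ofReal (by simp)]
    simp only [ENNReal.toReal_ofReal', smul_eq_mul]
  have hmul (v : X → ℝ) (hv : Integrable v ν) (f : X →ᵇ ℝ) :
      Integrable (fun x => max (v x) 0 * f x) ν :=
    hv.pos_part.mul_bdd (c := ‖f‖) f.continuous.aestronglyMeasurable
      (ae_of_all _ fun x => f.norm_coe_le_norm x)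
  have hρ : ρ u = ρ (-u) := by
    refine ext_of_forall_mem_subalgebra_integral_eq_of_polish hS fun f hf => sub_eq_zero.1 ?_
    rw [hint u hu, hint (-u) hu.neg, ← integral_sub (hmul u hu f) (hmul (-u) hu.neg f)]
    simpa only [← sub_mul, Pi.neg_apply, max_zero_sub_max_neg_zero_eq_self] using h f hf
  filter_upwards [(withDensity_eq_iff hu.1.aemeasurable.ennreal_ofReal
    hu.neg.1.aemeasurable.ennreal_ofReal hu.lintegral_lt_top.ne).1 hρ] with x hx
  have hmax := congrArg ENNReal.toReal hx
  rw [ENNReal.toReal_ofReal', ENNReal.toReal_ofReal', Pi.neg_apply] at hmax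
  rw [Pi.zero_apply, ← max_zero_sub_max_neg_zero_eq_self (u x), hmax, sub_self]

/-- The closed half space `{y ≥ 0}`. -/
abbrev ClosedHalf (n : ℕ) : Type := {z : Pt n // 0 ≤ z.2}

/-- A Gaussian centred on `{y = 0}`, as a bounded continuous function on the closed half space. -/
def gaussBCF {t : ℝ} (ht : 0 ≤ t) (x : EuclideanSpace ℝ (Fin n)) : ClosedHalf n →ᵇ ℝ :=
  BoundedContinuousFunction.ofNormedAddCommGroup (fun z => gauss t x z.1)
    ((continuous_gauss t x).comp continuous_subtype_val) 1 fun z => by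
      rw [Real.norm_of_nonneg (gauss_pos _ _ _).le]; exact gauss_le_one ht _ _

lemma gauss_mul_gauss_of_nonneg {s t : ℝ} (hs : 0 ≤ s) (ht : 0 ≤ t)
    (x x₀ : EuclideanSpace ℝ (Fin n)) (z : Pt n) :
    gauss s x z * gauss t x₀ z = gauss (s * t / (s + t)) x₀ (x, 0) *
      gauss (s + t) ((s + t)⁻¹ • (s • x + t • x₀)) z := by
  rcases eq_or_ne (s + t) 0 with hst | hst
  · obtain ⟨rfl, rfl⟩ := (add_eq_zero_iff_of_nonneg hs ht).1 hst
    simp [gauss_zero]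
  · exact gauss_mul_gauss hst x x₀ z

lemma gaussBCF_mul_gaussBCF {s t : ℝ} (hs : 0 ≤ s) (ht : 0 ≤ t)
    (x x₀ : EuclideanSpace ℝ (Fin n)) :
    gaussBCF hs x * gaussBCF ht x₀ = gauss (s * t / (s + t)) x₀ (x, 0) •
      gaussBCF (add_nonneg hs ht) ((s + t)⁻¹ • (s • x + t • x₀)) := by
  ext z
  exact gauss_mul_gauss_of_nonneg hs ht x x₀ z.1

lemma gaussBCF_zero (x : EuclideanSpace ℝ (Fin n)) : gaussBCF le_rfl x = 1 := by
  ext z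
  exact gauss_zero x z.1

/-- The multiples of Gaussians centred on `{y = 0}`. The parameter `t = 0` contributes the
constants. -/
def gaussSubmonoid (n : ℕ) : Submonoid (ClosedHalf n →ᵇ ℝ) where
  carrier := {f | ∃ (c t : ℝ) (ht : 0 ≤ t) (x : EuclideanSpace ℝ (Fin n)), f = c • gaussBCF ht x}
  one_mem' := ⟨1, 0, le_rfl, 0, by rw [one_smul, gaussBCF_zero]⟩
  mul_mem' := by
    rintro _ _ ⟨c, s, hs, x, rfl⟩ ⟨d, t, ht, x₀, rfl⟩
    exact ⟨c * d * gauss (s * t / (s + t)) x₀ (x, 0), s + t, add_nonneg hs ht,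
      (s + t)⁻¹ • (s • x + t • x₀),
      by rw [smul_mul_smul_comm, gaussBCF_mul_gaussBCF, smul_smul]⟩

/-- The algebra generated by the Gaussians centred on `{y = 0}`. -/
def gaussAlgebra (n : ℕ) : StarSubalgebra ℝ (ClosedHalf n →ᵇ ℝ) where
  toSubalgebra := Algebra.adjoin ℝ (gaussSubmonoid n)
  star_mem' {f} hf := by
    have hstar : star f = f := by ext z; simp
    rwa [hstar]

lemma eq_of_forall_gauss_eq {z z' : Pt n} (hz : 0 ≤ z.2) (hz' : 0 ≤ z'.2)
    (h : ∀ x, gauss 1 x z = gauss 1 x z') : z = z' := by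
  have hdist (x : EuclideanSpace ℝ (Fin n)) :
      ‖z.1 - x‖ ^ 2 + z.2 ^ 2 = ‖z'.1 - x‖ ^ 2 + z'.2 ^ 2 := by
    have hexp := Real.exp_injective (h x)
    rw [normSq_sub_mk, normSq_sub_mk] at hexp
    linarith
  have hz₁ := hdist z.1
  have hz₂ := hdist z'.1
  rw [sub_self, norm_zero] at hz₁ hz₂
  rw [norm_sub_rev] at hz₂
  have hnorm : ‖z'.1 - z.1‖ ^ 2 = 0 := by linarith
  refine Prod.ext (sub_eq_zero.1 (norm_eq_zero.1 (pow_eq_zero_iff two_ne_zero |>.1 hnorm))).symm ?_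
  exact (sq_eq_sq₀ hz hz').1 (by linarith)

lemma separatesPoints_gaussAlgebra (n : ℕ) :
    ((gaussAlgebra n).map
      (BoundedContinuousFunction.toContinuousMapStarₐ ℝ)).SeparatesPoints := by
  intro z z' hne
  by_contra! hcon
  refine hne (Subtype.ext (eq_of_forall_gauss_eq z.2 z'.2 fun x =>
    hcon _ ⟨_, ⟨gaussBCF zero_le_one x, Algebra.subset_adjoin ?_, rfl⟩, rfl⟩))
  exact ⟨1, 1, zero_le_one, x, (one_smul ℝ _).symm⟩

lemma integral_mul_eq_zero_of_mem_gaussAlgebra {ν : Measure (ClosedHalf n)} {u : ClosedHalf n → ℝ}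
    (hu : Integrable u ν) (h : ∀ t : ℝ, 0 ≤ t → ∀ x, ∫ z, u z * gauss t x z.1 ∂ν = 0)
    {f : ClosedHalf n →ᵇ ℝ} (hf : f ∈ gaussAlgebra n) : ∫ z, u z * f z ∂ν = 0 := by
  have hint (f : ClosedHalf n →ᵇ ℝ) : Integrable (fun z => u z * f z) ν :=
    hu.mul_bdd (c := ‖f‖) f.continuous.aestronglyMeasurable
      (ae_of_all _ fun z => f.norm_coe_le_norm z)
  have hspan : f ∈ Submodule.span ℝ (gaussSubmonoid n : Set (ClosedHalf n →ᵇ ℝ)) := by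
    rw [← Submonoid.closure_eq (gaussSubmonoid n), ← Algebra.adjoin_eq_span]
    exact hf
  clear hf
  induction hspan using Submodule.span_induction with
  | mem f hf =>
    obtain ⟨c, t, ht, x, rfl⟩ := hf
    change ∫ z, u z * (c * gauss t x z.1) ∂ν = 0
    simp_rw [mul_left_comm _ c]
    rw [integral_const_mul, h t ht x, mul_zero]
  | zero => simp
  | add f g _ _ hf hg =>
    simp only [BoundedContinuousFunction.coe_add, Pi.add_apply, mul_add]
    rw [integral_add (hint f) (hint g), hf, hg, add_zero]
  | smul c f _ hf =>
    simp only [BoundedContinuousFunction.coe_smul, smul_eq_mul, mul_left_comm _ c]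
    rw [integral_const_mul, hf, mul_zero]

lemma ae_eq_zero_of_forall_integral_gauss {w : Pt n → ℝ}
    (hint : Integrable (fun z => w z * gauss 1 0 z) (halfMeasure n a))
    (h : ∀ t : ℝ, 0 < t → ∀ x, ∫ z, w z * gauss t x z ∂halfMeasure n a = 0) :
    w =ᵐ[halfMeasure n a] 0 := by
  have hclosed : IsClosed {z : Pt n | 0 ≤ z.2} := isClosed_le continuous_const continuous_snd
  have : PolishSpace (ClosedHalf n) := hclosed.polishSpace
  have hemb : MeasurableEmbedding ((↑) : ClosedHalf n → Pt n) := .subtype_coe hclosed.measurableSet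
  have hmap : ((halfMeasure n a).comap ((↑) : ClosedHalf n → Pt n)).map (↑) = halfMeasure n a := by
    rw [hemb.map_comap]
    exact Measure.restrict_eq_self_of_ae_mem
      ((ae_pos_halfMeasure n a).mono fun z hz => ⟨⟨z, hz.le⟩, rfl⟩)
  have hu := (hemb.integrable_map_iff).1 (hmap.symm ▸ hint)
  have hzero : ∀ᵐ z ∂halfMeasure n a, w z * gauss 1 0 z = 0 := by
    rw [← hmap, hemb.ae_map_iff]
    refine ae_eq_zero_of_forall_mem_subalgebra hu (separatesPoints_gaussAlgebra n) fun f hf =>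
      integral_mul_eq_zero_of_mem_gaussAlgebra hu (fun t ht x => ?_) hf
    refine (hemb.integral_map fun z => w z * gauss 1 0 z * gauss t x z).symm.trans ?_
    rw [hmap]
    simp_rw [mul_assoc, gauss_mul_gauss_of_nonneg zero_le_one ht, mul_left_comm (w _)]
    rw [integral_const_mul, h _ (by positivity), mul_zero]
  filter_upwards [hzero] with z hz
  exact (mul_eq_zero.1 hz).resolve_right (gauss_pos _ _ _).ne'

end Injectivity

/-! ### The fundamental solution -/

lemma euclNorm_mul_gauss_le {t : ℝ} (ht : 0 < t) (x : EuclideanSpace ℝ (Fin n)) (z : Pt n) :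
    euclNorm (z - (x, 0)) * gauss t x z ≤ t ^ (-(1 / 2) : ℝ) * gauss (t / 2) x z := by
  have hsqrt : 0 < √t := Real.sqrt_pos.2 ht
  have hpow : t ^ (-(1 / 2) : ℝ) = (√t)⁻¹ := by rw [Real.rpow_neg ht.le, Real.sqrt_eq_rpow]
  have hexp : √t * euclNorm (z - (x, 0)) ≤ Real.exp (t / 2 * normSq (z - (x, 0))) := by
    have hadd := Real.add_one_le_exp (t / 2 * normSq (z - (x, 0)))
    have hsq : (√t * euclNorm (z - (x, 0))) ^ 2 = t * normSq (z - (x, 0)) := by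
      rw [mul_pow, Real.sq_sqrt ht.le, euclNorm_sq]
    nlinarith [sq_nonneg (√t * euclNorm (z - (x, 0)) - 1)]
  have hhalf : euclNorm (z - (x, 0)) * gauss (t / 2) x z ≤ (√t)⁻¹ := by
    rw [gauss, neg_mul, Real.exp_neg, ← div_eq_mul_inv, div_le_iff₀ (Real.exp_pos _),
      inv_mul_eq_div, le_div_iff₀' hsqrt]
    exact hexp
  rw [hpow, ← add_halves t, gauss_add, add_halves, ← mul_assoc]
  exact mul_le_mul_of_nonneg_right hhalf (gauss_pos _ _ _).le

lemma integrable_euclNorm_mul_gauss [Fact (-1 < a)] {t : ℝ} (ht : 0 < t)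
    (x : EuclideanSpace ℝ (Fin n)) :
    Integrable (fun z => euclNorm (z - (x, 0)) * gauss t x z) (halfMeasure n a) := by
  refine ((integrable_gauss (half_pos ht) x).const_mul (t ^ (-(1 / 2) : ℝ))).mono'
    (Continuous.aestronglyMeasurable (by fun_prop)) (ae_of_all _ fun z => ?_)
  rw [Real.norm_of_nonneg (mul_nonneg (euclNorm_nonneg _) (gauss_pos _ _ _).le)]
  exact euclNorm_mul_gauss_le ht x z

lemma integral_euclNorm_mul_gauss_le [Fact (-1 < a)] {t : ℝ} (ht : 0 < t)
    (x : EuclideanSpace ℝ (Fin n)) :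
    ∫ z, euclNorm (z - (x, 0)) * gauss t x z ∂halfMeasure n a ≤
      gaussMass n a * 2 ^ halfDim n a * t ^ (-(1 / 2) - halfDim n a) :=
  calc _ ≤ ∫ z, t ^ (-(1 / 2) : ℝ) * gauss (t / 2) x z ∂halfMeasure n a :=
        integral_mono (integrable_euclNorm_mul_gauss ht x)
          ((integrable_gauss (half_pos ht) x).const_mul _) (euclNorm_mul_gauss_le ht x)
    _ = _ := by
        rw [integral_const_mul, integral_gauss (half_pos ht), Real.div_rpow ht.le zero_le_two,
          Real.rpow_neg zero_le_two, div_inv_eq_mul, sub_eq_add_neg, Real.rpow_add ht]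
        ring

lemma IsTest.abs_integral_gauss_sub_le [Fact (-1 < a)] {ψ : Pt n → ℝ} (h : IsTest ψ) {L : ℝ}
    {x : EuclideanSpace ℝ (Fin n)} (hL0 : 0 ≤ L)
    (hL : ∀ z, |ψ z - ψ (x, 0)| ≤ L * euclNorm (z - (x, 0))) {t : ℝ} (ht : 0 < t) :
    |∫ z, ψ z * gauss t x z ∂halfMeasure n a - gaussMass n a * t ^ (-halfDim n a) * ψ (x, 0)| ≤
      L * (gaussMass n a * 2 ^ halfDim n a * t ^ (-(1 / 2) - halfDim n a)) := by
  have hi := integrable_mul_gauss (a := a) h.memLp_hardyWeight_mul ht x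
  have hdiff : ∫ z, ψ z * gauss t x z ∂halfMeasure n a -
      gaussMass n a * t ^ (-halfDim n a) * ψ (x, 0) =
        ∫ z, (ψ z * gauss t x z - ψ (x, 0) * gauss t x z) ∂halfMeasure n a := by
    rw [integral_sub hi ((integrable_gauss ht x (a := a)).const_mul _), integral_const_mul,
      integral_gauss ht, mul_comm (ψ _)]
  calc _ ≤ ∫ z, L * (euclNorm (z - (x, 0)) * gauss t x z) ∂halfMeasure n a := by
        rw [hdiff, ← Real.norm_eq_abs]
        refine norm_integral_le_of_norm_le ((integrable_euclNorm_mul_gauss ht x).const_mul L)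
          (ae_of_all _ fun z => ?_)
        rw [← sub_mul, norm_mul, Real.norm_of_nonneg (gauss_pos _ _ _).le, ← mul_assoc]
        exact mul_le_mul_of_nonneg_right (hL z) (gauss_pos _ _ _).le
    _ ≤ _ := by
        rw [integral_const_mul]
        exact mul_le_mul_of_nonneg_left (integral_euclNorm_mul_gauss_le ht x) hL0

lemma IsTest.tendsto_rpow_mul_integral_gauss_atTop [Fact (-1 < a)] {ψ : Pt n → ℝ} (h : IsTest ψ)
    (x : EuclideanSpace ℝ (Fin n)) :
    Tendsto (fun t : ℝ => t ^ halfDim n a * ∫ z, ψ z * gauss t x z ∂halfMeasure n a) atTop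
      (𝓝 (gaussMass n a * ψ (x, 0))) := by
  obtain ⟨L, hL0, hL⟩ := h.exists_lipschitz
  have hlim : Tendsto (fun t : ℝ => L * (gaussMass n a * 2 ^ halfDim n a) * t ^ (-(1 / 2) : ℝ))
      atTop (𝓝 0) := by
    simpa only [mul_zero] using (tendsto_rpow_neg_atTop one_half_pos).const_mul _
  refine tendsto_iff_dist_tendsto_zero.2 (squeeze_zero' (.of_forall fun _ => dist_nonneg) ?_ hlim)
  filter_upwards [eventually_gt_atTop 0] with t ht
  have hpow : 0 < t ^ halfDim n a := Real.rpow_pos_of_pos ht _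
  have hmass : gaussMass n a * ψ (x, 0) =
      t ^ halfDim n a * (gaussMass n a * t ^ (-halfDim n a) * ψ (x, 0)) := by
    rw [Real.rpow_neg ht.le]
    field_simp
  rw [hmass, Real.dist_eq, ← mul_sub, abs_mul, abs_of_pos hpow]
  calc _ ≤ t ^ halfDim n a *
        (L * (gaussMass n a * 2 ^ halfDim n a * t ^ (-(1 / 2) - halfDim n a))) :=
        mul_le_mul_of_nonneg_left (h.abs_integral_gauss_sub_le hL0 (hL · _) ht) hpow.le
    _ = _ := by
        rw [Real.rpow_sub ht]
        field_simp

lemma integrable_prod_rpow_mul_gauss_mul {f : Pt n → ℝ} (hf : Measurable f)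
    {q : ℝ} {x : EuclideanSpace ℝ (Fin n)}
    (hint : ∀ t, Integrable (fun z => gauss t x z * f z) (halfMeasure n a))
    (hnorm : IntegrableOn (fun t : ℝ => t ^ q * ∫ z, ‖gauss t x z * f z‖ ∂halfMeasure n a)
      (Ioi 0)) :
    Integrable (fun p : Pt n × ℝ => p.2 ^ q * (gauss p.2 x p.1 * f p.1))
      ((halfMeasure n a).prod (volume.restrict (Ioi 0))) := by
  have hmeas : Measurable fun p : Pt n × ℝ => p.2 ^ q * (gauss p.2 x p.1 * f p.1) :=
    (measurable_snd.pow_const q).mul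
      ((measurable_gauss_comp measurable_snd measurable_fst x).mul (hf.comp measurable_fst))
  refine (integrable_prod_iff' hmeas.aestronglyMeasurable).2
    ⟨ae_of_all _ fun t => (hint t).const_mul (t ^ q), hnorm.congr ?_⟩
  filter_upwards [ae_restrict_mem measurableSet_Ioi] with t ht
  simp only [norm_mul (t ^ q), Real.norm_of_nonneg (Real.rpow_nonneg (le_of_lt ht) q),
    integral_const_mul]

namespace IsTest

variable {ψ : Pt n → ℝ}

lemma exists_abs_euclDot_euclGrad_le (h : IsTest ψ) :
    ∃ C, 0 ≤ C ∧ ∀ z w, |euclDot (euclGrad ψ z) w| ≤ C * euclNorm w := by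
  obtain ⟨C, hC⟩ := h.continuous_euclGrad.bounded_above_of_compact_support
    h.hasCompactSupport_euclGrad
  refine ⟨2 * C, mul_nonneg zero_le_two ((norm_nonneg _).trans (hC 0)), fun z w => ?_⟩
  refine (abs_euclDot_le _ _).trans (mul_le_mul_of_nonneg_right ?_ (euclNorm_nonneg w))
  exact (euclNorm_le _).trans (mul_le_mul_of_nonneg_left (hC z) zero_le_two)

lemma continuous_euclDot_euclGrad_sub (h : IsTest ψ) (x : EuclideanSpace ℝ (Fin n)) :
    Continuous fun z => euclDot (euclGrad ψ z) (z - (x, 0)) := by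
  have := h.continuous_euclGrad
  fun_prop

lemma integrable_gauss_mul_euclDot [Fact (-1 < a)] (h : IsTest ψ) (t : ℝ)
    (x : EuclideanSpace ℝ (Fin n)) :
    Integrable (fun z => gauss t x z * euclDot (euclGrad ψ z) (z - (x, 0)))
      (halfMeasure n a) := by
  refine ((continuous_gauss t x).mul
    (h.continuous_euclDot_euclGrad_sub x)).integrable_of_hasCompactSupport ?_
  exact h.hasCompactSupport_euclGrad.mono fun z hz h0 => hz (by simp [h0, euclDot])

lemma integral_norm_gauss_mul_euclDot_le [Fact (-1 < a)] (h : IsTest ψ) {t : ℝ} (ht : 0 ≤ t)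
    (x : EuclideanSpace ℝ (Fin n)) :
    ∫ z, ‖gauss t x z * euclDot (euclGrad ψ z) (z - (x, 0))‖ ∂halfMeasure n a ≤
      ∫ z, ‖gauss 0 x z * euclDot (euclGrad ψ z) (z - (x, 0))‖ ∂halfMeasure n a := by
  refine integral_mono (h.integrable_gauss_mul_euclDot t x).norm
    (h.integrable_gauss_mul_euclDot 0 x).norm fun z => ?_
  simp only [norm_mul, gauss_zero, norm_one, Real.norm_of_nonneg (gauss_pos t x z).le]
  exact mul_le_mul_of_nonneg_right (gauss_le_one ht x z) (norm_nonneg _)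

lemma exists_integral_norm_gauss_mul_euclDot_le [Fact (-1 < a)] (h : IsTest ψ)
    (x : EuclideanSpace ℝ (Fin n)) :
    ∃ C, ∀ t, 0 < t →
      ∫ z, ‖gauss t x z * euclDot (euclGrad ψ z) (z - (x, 0))‖ ∂halfMeasure n a ≤
        C * t ^ (-(1 / 2) - halfDim n a) := by
  obtain ⟨C, hC0, hC⟩ := h.exists_abs_euclDot_euclGrad_le
  refine ⟨C * (gaussMass n a * 2 ^ halfDim n a), fun t ht => ?_⟩
  calc _ ≤ ∫ z, C * (euclNorm (z - (x, 0)) * gauss t x z) ∂halfMeasure n a := by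
        refine integral_mono (h.integrable_gauss_mul_euclDot t x).norm
          ((integrable_euclNorm_mul_gauss ht x).const_mul C) fun z => ?_
        calc _ = |euclDot (euclGrad ψ z) (z - (x, 0))| * gauss t x z := by
              rw [norm_mul, Real.norm_of_nonneg (gauss_pos t x z).le, mul_comm, Real.norm_eq_abs]
          _ ≤ C * euclNorm (z - (x, 0)) * gauss t x z :=
              mul_le_mul_of_nonneg_right (hC z _) (gauss_pos t x z).le
          _ = _ := mul_assoc _ _ _
    _ ≤ C * (gaussMass n a * 2 ^ halfDim n a * t ^ (-(1 / 2) - halfDim n a)) := by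
        rw [integral_const_mul]
        exact mul_le_mul_of_nonneg_left (integral_euclNorm_mul_gauss_le ht x) hC0
    _ = _ := by ring

lemma continuousOn_integral_norm_gauss_mul_euclDot [Fact (-1 < a)] (h : IsTest ψ)
    (x : EuclideanSpace ℝ (Fin n)) :
    ContinuousOn (fun t => ∫ z, ‖gauss t x z * euclDot (euclGrad ψ z) (z - (x, 0))‖
      ∂halfMeasure n a) (Ioi 0) := by
  refine continuousOn_of_dominated
    (fun t _ => (h.integrable_gauss_mul_euclDot t x).norm.aestronglyMeasurable)
    (fun t ht => ae_of_all _ fun z => ?_) (h.integrable_gauss_mul_euclDot 0 x).norm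
    (ae_of_all _ fun z => ?_)
  · rw [norm_norm, norm_mul, norm_mul, gauss_zero, norm_one,
      Real.norm_of_nonneg (gauss_pos t x z).le]
    exact mul_le_mul_of_nonneg_right (gauss_le_one (le_of_lt ht) x z) (norm_nonneg _)
  · unfold gauss
    fun_prop

lemma integrableOn_rpow_mul_integral_norm_gauss_mul_euclDot [Fact (-1 < a)]
    (hb : 0 < halfDim n a) (h : IsTest ψ) (x : EuclideanSpace ℝ (Fin n)) :
    IntegrableOn (fun t : ℝ => t ^ (halfDim n a - 1) *
      ∫ z, ‖gauss t x z * euclDot (euclGrad ψ z) (z - (x, 0))‖ ∂halfMeasure n a) (Ioi 0) := by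
  obtain ⟨C, hC⟩ := h.exists_integral_norm_gauss_mul_euclDot_le (a := a) x
  refine mellin_convergent_of_isBigO_scalar (a := 1 / 2 + halfDim n a) (b := 0)
    ((h.continuousOn_integral_norm_gauss_mul_euclDot x).locallyIntegrableOn measurableSet_Ioi)
    (.of_bound C ?_) (by linarith)
    (.of_bound (∫ z, ‖gauss 0 x z * euclDot (euclGrad ψ z) (z - (x, 0))‖ ∂halfMeasure n a) ?_) hb
  · filter_upwards [eventually_gt_atTop 0] with t ht
    rw [Real.norm_of_nonneg (integral_nonneg fun _ => norm_nonneg _),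
      Real.norm_of_nonneg (Real.rpow_nonneg ht.le _), neg_add']
    exact hC t ht
  · filter_upwards [self_mem_nhdsWithin] with t ht
    rw [Real.norm_of_nonneg (integral_nonneg fun _ => norm_nonneg _), neg_zero, Real.rpow_zero,
      norm_one, mul_one]
    exact h.integral_norm_gauss_mul_euclDot_le (le_of_lt ht) x

lemma integrable_prod_rpow_mul_gauss_mul_euclDot [Fact (-1 < a)] (hb : 0 < halfDim n a)
    (h : IsTest ψ) (x : EuclideanSpace ℝ (Fin n)) :
    Integrable (fun p : Pt n × ℝ => p.2 ^ (halfDim n a - 1) *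
      (gauss p.2 x p.1 * euclDot (euclGrad ψ p.1) (p.1 - (x, 0))))
      ((halfMeasure n a).prod (volume.restrict (Ioi 0))) :=
  integrable_prod_rpow_mul_gauss_mul (h.continuous_euclDot_euclGrad_sub x).measurable
    (h.integrable_gauss_mul_euclDot · x)
    (h.integrableOn_rpow_mul_integral_norm_gauss_mul_euclDot hb x)

lemma integral_rpow_mul_integral_gauss_mul_euclDot [Fact (-1 < a)] (hb : 1 < halfDim n a)
    (h : IsTest ψ) (x : EuclideanSpace ℝ (Fin n)) :
    ∫ t in Ioi (0 : ℝ), t ^ (halfDim n a - 1) *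
      ∫ z, gauss t x z * euclDot (euclGrad ψ z) (z - (x, 0)) ∂halfMeasure n a =
      -2 * (gaussMass n a * ψ (x, 0)) := by
  have hφ := h.memLp_hardyWeight_mul (a := a)
  have hint : IntegrableOn (fun t : ℝ => t ^ (halfDim n a - 1) *
      ∫ z, gauss t x z * euclDot (euclGrad ψ z) (z - (x, 0)) ∂halfMeasure n a) (Ioi 0) := by
    rw [IntegrableOn]
    simpa only [integral_const_mul] using
      (h.integrable_prod_rpow_mul_gauss_mul_euclDot (by linarith) x (a := a)).integral_prod_right
  have hzero : (0 : ℝ) ^ halfDim n a = 0 := Real.zero_rpow (by linarith)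
  have hftc := integral_Ioi_of_hasDerivAt_of_tendsto (a := 0)
    (f := fun t : ℝ => t ^ halfDim n a * ∫ z, ψ z * gauss t x z ∂halfMeasure n a)
    (f' := fun t : ℝ => -(1 / 2) * (t ^ (halfDim n a - 1) *
      ∫ z, gauss t x z * euclDot (euclGrad ψ z) (z - (x, 0)) ∂halfMeasure n a))
    (by
      rw [← continuousWithinAt_Ioi_iff_Ici, ContinuousWithinAt, hzero, zero_mul]
      exact tendsto_rpow_mul_integral_gauss_zero hb hφ x)
    (fun t ht => by
      rw [h.integral_gauss_mul_euclDot t x, ← mul_assoc]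
      exact hasDerivAt_rpow_mul_integral_gauss hφ ht x)
    (hint.const_mul _) (h.tendsto_rpow_mul_integral_gauss_atTop x)
  rw [integral_const_mul, hzero, zero_mul, sub_zero] at hftc
  linarith

end IsTest

lemma differentiableAt_fundKernel {z : Pt n} (hz : 0 < normSq z) :
    DifferentiableAt ℝ (fundKernel n a) z :=
  ((differentiable_normSq z).rpow_const (Or.inl hz.ne')).const_mul _

lemma euclDot_euclGrad_fundKernel [Fact (-1 < a)] (hb : 1 < halfDim n a) {z : Pt n}
    (hz : 0 < normSq z) (w : Pt n) :
    euclDot (euclGrad (fundKernel n a) z) w =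
      -(2 * gaussMass n a)⁻¹ * (Real.Gamma (halfDim n a) * normSq z ^ (-halfDim n a)) *
        euclDot z w := by
  have hmass := gaussMass_pos (n := n) (a := a)
  have hgamma : Real.Gamma (halfDim n a) =
      (halfDim n a - 1) * Real.Gamma (halfDim n a - 1) := by
    rw [← Real.Gamma_add_one (by linarith), sub_add_cancel]
  have hderiv : HasFDerivAt (fundKernel n a) _ z :=
    ((differentiable_normSq z).hasFDerivAt.rpow_const (p := -(halfDim n a - 1))
      (Or.inl hz.ne')).const_mul (Real.Gamma (halfDim n a - 1) / (4 * gaussMass n a))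
  rw [euclDot_euclGrad hderiv.differentiableAt, hderiv.fderiv]
  simp only [smul_apply, smul_eq_mul, fderiv_normSq]
  rw [hgamma, show -(halfDim n a - 1) - 1 = -halfDim n a by ring]
  field_simp
  ring

lemma integral_rpow_mul_gauss {q : ℝ} (hq : 0 < q) {x : EuclideanSpace ℝ (Fin n)} {z : Pt n}
    (hz : 0 < normSq (z - (x, 0))) :
    ∫ t in Ioi (0 : ℝ), t ^ (q - 1) * gauss t x z =
      Real.Gamma q * normSq (z - (x, 0)) ^ (-q) := by
  simp only [gauss, mul_comm _ (normSq (z - (x, 0))), mul_neg]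
  rw [Real.integral_rpow_mul_exp_neg_mul_Ioi hq hz, one_div, Real.inv_rpow hz.le,
    Real.rpow_neg hz.le, mul_comm]

lemma integral_rpow_mul_gauss_mul_euclDot [Fact (-1 < a)] (hb : 1 < halfDim n a)
    {x : EuclideanSpace ℝ (Fin n)} {z : Pt n} (hz : 0 < normSq (z - (x, 0))) (w : Pt n) :
    ∫ t in Ioi (0 : ℝ), t ^ (halfDim n a - 1) * (gauss t x z * euclDot w (z - (x, 0))) =
      -2 * gaussMass n a * euclDot (euclGrad (fundKernel n a) (z - (x, 0))) w := by
  have hmass := gaussMass_pos (n := n) (a := a)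
  simp only [← mul_assoc]
  rw [integral_mul_const, integral_rpow_mul_gauss (by linarith) hz,
    euclDot_euclGrad_fundKernel hb hz, euclDot_comm w]
  field_simp

lemma normSq_pos_of_snd_pos {z : Pt n} (hz : 0 < z.2) : 0 < normSq z := by
  unfold normSq
  positivity

lemma ae_integral_rpow_mul_gauss_mul_euclDot [Fact (-1 < a)] (hb : 1 < halfDim n a)
    (v : Pt n → Pt n) (x : EuclideanSpace ℝ (Fin n)) :
    ∀ᵐ z ∂halfMeasure n a,
      ∫ t in Ioi (0 : ℝ), t ^ (halfDim n a - 1) * (gauss t x z * euclDot (v z) (z - (x, 0))) =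
        -2 * gaussMass n a * euclDot (euclGrad (fundKernel n a) (z - (x, 0))) (v z) := by
  filter_upwards [ae_pos_halfMeasure n a] with z hz
  exact integral_rpow_mul_gauss_mul_euclDot hb (normSq_pos_of_snd_pos (by simpa using hz)) _

lemma IsTest.integrable_euclDot_euclGrad_fundKernel [Fact (-1 < a)] (hb : 1 < halfDim n a)
    {ψ : Pt n → ℝ} (h : IsTest ψ) (x : EuclideanSpace ℝ (Fin n)) :
    Integrable (fun z => euclDot (euclGrad (fundKernel n a) (z - (x, 0))) (euclGrad ψ z))
      (halfMeasure n a) := by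
  have hmass := gaussMass_pos (n := n) (a := a)
  have hprod :=
    h.integrable_prod_rpow_mul_gauss_mul_euclDot (show 0 < halfDim n a by linarith) x
  refine (hprod.integral_prod_left.const_mul (-2 * gaussMass n a)⁻¹).congr ?_
  filter_upwards [ae_integral_rpow_mul_gauss_mul_euclDot hb (euclGrad ψ) x] with z hz
  rw [hz]
  field_simp

lemma IsTest.integral_euclDot_euclGrad_fundKernel [Fact (-1 < a)] (hb : 1 < halfDim n a)
    {ψ : Pt n → ℝ} (h : IsTest ψ) (x : EuclideanSpace ℝ (Fin n)) :
    ∫ z, euclDot (euclGrad (fundKernel n a) (z - (x, 0))) (euclGrad ψ z) ∂halfMeasure n a =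
      ψ (x, 0) := by
  have hmass := gaussMass_pos (n := n) (a := a)
  have hprod :=
    h.integrable_prod_rpow_mul_gauss_mul_euclDot (show 0 < halfDim n a by linarith) x
  have hswap := integral_integral_swap (f := fun z (t : ℝ) => t ^ (halfDim n a - 1) *
    (gauss t x z * euclDot (euclGrad ψ z) (z - (x, 0)))) hprod
  rw [integral_congr_ae (ae_integral_rpow_mul_gauss_mul_euclDot hb (euclGrad ψ) x),
    integral_const_mul] at hswap
  simp only [integral_const_mul] at hswap
  rw [h.integral_rpow_mul_integral_gauss_mul_euclDot hb] at hswap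
  refine mul_left_cancel₀ (show -2 * gaussMass n a ≠ 0 by positivity) (hswap.trans ?_)
  ring

/-- The constant `μ` of `div(|y|^a ∇h) = -μ δ`, chosen so that `h = (μ / 2) fundKernel`; the
factor `1 / 2` is there because `fundKernel` has unit flux through the upper half space alone. -/
def fundConst (n : ℕ) (a : ℝ) : ℝ :=
  8 * nuConst (n + 1 + a) * gaussMass n a / Real.Gamma (halfDim n a - 1)

lemma fundConst_pos [Fact (-1 < a)] (hb : 1 < halfDim n a) : 0 < fundConst n a := by
  have hmass := gaussMass_pos (n := n) (a := a)
  have : 0 < Real.Gamma (halfDim n a - 1) := Real.Gamma_pos_of_pos (by linarith)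
  have hnu : 0 < nuConst (n + 1 + a) := by
    have := Real.Gamma_pos_of_pos (s := ((n : ℝ) + 1 + a - 1) / 2) (by
      unfold halfDim at hb; linarith)
    unfold nuConst
    positivity
  unfold fundConst
  positivity

lemma hFun_eq [Fact (-1 < a)] (hb : 1 < halfDim n a) (z : Pt n) :
    hFun n a z = fundConst n a / 2 * fundKernel n a z := by
  have hmass := gaussMass_pos (n := n) (a := a)
  have hgamma := Real.Gamma_pos_of_pos (s := halfDim n a - 1) (by linarith)
  have hexp : ((n : ℝ) - 1 + a) / 2 = halfDim n a - 1 := by unfold halfDim; ring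
  change nuConst (n + 1 + a) / normSq z ^ (((n : ℝ) - 1 + a) / 2) = _
  rw [hexp, fundConst, fundKernel, Real.rpow_neg (normSq_nonneg z)]
  field_simp
  ring

lemma euclDot_euclGrad_hFun [Fact (-1 < a)] (hb : 1 < halfDim n a) {z : Pt n}
    (hz : 0 < normSq z) (w : Pt n) :
    euclDot (euclGrad (hFun n a) z) w =
      fundConst n a / 2 * euclDot (euclGrad (fundKernel n a) z) w := by
  have hd := differentiableAt_fundKernel (a := a) hz
  rw [funext (hFun_eq hb), euclDot_euclGrad (hd.const_mul _), fderiv_const_mul hd,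
    euclDot_euclGrad hd, smul_apply, smul_eq_mul]

/-- The density `|y|^a ⟨∇h, ∇ψ⟩` of the weak form of `div(|y|^a ∇h)`. -/
def weakDensity (a : ℝ) (ψ : Pt n → ℝ) (z : Pt n) : ℝ :=
  |z.2| ^ a * euclDot (euclGrad (hFun n a) z) (euclGrad ψ z)

section FundamentalConst

variable [Fact (-1 < a)] {ψ : Pt n → ℝ}

lemma ae_euclDot_euclGrad_hFun (hb : 1 < halfDim n a) (v : Pt n → Pt n) :
    ∀ᵐ z ∂halfMeasure n a, fundConst n a / 2 * euclDot (euclGrad (fundKernel n a) z) (v z) =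
      euclDot (euclGrad (hFun n a) z) (v z) := by
  filter_upwards [ae_pos_halfMeasure n a] with z hz
  exact (euclDot_euclGrad_hFun hb (normSq_pos_of_snd_pos hz) _).symm

lemma IsTest.integrableOn_weakDensity (hb : 1 < halfDim n a) (h : IsTest ψ) :
    IntegrableOn (weakDensity a ψ) {z | 0 < z.2} := by
  have hint := h.integrable_euclDot_euclGrad_fundKernel hb 0
  simp only [Prod.mk_zero_zero, sub_zero] at hint
  exact integrable_halfMeasure_iff.1
    ((hint.const_mul _).congr (ae_euclDot_euclGrad_hFun hb (euclGrad ψ)))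

lemma IsTest.setIntegral_weakDensity (hb : 1 < halfDim n a) (h : IsTest ψ) :
    ∫ z in {z : Pt n | 0 < z.2}, weakDensity a ψ z = fundConst n a / 2 * ψ 0 := by
  have hint := h.integral_euclDot_euclGrad_fundKernel hb 0
  simp only [Prod.mk_zero_zero, sub_zero] at hint
  unfold weakDensity
  rw [← integral_halfMeasure, ← integral_congr_ae (ae_euclDot_euclGrad_hFun hb (euclGrad ψ)),
    integral_const_mul, hint]

end FundamentalConst

/-- The reflection `(x, y) ↦ (x, -y)`, which exchanges the two half spaces. -/
def reflect (n : ℕ) : Pt n ≃L[ℝ] Pt n :=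
  (ContinuousLinearEquiv.refl ℝ _).prodCongr (ContinuousLinearEquiv.neg ℝ)

lemma reflect_apply (z : Pt n) : reflect n z = (z.1, -z.2) := rfl

lemma measurePreserving_reflect : MeasurePreserving (reflect n) (volume : Measure (Pt n)) volume :=
  (MeasurePreserving.id volume).prod (Measure.measurePreserving_neg volume)

lemma measurableEmbedding_reflect : MeasurableEmbedding (reflect n) :=
  (reflect n).toHomeomorph.measurableEmbedding

lemma reflect_preimage_lowerHalf : reflect n ⁻¹' {z | z.2 < 0} = {z | 0 < z.2} := by
  ext z
  simp [reflect_apply]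

lemma euclGrad_comp_reflect (f : Pt n → ℝ) (z : Pt n) :
    euclGrad (fun w => f (reflect n w)) z = reflect n (euclGrad f (reflect n z)) :=
  Prod.ext rfl (deriv_comp_neg (fun y => f (z.1, y)) z.2)

lemma euclDot_reflect (z w : Pt n) : euclDot (reflect n z) (reflect n w) = euclDot z w := by
  simp [euclDot, reflect_apply]

lemma hFun_reflect (z : Pt n) : hFun n a (reflect n z) = hFun n a z := by
  simp [hFun, reflect_apply]

lemma IsTest.comp_reflect {ψ : Pt n → ℝ} (h : IsTest ψ) : IsTest fun z => ψ (reflect n z) :=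
  ⟨h.1.comp (reflect n).contDiff, h.2.comp_homeomorph (reflect n).toHomeomorph⟩

lemma weakDensity_reflect (ψ : Pt n → ℝ) (z : Pt n) :
    weakDensity a ψ (reflect n z) = weakDensity a (fun w => ψ (reflect n w)) z := by
  have hgrad : euclGrad (hFun n a) z = reflect n (euclGrad (hFun n a) (reflect n z)) := by
    simpa only [hFun_reflect] using euclGrad_comp_reflect (hFun n a) z
  rw [weakDensity, weakDensity, hgrad, euclGrad_comp_reflect, euclDot_reflect, reflect_apply,
    abs_neg]

lemma isFundamentalConst_fundConst [Fact (-1 < a)] (hb : 1 < halfDim n a) :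
    IsFundamentalConst n a (fundConst n a) := by
  intro ψ hψ
  have hlower : IntegrableOn (weakDensity a ψ) {z | z.2 < 0} := by
    rw [← measurePreserving_reflect.integrableOn_comp_preimage measurableEmbedding_reflect,
      reflect_preimage_lowerHalf]
    simpa only [Function.comp_def, weakDensity_reflect]
      using hψ.comp_reflect.integrableOn_weakDensity hb
  have hlower_eq : ∫ z in {z : Pt n | z.2 < 0}, weakDensity a ψ z = fundConst n a / 2 * ψ 0 := by
    rw [← measurePreserving_reflect.setIntegral_preimage_emb measurableEmbedding_reflect,
      reflect_preimage_lowerHalf]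
    simp only [weakDensity_reflect]
    rw [hψ.comp_reflect.setIntegral_weakDensity hb, map_zero]
  have hhalves : ({z : Pt n | 0 < z.2} ∪ {z | z.2 < 0} : Set (Pt n)) =ᵐ[volume] univ := by
    have hne : ∀ᵐ z : Pt n, z.2 ≠ 0 :=
      Measure.quasiMeasurePreserving_snd.ae (Measure.ae_ne volume 0)
    filter_upwards [hne] with z hz
    exact propext (iff_of_true hz.lt_or_gt.symm trivial)
  have hdisj : Disjoint {z : Pt n | 0 < z.2} {z | z.2 < 0} :=
    disjoint_left.2 fun z (hz : 0 < z.2) (hz' : z.2 < 0) => lt_asymm hz hz'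
  change ∫ z, weakDensity a ψ z = _
  rw [← setIntegral_univ, ← setIntegral_congr_set hhalves, setIntegral_union hdisj
    (measurableSet_lt measurable_snd measurable_const) (hψ.integrableOn_weakDensity hb) hlower,
    hψ.setIntegral_weakDensity hb, hlower_eq]
  ring

/-! ### Capacitary potentials far away from the set -/

theorem IsCapacitaryPotential.exists_potential_ae_eq [Fact (-1 < a)] (hb : 1 < halfDim n a)
    {A K : Set (EuclideanSpace ℝ (Fin n))} {φ : Pt n → ℝ} (h : IsCapacitaryPotential a A φ)
    (hK : IsCompact K) (hAK : A ⊆ K) :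
    ∃ m : Measure (EuclideanSpace ℝ (Fin n)), IsFiniteMeasure m ∧ m univ = sCap a A ∧
      (∀ᵐ x ∂m, x ∈ K) ∧ potential a m =ᵐ[halfMeasure n a] φ := by
  obtain ⟨g, hg, hE⟩ := h
  obtain ⟨m, hfin, hflux, hmass, hsupp⟩ := hg.exists_isBoundaryFlux hE hK hAK
  refine ⟨m, hfin, hmass, hsupp, ?_⟩
  have hφ := hg.isTestLimit.memLp_hardyWeight_mul hb
  have hsub : (fun z => potential a m z - φ z) =ᵐ[halfMeasure n a] 0 := by
    refine ae_eq_zero_of_forall_integral_gauss ?_ fun t ht x => ?_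
    · simp only [sub_mul]
      exact (integrable_potential_mul_gauss m hb one_pos 0).sub (integrable_mul_gauss hφ one_pos 0)
    · simp only [sub_mul]
      rw [integral_sub (integrable_potential_mul_gauss m hb ht x) (integrable_mul_gauss hφ ht x),
        integral_potential_mul_gauss m hb ht x,
        ← hg.isTestLimit.rpow_mul_integral_gauss hb hflux ht x, Real.rpow_neg ht.le,
        inv_mul_cancel_left₀ (Real.rpow_pos_of_pos ht _).ne', sub_self]
  filter_upwards [hsub] with z hz
  exact sub_eq_zero.1 hz

lemma fundKernel_eq_rpow_euclNorm (z : Pt n) :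
    fundKernel n a z = Real.Gamma (halfDim n a - 1) / (4 * gaussMass n a) *
      euclNorm z ^ (-(2 * (halfDim n a - 1))) := by
  rw [fundKernel, ← euclNorm_sq, ← Real.rpow_natCast, ← Real.rpow_mul (euclNorm_nonneg z),
    Nat.cast_ofNat, mul_neg]

lemma fundKernel_eq_rpow_mul (v : Pt n) {w : Pt n} (hw : 0 < euclNorm w) :
    fundKernel n a v =
      (euclNorm v / euclNorm w) ^ (-(2 * (halfDim n a - 1))) * fundKernel n a w := by
  have := (Real.rpow_pos_of_pos hw (-(2 * (halfDim n a - 1)))).ne'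
  rw [fundKernel_eq_rpow_euclNorm, fundKernel_eq_rpow_euclNorm,
    Real.div_rpow (euclNorm_nonneg v) hw.le]
  field_simp

lemma exists_abs_fundKernel_sub_le [Fact (-1 < a)] (hb : 1 < halfDim n a) {δ : ℝ} (hδ : 0 < δ) :
    ∃ τ : ℝ, 0 < τ ∧ τ < 1 ∧ ∀ v w : Pt n, 0 < euclNorm w →
      |euclNorm v - euclNorm w| ≤ τ * euclNorm w →
        |fundKernel n a v - fundKernel n a w| ≤ δ * fundKernel n a w := by
  obtain ⟨η, hη, hpow⟩ := Metric.continuousAt_iff.1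
    (Real.continuousAt_rpow_const 1 (-(2 * (halfDim n a - 1))) (Or.inl one_ne_zero)) δ hδ
  refine ⟨min (η / 2) (1 / 2), by positivity, by norm_num, fun v w hw hvw => ?_⟩
  have hratio : dist (euclNorm v / euclNorm w) 1 < η := by
    rw [Real.dist_eq, div_sub_one hw.ne', abs_div, abs_of_pos hw, div_lt_iff₀ hw]
    refine hvw.trans_lt (mul_lt_mul_of_pos_right ?_ hw)
    exact (min_le_left _ _).trans_lt (half_lt_self hη)
  rw [fundKernel_eq_rpow_mul v hw, ← sub_one_mul, abs_mul, abs_of_nonneg (fundKernel_nonneg hb w)]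
  have hclose := hpow hratio
  rw [Real.one_rpow, Real.dist_eq] at hclose
  exact mul_le_mul_of_nonneg_right hclose.le (fundKernel_nonneg hb w)

lemma abs_euclNorm_sub_mk_sub_le (z : Pt n) (x c : EuclideanSpace ℝ (Fin n)) :
    |euclNorm (z - (x, 0)) - euclNorm (z - (c, 0))| ≤ dist x c := by
  have hdist : euclNorm (z - (x, 0) - (z - (c, 0))) = dist x c := by
    rw [sub_sub_sub_cancel_left, Prod.mk_sub_mk, euclNorm, sub_zero, zero_pow two_ne_zero,
      add_zero, Real.sqrt_sq (norm_nonneg _), dist_comm, dist_eq_norm]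
  rw [← hdist, ← norm_toLp, ← norm_toLp, ← norm_toLp, WithLp.toLp_sub]
  exact abs_norm_sub_norm_le _ _

section FarField

variable (m : Measure (EuclideanSpace ℝ (Fin n))) [IsFiniteMeasure m]

lemma continuousOn_potential [Fact (-1 < a)] (hb : 1 < halfDim n a) {s : Set (Pt n)} {r : ℝ}
    (hr : 0 < r) (hs : ∀ᵐ x ∂m, ∀ z ∈ s, r ≤ normSq (z - (x, 0))) :
    ContinuousOn (potential a m) s := by
  refine continuousOn_of_dominated (bound := fun _ =>
    Real.Gamma (halfDim n a - 1) / (4 * gaussMass n a) * r ^ (-(halfDim n a - 1)))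
    (fun z hz => (integrable_fundKernel_sub m hb hr
      (hs.mono fun x hx => hx z hz)).aestronglyMeasurable)
    (fun z hz => hs.mono fun x hx => ?_) (integrable_const _) (hs.mono fun x hx z hz => ?_)
  · rw [Real.norm_of_nonneg (fundKernel_nonneg hb _), fundKernel]
    exact mul_le_mul_of_nonneg_left
      (Real.rpow_le_rpow_of_nonpos hr (hx z hz) (by linarith)) (gamma_div_gaussMass_pos hb).le
  · have hd : DifferentiableAt ℝ (fundKernel n a) (z - (x, 0)) :=
      differentiableAt_fundKernel (hr.trans_le (hx z hz))
    exact (hd.continuousAt.comp (f := fun z : Pt n => z - (x, 0))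
      (by fun_prop)).continuousWithinAt

lemma abs_potential_sub_le {z w : Pt n} {δ : ℝ}
    (hint : Integrable (fun x => fundKernel n a (z - (x, 0))) m)
    (h : ∀ᵐ x ∂m, |fundKernel n a (z - (x, 0)) - fundKernel n a w| ≤ δ * fundKernel n a w) :
    |potential a m z - m.real univ * fundKernel n a w| ≤
      δ * (m.real univ * fundKernel n a w) := by
  have hdiff : potential a m z - m.real univ * fundKernel n a w =
      ∫ x, (fundKernel n a (z - (x, 0)) - fundKernel n a w) ∂m := by
    rw [integral_sub hint (integrable_const _), integral_const, smul_eq_mul, potential]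
  calc _ = ‖∫ x, (fundKernel n a (z - (x, 0)) - fundKernel n a w) ∂m‖ := by
        rw [hdiff, Real.norm_eq_abs]
    _ ≤ δ * fundKernel n a w * m.real univ := norm_integral_le_of_norm_le_const h
    _ = _ := by ring

end FarField

theorem exists_abs_potential_sub_le (n : ℕ) (a : ℝ) [Fact (-1 < a)] (hb : 1 < halfDim n a)
    {δ : ℝ} (hδ : 0 < δ) :
    ∃ Λ : ℝ, 0 < Λ ∧ ∀ (m : Measure (EuclideanSpace ℝ (Fin n))) [IsFiniteMeasure m]
      (c : EuclideanSpace ℝ (Fin n)) (ρ : ℝ), 0 < ρ → (∀ᵐ x ∂m, x ∈ Metric.closedBall c ρ) →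
        ContinuousOn (potential a m) (farRegion c (Λ * ρ)) ∧
        ∀ z ∈ farRegion c (Λ * ρ),
          |potential a m z - m.real univ * fundKernel n a (z - (c, 0))| ≤
            δ * (m.real univ * fundKernel n a (z - (c, 0))) := by
  obtain ⟨τ, hτ0, hτ1, hclose⟩ := exists_abs_fundKernel_sub_le hb hδ
  refine ⟨τ⁻¹, inv_pos.2 hτ0, fun m _ c ρ hρ hm => ?_⟩
  have hpos : ∀ z ∈ farRegion c (τ⁻¹ * ρ), 0 < euclNorm (z - (c, 0)) := fun z hz =>
    (mul_pos (inv_pos.2 hτ0) hρ).trans_le hz.2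
  have hnear : ∀ z ∈ farRegion c (τ⁻¹ * ρ), ∀ x ∈ Metric.closedBall c ρ,
      |euclNorm (z - (x, 0)) - euclNorm (z - (c, 0))| ≤ τ * euclNorm (z - (c, 0)) :=
    fun z hz x hx => (abs_euclNorm_sub_mk_sub_le z x c).trans
      (hx.trans ((inv_mul_le_iff₀ hτ0).1 hz.2))
  have hlow : ∀ᵐ x ∂m, ∀ z ∈ farRegion c (τ⁻¹ * ρ),
      ((1 - τ) * (τ⁻¹ * ρ)) ^ 2 ≤ normSq (z - (x, 0)) := by
    filter_upwards [hm] with x hx z hz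
    rw [← euclNorm_sq]
    have hτ := sub_pos.2 hτ1
    refine pow_le_pow_left₀ (by positivity) ?_ 2
    linarith [(abs_le.1 (hnear z hz x hx)).1, mul_le_mul_of_nonneg_left hz.2 hτ.le]
  have hr : 0 < ((1 - τ) * (τ⁻¹ * ρ)) ^ 2 := by
    have := sub_pos.2 hτ1
    positivity
  refine ⟨continuousOn_potential m hb hr hlow, fun z hz => abs_potential_sub_le m
    (integrable_fundKernel_sub m hb hr (hlow.mono fun x hx => hx z hz)) ?_⟩
  filter_upwards [hm] with x hx
  exact hclose _ _ (hpos z hz) (hnear z hz x hx)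

theorem exists_abs_capacitaryPotential_sub_le (n : ℕ) (a : ℝ) [Fact (-1 < a)]
    (hb : 1 < halfDim n a) {δ : ℝ} (hδ : 0 < δ) :
    ∃ Λ : ℝ, 0 < Λ ∧ ∀ (A : Set (EuclideanSpace ℝ (Fin n))) (c : EuclideanSpace ℝ (Fin n))
      (ρ : ℝ), 0 < ρ → A ⊆ Metric.closedBall c ρ → ∀ φ, IsCapacitaryPotential a A φ →
        ∃ φ' : Pt n → ℝ, φ' =ᵐ[halfMeasure n a] φ ∧ ContinuousOn φ' (farRegion c (Λ * ρ)) ∧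
          ∀ z ∈ farRegion c (Λ * ρ),
            |φ' z - (sCap a A).toReal * (2 / fundConst n a) * hFun n a (z - (c, 0))| ≤
              δ * ((sCap a A).toReal * (2 / fundConst n a) * hFun n a (z - (c, 0))) := by
  obtain ⟨Λ, hΛ, hfar⟩ := exists_abs_potential_sub_le n a hb hδ
  refine ⟨Λ, hΛ, fun A c ρ hρ hA φ hφ => ?_⟩
  obtain ⟨m, _, hmass, hsupp, hae⟩ :=
    hφ.exists_potential_ae_eq hb (isCompact_closedBall c ρ) hA
  obtain ⟨hcont, hbound⟩ := hfar m c ρ hρ hsupp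
  refine ⟨potential a m, hae, hcont, fun z hz => ?_⟩
  have hμ := (fundConst_pos hb).ne'
  have hmain : (sCap a A).toReal * (2 / fundConst n a) * hFun n a (z - (c, 0)) =
      m.real univ * fundKernel n a (z - (c, 0)) := by
    rw [hFun_eq hb, Measure.real, hmass]
    field_simp
  rw [hmain]
  exact hbound z hz

end FracCap

end

theorem mainTheorem7_general (n : ℕ) (a : ℝ) (ha : -1 < a) (hna : 1 < (n : ℝ) + a) :
    ∃ μ : ℝ, 0 < μ ∧ FracCap.IsFundamentalConst n a μ ∧
      ∀ M : ℝ, 0 < M → ∀ δ : ℝ, 0 < δ → ∃ R : ℝ, 0 < R ∧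
        ∀ (Ω : Type*) [MeasurableSpace Ω] (P : Measure Ω)
          (S : ℝ → (Fin n → ℤ) → Ω → Set (EuclideanSpace ℝ (Fin n)))
          (γ : (Fin n → ℤ) → Ω → ℝ≥0),
          (∀ ε : ℝ, 0 < ε → ∀ k ω,
            FracCap.sCap a (S ε k ω) = ENNReal.ofReal (ε ^ n * (γ k ω : ℝ))) →
          (∀ᵐ ω ∂P, ∀ ε : ℝ, 0 < ε → ∀ k, S ε k ω ⊆
            Metric.closedBall (FracCap.latticePt ε k) (M * FracCap.critSize n a ε)) →
          ∀ᵐ ω ∂P, ∀ ε : ℝ, 0 < ε → ∀ k, ∀ φ : FracCap.Pt n → ℝ,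
            FracCap.IsCapacitaryPotential a (S ε k ω) φ →
            ∃ φ' : FracCap.Pt n → ℝ, φ' =ᵐ[FracCap.halfMeasure n a] φ ∧
              ContinuousOn φ'
                (FracCap.farRegion (FracCap.latticePt ε k) (R * FracCap.critSize n a ε)) ∧
              ∀ z ∈ FracCap.farRegion (FracCap.latticePt ε k) (R * FracCap.critSize n a ε),
                |φ' z - ε ^ n * (γ k ω : ℝ) * (2 / μ) *
                    FracCap.hFun n a (z - (FracCap.latticePt ε k, 0))| ≤
                  δ * (ε ^ n * (γ k ω : ℝ) * (2 / μ) *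
                    FracCap.hFun n a (z - (FracCap.latticePt ε k, 0))) := by
  have : Fact (-1 < a) := ⟨ha⟩
  have hb : 1 < FracCap.halfDim n a := by
    unfold FracCap.halfDim
    linarith
  refine ⟨FracCap.fundConst n a, FracCap.fundConst_pos hb,
    FracCap.isFundamentalConst_fundConst hb, fun M hM δ hδ => ?_⟩
  obtain ⟨Λ, hΛ, hfar⟩ := FracCap.exists_abs_capacitaryPotential_sub_le n a hb hδ
  refine ⟨Λ * M, mul_pos hΛ hM, fun Ω _ P S γ hcap hsub => ?_⟩
  filter_upwards [hsub] with ω hω ε hε k φ hφ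
  have hcapReal : (FracCap.sCap a (S ε k ω)).toReal = ε ^ n * (γ k ω : ℝ) := by
    rw [hcap ε hε, ENNReal.toReal_ofReal (by positivity)]
  simp only [← hcapReal, mul_assoc Λ]
  exact hfar _ _ _ (mul_pos hM (Real.rpow_pos_of_pos hε _)) (hω ε hε k) φ hφ

theorem mainTheorem7 (n : ℕ) (hn : 2 ≤ n) (a : ℝ) (ha : -1 < a) (ha' : a < 1) :
    ∃ μ : ℝ, 0 < μ ∧ FracCap.IsFundamentalConst n a μ ∧
      ∀ M : ℝ, 0 < M → ∀ δ : ℝ, 0 < δ → ∃ R : ℝ, 0 < R ∧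
        ∀ (Ω : Type*) [MeasurableSpace Ω] (P : Measure Ω) [IsProbabilityMeasure P]
          (S : ℝ → (Fin n → ℤ) → Ω → Set (EuclideanSpace ℝ (Fin n)))
          (γ : (Fin n → ℤ) → Ω → ℝ≥0),
          (∀ ε : ℝ, 0 < ε → ∀ k ω,
            FracCap.sCap a (S ε k ω) = ENNReal.ofReal (ε ^ n * (γ k ω : ℝ))) →
          (∀ᵐ ω ∂P, ∀ ε : ℝ, 0 < ε → ∀ k, S ε k ω ⊆
            Metric.closedBall (FracCap.latticePt ε k) (M * FracCap.critSize n a ε)) →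
          ∀ᵐ ω ∂P, ∀ ε : ℝ, 0 < ε → ∀ k, ∀ φ : FracCap.Pt n → ℝ,
            FracCap.IsCapacitaryPotential a (S ε k ω) φ →
            ∃ φ' : FracCap.Pt n → ℝ, φ' =ᵐ[FracCap.halfMeasure n a] φ ∧
              ContinuousOn φ'
                (FracCap.farRegion (FracCap.latticePt ε k) (R * FracCap.critSize n a ε)) ∧
              ∀ z ∈ FracCap.farRegion (FracCap.latticePt ε k) (R * FracCap.critSize n a ε),
                |φ' z - ε ^ n * (γ k ω : ℝ) * (2 / μ) *
                    FracCap.hFun n a (z - (FracCap.latticePt ε k, 0))| ≤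
                  δ * (ε ^ n * (γ k ω : ℝ) * (2 / μ) *
                    FracCap.hFun n a (z - (FracCap.latticePt ε k, 0))) := by
  have hn' : (2 : ℝ) ≤ n := by exact_mod_cast hn
  obtain ⟨μ, hμ, hfund, hmain⟩ := mainTheorem7_general n a ha (by linarith)
  exact ⟨μ, hμ, hfund, fun M hM δ hδ =>
    (hmain M hM δ hδ).imp fun _ h => ⟨h.1, fun Ω _ P _ => h.2 Ω P⟩⟩
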